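/- Let $\Bbbk$ be an algebraically closed field of characteristic $0$ and let $(G,z)$ be a finite supergroup, i.e. $G$ is a finite group and $z\in G$ is central with $z^2=e$ (the case $z=e$ is allowed). For a representation $V$ of $G$ let $V^0,V^1$ be the images of $e^0=\frac{1+z}{2}$, $e^1=\frac{1-z}{2}$. Let $\mathcal A=\mathrm{Rep}(G,z)$ be the category of finite-dimensional representations of $G$ over $\Bbbk$, with the usual tensor product, duals and pivotal structure, and with the braiding $c(x\otimes y)=(-1)^{\sigma\tau}\,y\otimes x$ for $x\in X^\sigma$, $y\in Y^\tau$. Let $X_i$ be representatives of the simple objects, $d_i=\dim X_i$, $\mathcal D=\sum_i d_i^2$; fix square roots $\sqrt{d_i}$, $\sqrt{\mathcal D}$. Let $\mathcal Z(\mathcal A)$ be the Drinfeld center of $\mathcal A$: its objects are pairs $(X,\gamma)$ with a half-braiding $\gamma_A:A\otimes X\to X\otimes A$. It carries the reduced tensor product $\bar\otimes$, as follows. * $(X,\gamma)\bar\otimes(Y,\mu)$ is the image of the idempotent $Q_{\gamma,\mu}=\frac1{\mathcal D}\sum_i d_i\,Q^i_{\gamma,\mu}$ of $X\otimes Y$,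 where, with $A=X_i$, $Q^i_{\gamma,\mu}$ is the composite $$X\otimes Y\to X\otimes A\otimes A^*\otimes Y\xrightarrow{c_{A,X}^{-1}\otimes\mu_{A^*}}A\otimes X\otimes Y\otimes A^*\xrightarrow{\gamma_A\otimes c_{Y,A^*}}X\otimes A\otimes A^*\otimes Y\to X\otimes Y$$ (coevaluation first, evaluation last). Its half-braiding is the restriction of the transformation $(\gamma\bar\otimes\mu)_B:B\otimes X\otimes Y\to X\otimes Y\otimes B$ equal to $\frac1{\mathcal D}\sum_{i,j}d_id_j\sum_\alpha$ of the same composite in which, in the middle, $\varphi_\alpha:B\otimes X_i\to X_j$ is inserted to the left of $X$ and the morphism $X_i^*\to X_j^*\otimes B$ obtained by duality from $\varphi^\alpha:X_j\to B\otimes X_i$ is inserted to the right of $Y$; here $(\varphi_\alpha)$, $(\varphi^\alpha)$ are bases dual to each other for the trace pairing. Tensor products of morphisms and the associativity constraint are the restrictions of those of $\mathcal A$. * The unit object is $I(\mathbf 1)=\bigoplus_iX_i\otimes X_i^*$, with half-braiding $\Gamma_B=\sum_{i,j}\sqrt{d_i}\sqrt{d_j}\sum_\alpha\varphi_\alpha\otimes(\varphi^\alpha)^\sharp$,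 where $(\varphi^\alpha)^\sharp:X_i^*\to X_j^*\otimes B$ is obtained from $\varphi^\alpha$ by duality. The left and right unit constraints are $\sum_i\frac{\sqrt{d_i}}{\sqrt{\mathcal D}}$ times $$X_i\otimes X_i^*\otimes X\xrightarrow{c}X_i\otimes X\otimes X_i^*\xrightarrow{\gamma_{X_i}}X\otimes X_i\otimes X_i^*\to X,\qquad X\otimes X_i\otimes X_i^*\xrightarrow{c^{-1}}X_i\otimes X\otimes X_i^*\xrightarrow{\gamma_{X_i}}X\otimes X_i\otimes X_i^*\to X .$$ * The dual of $(X,\gamma)$ is $(X^*,\gamma^\vee)$, where $\gamma^\vee_A$ is $$A\otimes X^*\xrightarrow{c}X^*\otimes A\to X^*\otimes A\otimes X\otimes X^*\xrightarrow{\gamma_A}X^*\otimes X\otimes A\otimes X^*\to A\otimes X^*\xrightarrow{c}X^*\otimes A,$$ with evaluation and coevaluation given, up to the implicit projections $Q$, by $\sum_i\frac{\sqrt{d_i}}{\sqrt{\mathcal D}}$ times $$X^*\otimes X\to X^*\otimes X_i\otimes X_i^*\otimes X\xrightarrow{\gamma_{X_i^*}}X^*\otimes X_i\otimes X\otimes X_i^*\xrightarrow{c}X^*\otimes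 X\otimes X_i\otimes X_i^*\to X_i\otimes X_i^*,$$ $$X_i\otimes X_i^*\to X_i\otimes X\otimes X^*\otimes X_i^*\xrightarrow{\gamma_{X_i}}X\otimes X_i\otimes X^*\otimes X_i^*\xrightarrow{c}X\otimes X_i\otimes X_i^*\otimes X^*\to X\otimes X^*.$$ The pivotal structure is the natural isomorphism $X\cong X^{**}$ of $\mathcal A$. Let $\mathcal D(G)=\Bbbk[G]\otimes F(G)$ be the Drinfeld double, $(g_1\otimes\delta_{h_1})(g_2\otimes\delta_{h_2})=g_1g_2\otimes\delta_{g_2^{-1}h_1g_2}\delta_{h_2}$, and write $V_g=\delta_gV$, $V_g^\sigma=e^\sigma V_g$ for a finite-dimensional module $V$. The $z$-twisted fiberwise tensor product $V\otimes_zW\subseteq V\otimes W$ is the module with $$(V\otimes_zW)_g=\bigoplus_{\sigma,\tau\in\mathbb Z/2}V^\sigma_{gz^\tau}\otimes W^\tau_{gz^\sigma}$$ on which $G$ acts diagonally; tensor products of morphisms and associativity are the restrictions of the usual ones, the unit is $\bigoplus_{g\in G}\Bbbk_g$, with unit constraints $1_g\otimes v\mapsto v$ and $v\otimes1_g\mapsto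 v$ (on the twisted products), duals are $(V^\vee)_g=(V_g)^*$ with $G$ acting contragrediently, with evaluation the contraction on the even part of each fiber $(V^\vee\otimes_zV)_g$ and zero on the odd part, with coevaluation sending $1_g$ to the $g$-component of $\sum_sv_s\otimes v^s$, and the pivotal structure is the natural isomorphism $V\cong V^{**}$. Let $T:\mathcal Z(\mathcal A)\to\mathcal D(G)\text{-mod}$ send $(X,\gamma)$ to $X$ with its action of $G$ and with $\delta_g\cdot x=\langle\mathrm{id}\otimes\delta_g,\gamma_{\Bbbk[G]}(e\otimes x)\rangle$, and be the identity on underlying linear maps of morphisms. **Theorem.** The above data make $(\mathcal Z(\mathcal A),\bar\otimes)$ and $(\mathcal D(G)\text{-mod},\otimes_z)$ pivotal monoidal categories, and $T$ is an equivalence and a pivotal (strong) monoidal functor $$T:(\mathcal Z(\mathrm{Rep}(G,z)),\bar\otimes)\simeq_\otimes(\mathcal D(G)\text{-mod},\otimes_z).$$ Its tensor constraint $T(X)\otimes_zT(Y)\cong T(X\bar\otimes Y)$ is the identity on underlying vectors: inside $X\otimes Y$, the image of $Q_{\gamma,\mu}$ is $T(X)\otimes_zT(Y)$. -/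

import Mathlib

open CategoryTheory MonoidalCategory TensorProduct

universe u

noncomputable section

namespace RedCenter

variable {k : Type u} [Field k] {G : Type u} [Group G]

/-- The linear map underlying a morphism of representations. -/
def lin {X Y : FDRep k G} (f : X ⟶ Y) : X →ₗ[k] Y := f.hom.hom.hom

/-- A `G`-equivariant linear map as a morphism of representations. -/
def homOf {X Y : FDRep k G} (f : X →ₗ[k] Y) (hf : ∀ g x, f (X.ρ g x) = Y.ρ g (f x)) : X ⟶ Y where
  hom := InducedCategory.homMk (ModuleCat.ofHom f)
  comm g := by
    ext x
    exact hf g x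

@[simp] lemma lin_homOf {X Y : FDRep k G} (f : X →ₗ[k] Y) (hf) : lin (homOf f hf) = f := rfl

lemma lin_injective {X Y : FDRep k G} {f g : X ⟶ Y} (h : lin f = lin g) : f = g := by
  apply Action.Hom.ext
  apply FGModuleCat.hom_ext
  exact h

@[simp] lemma lin_id (X : FDRep k G) : lin (𝟙 X) = LinearMap.id := rfl
@[simp] lemma lin_comp {X Y Z : FDRep k G} (f : X ⟶ Y) (g : Y ⟶ Z) :
    lin (f ≫ g) = lin g ∘ₗ lin f := rfl
@[simp] lemma lin_add {X Y : FDRep k G} (f g : X ⟶ Y) : lin (f + g) = lin f + lin g := rfl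
@[simp] lemma lin_smul {X Y : FDRep k G} (c : k) (g : X ⟶ Y) : lin (c • g) = c • lin g := rfl
@[simp] lemma lin_zero {X Y : FDRep k G} : lin (0 : X ⟶ Y) = 0 := rfl
lemma lin_sum {X Y : FDRep k G} {ι : Type*} (s : Finset ι) (f : ι → (X ⟶ Y)) :
    lin (∑ i ∈ s, f i) = ∑ i ∈ s, lin (f i) := by
  classical
  induction s using Finset.induction_on with
  | empty => simp
  | insert a s ha ih => simp [Finset.sum_insert ha, ih]

lemma lin_ρ {X Y : FDRep k G} (f : X ⟶ Y) (g : G) (x : X) : lin f (X.ρ g x) = Y.ρ g (lin f x) := by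
  have := congrArg (fun h => h.hom.hom x) (f.comm g)
  exact this

/-- The element `x ⊗ y` of the tensor product of two representations. -/
def tm {X Y : FDRep k G} (x : X) (y : Y) : (X ⊗ Y : FDRep k G) := (x ⊗ₜ[k] y : X ⊗[k] Y)

/-- The unit object of the category of representations has underlying space `k`. -/
def un (c : k) : (𝟙_ (FDRep k G) : FDRep k G) := c

lemma tensor_ext {X Y Z : FDRep k G} {f g : (X ⊗ Y : FDRep k G) →ₗ[k] Z}
    (h : ∀ x y, f (tm x y) = g (tm x y)) : f = g :=
  TensorProduct.ext' h

section
variable {X Y Z W : FDRep k G}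
lemma tm_add (x : X) (y y' : Y) : tm x (y + y') = tm x y + tm x y' := TensorProduct.tmul_add x y y'
lemma add_tm (x x' : X) (y : Y) : tm (x + x') y = tm x y + tm x' y := TensorProduct.add_tmul x x' y
lemma tm_smul (c : k) (x : X) (y : Y) : tm x (c • y) = c • tm x y := TensorProduct.tmul_smul c x y
lemma smul_tm (c : k) (x : X) (y : Y) : tm (c • x) y = c • tm x y :=
  (TensorProduct.smul_tmul' c x y).symm
lemma tm_zero (x : X) : tm x (0 : Y) = 0 := TensorProduct.tmul_zero Y x
lemma zero_tm (y : Y) : tm (0 : X) y = 0 := TensorProduct.zero_tmul X y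
lemma tm_sum {ι : Type*} (s : Finset ι) (x : X) (y : ι → Y) :
    tm x (∑ i ∈ s, y i) = ∑ i ∈ s, tm x (y i) := TensorProduct.tmul_sum x s y
lemma sum_tm {ι : Type*} (s : Finset ι) (x : ι → X) (y : Y) :
    tm (∑ i ∈ s, x i) y = ∑ i ∈ s, tm (x i) y := TensorProduct.sum_tmul s x y
@[simp] lemma ρ_tm (g : G) (x : X) (y : Y) :
    (X ⊗ Y : FDRep k G).ρ g (tm x y) = tm (X.ρ g x) (Y.ρ g y) := rfl
@[simp] lemma ρ_un (g : G) (c : k) : (𝟙_ (FDRep k G) : FDRep k G).ρ g (un c) = un c := rfl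
@[simp] lemma lin_whiskerLeft (f : Y ⟶ Z) (x : X) (y : Y) :
    lin (X ◁ f) (tm x y) = tm x (lin f y) := rfl
@[simp] lemma lin_whiskerRight (f : X ⟶ Z) (x : X) (y : Y) :
    lin (f ▷ Y) (tm x y) = tm (lin f x) y := rfl
@[simp] lemma lin_tensorHom (f : X ⟶ Z) (g : Y ⟶ W) (x : X) (y : Y) :
    lin (f ⊗ₘ g) (tm x y) = tm (lin f x) (lin g y) := rfl
@[simp] lemma lin_assoc_hom (x : X) (y : Y) (z : Z) :
    lin (α_ X Y Z).hom (tm (tm x y) z) = tm x (tm y z) := rfl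
@[simp] lemma lin_assoc_inv (x : X) (y : Y) (z : Z) :
    lin (α_ X Y Z).inv (tm x (tm y z)) = tm (tm x y) z := rfl
@[simp] lemma lin_leftUnitor_hom (c : k) (x : X) : lin (λ_ X).hom (tm (un c) x) = c • x := rfl
@[simp] lemma lin_leftUnitor_inv (x : X) : lin (λ_ X).inv x = tm (un 1) x := rfl
@[simp] lemma lin_rightUnitor_hom (c : k) (x : X) : lin (ρ_ X).hom (tm x (un c)) = c • x := rfl
@[simp] lemma lin_rightUnitor_inv (x : X) : lin (ρ_ X).inv x = tm x (un 1) := rfl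
end

/-- The dual representation `X^*`. -/
def dualRep (X : FDRep k G) : FDRep k G := FDRep.of (Representation.dual X.ρ)
end RedCenter

/-- A supergroup structure on a group: a central element `z` with `z² = 1`. -/
class Supergroup (G : Type u) [Group G] where
  z : G
  z_comm : ∀ g : G, g * z = z * g
  z_sq : z * z = 1

namespace RedCenter
open scoped Classical
set_option linter.unusedSectionVars false
section Double
variable (k : Type u) [Field k] (G : Type u) [Group G] [Fintype G]

/-- The Drinfeld double `D(G) = k[G] ⊗ F(G)`; an element is recorded by its coefficients,
`a g h` being the coefficient of `g ⊗ δ_h`. -/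
def DrinfeldDouble : Type u := G → G → k

namespace DrinfeldDouble

instance : AddCommGroup (DrinfeldDouble k G) := inferInstanceAs (AddCommGroup (G → G → k))
instance : Module k (DrinfeldDouble k G) := inferInstanceAs (Module k (G → G → k))

variable {k G}

/-- The basis element `g ⊗ δ_h`. -/
def basis (g h : G) : DrinfeldDouble k G := fun x y => if x = g ∧ y = h then 1 else 0

instance : One (DrinfeldDouble k G) := ⟨fun g _ => if g = 1 then 1 else 0⟩
instance : Mul (DrinfeldDouble k G) :=
  ⟨fun a b g h => ∑ x : G, a (g * x⁻¹) (x * h * x⁻¹) * b x h⟩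

lemma one_def (g h : G) : (1 : DrinfeldDouble k G) g h = if g = 1 then 1 else 0 := rfl
lemma mul_def (a b : DrinfeldDouble k G) (g h : G) :
    (a * b) g h = ∑ x : G, a (g * x⁻¹) (x * h * x⁻¹) * b x h := rfl
lemma add_def (a b : DrinfeldDouble k G) (g h : G) : (a + b) g h = a g h + b g h := rfl
lemma smul_def (c : k) (a : DrinfeldDouble k G) (g h : G) : (c • a) g h = c * a g h := rfl
lemma zero_def (g h : G) : (0 : DrinfeldDouble k G) g h = 0 := rfl
@[ext] lemma ext {a b : DrinfeldDouble k G} (h : ∀ x y, a x y = b x y) : a = b :=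
  funext fun x => funext fun y => h x y

instance : Ring (DrinfeldDouble k G) where
  __ := (inferInstance : AddCommGroup (DrinfeldDouble k G))
  mul_assoc a b c := by
    ext g h
    simp only [mul_def, Finset.sum_mul, Finset.mul_sum]
    rw [Finset.sum_comm]
    conv_rhs => rw [Finset.sum_comm]
    conv_lhs => rw [Finset.sum_comm]
    refine Finset.sum_congr rfl fun x _ => ?_
    refine Fintype.sum_equiv (Equiv.mulRight x) _ _ fun y => ?_
    simp [mul_assoc]
  one_mul a := by
    ext g h
    simp only [mul_def, one_def]
    rw [Finset.sum_eq_single g]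
    · simp
    · intro b _ hb
      rw [if_neg, zero_mul]
      intro h; exact hb (mul_inv_eq_one.mp h).symm
    · simp
  mul_one a := by
    ext g h
    simp only [mul_def, one_def]
    rw [Finset.sum_eq_single 1]
    · simp
    · intro b _ hb
      rw [if_neg hb, mul_zero]
    · simp
  left_distrib a b c := by
    ext g h; simp only [mul_def, add_def, mul_add, Finset.sum_add_distrib]
  right_distrib a b c := by
    ext g h; simp only [mul_def, add_def, add_mul, Finset.sum_add_distrib]
  zero_mul a := by ext g h; simp only [mul_def, zero_def, zero_mul, Finset.sum_const_zero]
  mul_zero a := by ext g h; simp only [mul_def, zero_def, mul_zero, Finset.sum_const_zero]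

instance : Algebra k (DrinfeldDouble k G) := Algebra.ofModule
  (fun c a b => by
    ext g h; simp only [mul_def, smul_def, Finset.mul_sum, mul_assoc])
  (fun c a b => by
    ext g h; simp only [mul_def, smul_def, Finset.mul_sum, mul_left_comm])

/-- The multiplication of `D(G)` on basis elements. -/
theorem basis_mul_basis (g₁ h₁ g₂ h₂ : G) :
    (basis g₁ h₁ * basis g₂ h₂ : DrinfeldDouble k G) =
      if g₂⁻¹ * h₁ * g₂ = h₂ then basis (g₁ * g₂) h₂ else 0 := by
  ext g h
  have e1 : ∀ x, (x = g₂ ∧ h = h₂) ↔ (x = g₂ ∧ h = h₂) := fun _ => Iff.rfl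
  rw [mul_def, Finset.sum_eq_single g₂]
  · simp only [basis]
    by_cases hh : h = h₂
    · subst hh
      by_cases hc : g₂⁻¹ * h₁ * g₂ = h
      · have : g₂ * h * g₂⁻¹ = h₁ := by rw [← hc]; group
        simp [hc, basis, this, mul_inv_eq_iff_eq_mul]
      · have : ¬ (g₂ * h * g₂⁻¹ = h₁) := fun h' => hc (by rw [← h']; group)
        simp [hc, this, zero_def]
    · split_ifs <;> simp_all [zero_def, basis]
  · intro b _ hb
    simp [basis, hb]
  · simp

/-- The group element `g`, that is `g ⊗ 1`. -/
def grp (g : G) : DrinfeldDouble k G := fun x _ => if x = g then 1 else 0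
/-- The function `δ_h`, that is `1 ⊗ δ_h`. -/
def dlt (h : G) : DrinfeldDouble k G := basis 1 h

lemma grp_mul (g g' : G) : (grp g * grp g' : DrinfeldDouble k G) = grp (g * g') := by
  ext x y
  simp only [mul_def, grp]
  rw [Finset.sum_eq_single g'] <;> simp +contextual [mul_inv_eq_iff_eq_mul]
lemma grp_one : (grp 1 : DrinfeldDouble k G) = 1 := rfl
lemma dlt_mul (h h' : G) : (dlt h * dlt h' : DrinfeldDouble k G) = if h = h' then dlt h else 0 := by
  rw [dlt, dlt, basis_mul_basis]
  by_cases hh : h = h' <;> simp [hh]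
lemma grp_mul_dlt (g h : G) : (grp g * dlt h : DrinfeldDouble k G) = basis g h := by
  ext x y
  simp only [mul_def, grp, dlt, basis]
  rw [Finset.sum_eq_single 1] <;> simp +contextual
  split_ifs <;> simp_all
lemma dlt_mul_grp (g h : G) :
    (dlt (g * h * g⁻¹) * grp g : DrinfeldDouble k G) = basis g h := by
  ext x y
  simp only [mul_def, grp, dlt, basis]
  rw [Finset.sum_eq_single g] <;> simp +contextual
  simp [mul_inv_eq_one]
lemma sum_dlt : (∑ h : G, dlt h : DrinfeldDouble k G) = 1 := by
  have : ∀ (s : Finset G) x y, (∑ h ∈ s, dlt h : DrinfeldDouble k G) x y =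
      ∑ h ∈ s, (dlt h : DrinfeldDouble k G) x y := by
    intro s x y
    induction s using Finset.induction_on with
    | empty => simp [zero_def]
    | insert a s ha ih => simp [Finset.sum_insert ha, add_def, ih]
  ext x y
  rw [this, one_def, Finset.sum_eq_single y] <;> simp +contextual [dlt, basis, eq_comm]
lemma eq_sum (a : DrinfeldDouble k G) : a = ∑ g : G, ∑ h : G, a g h • basis g h := by
  have : ∀ (s : Finset G) (f : G → DrinfeldDouble k G) x y, (∑ h ∈ s, f h) x y =
      ∑ h ∈ s, f h x y := by
    intro s f x y
    induction s using Finset.induction_on with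
    | empty => simp [zero_def]
    | insert a s ha ih => simp [Finset.sum_insert ha, add_def, ih]
  ext x y
  rw [this, Finset.sum_eq_single x, this, Finset.sum_eq_single y] <;>
    simp +contextual [smul_def, basis, eq_comm, this]

end DrinfeldDouble

variable {k G}
variable {V W : Type u} [AddCommGroup V] [Module k V] [AddCommGroup W] [Module k W]

/-- A family of orthogonal projections indexed by `G` which is equivariant for conjugation. -/
structure IsGrading (ρ : Representation k G V) (δ : G → Module.End k V) : Prop where
  orth : ∀ g h, δ g * δ h = if g = h then δ g else 0
  conj : ∀ g h, ρ g * δ h = δ (g * h * g⁻¹) * ρ g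

/-- An action of `G` and a complete equivariant family of projections define a
representation of `D(G)`. -/
def liftDouble (ρ : Representation k G V) (δ : G → Module.End k V) (hδ : IsGrading ρ δ)
    (h1 : ∑ g, δ g = 1) : DrinfeldDouble k G →ₐ[k] Module.End k V :=
  AlgHom.ofLinearMap
    { toFun := fun a => ∑ g : G, ∑ h : G, a g h • (ρ g * δ h)
      map_add' := fun a b => by
        simp only [DrinfeldDouble.add_def, add_smul, Finset.sum_add_distrib]
      map_smul' := fun c a => by
        simp only [DrinfeldDouble.smul_def, mul_smul, Finset.smul_sum, RingHom.id_apply] }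
    (by
      simp only [LinearMap.coe_mk, AddHom.coe_mk, DrinfeldDouble.one_def]
      rw [Finset.sum_eq_single 1] <;> simp +contextual [h1])
    (fun a b => by
      have key : ∀ p q x h, (ρ p * δ q) * (ρ x * δ h) =
          if q = x * h * x⁻¹ then ρ (p * x) * δ h else 0 := by
        intro p q x h
        have : δ q * ρ x = ρ x * δ (x⁻¹ * q * x) := by
          rw [hδ.conj]; congr 2; group
        rw [mul_assoc, ← mul_assoc (δ q), this, mul_assoc (ρ x), hδ.orth, ← mul_assoc, ← map_mul]
        by_cases hq : q = x * h * x⁻¹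
        · have : x⁻¹ * q * x = h := by rw [hq]; group
          rw [if_pos this, if_pos hq, this]
        · have : ¬ (x⁻¹ * q * x = h) := fun h' => hq (by rw [← h']; group)
          rw [if_neg this, if_neg hq, mul_zero]
      simp only [LinearMap.coe_mk, AddHom.coe_mk, DrinfeldDouble.mul_def, Finset.sum_smul,
        Finset.sum_mul_sum, Finset.sum_mul, Finset.mul_sum, smul_mul_smul_comm, key]
      simp only [smul_ite, smul_zero]
      have : ∀ p x h, (∑ q : G, if q = x * h * x⁻¹ then (a p q * b x h) • (ρ (p * x) * δ h) else 0)
          = (a p (x * h * x⁻¹) * b x h) • (ρ (p * x) * δ h) := by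
        intro p x h; simp
      calc _ = ∑ h : G, ∑ x : G, ∑ g : G,
            (a (g * x⁻¹) (x * h * x⁻¹) * b x h) • (ρ g * δ h) := by
              rw [Finset.sum_comm]
              refine Finset.sum_congr rfl fun h _ => ?_
              rw [Finset.sum_comm]
        _ = ∑ h : G, ∑ x : G, ∑ p : G,
            (a p (x * h * x⁻¹) * b x h) • (ρ (p * x) * δ h) := by
              refine Finset.sum_congr rfl fun h _ => Finset.sum_congr rfl fun x _ => ?_
              refine Fintype.sum_equiv (Equiv.mulRight x⁻¹) _ _ fun g => by simp
        _ = ∑ h : G, ∑ x : G, ∑ p : G, ∑ q : G,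
            (if q = x * h * x⁻¹ then (a p q * b x h) • (ρ (p * x) * δ h) else 0) := by
              simp only [this]
        _ = _ := Finset.sum_comm)


lemma liftDouble_apply (ρ : Representation k G V) (δ : G → Module.End k V) (hδ : IsGrading ρ δ)
    (h1 : ∑ g, δ g = 1) (a : DrinfeldDouble k G) :
    liftDouble ρ δ hδ h1 a = ∑ g : G, ∑ h : G, a g h • (ρ g * δ h) := rfl
@[simp] lemma liftDouble_grp (ρ : Representation k G V) (δ : G → Module.End k V)
    (hδ : IsGrading ρ δ) (h1 : ∑ g, δ g = 1) (g : G) :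
    liftDouble ρ δ hδ h1 (.grp g) = ρ g := by
  rw [liftDouble_apply, Finset.sum_eq_single g] <;> simp +contextual [DrinfeldDouble.grp]
  rw [← Finset.mul_sum, h1, mul_one]
@[simp] lemma liftDouble_dlt (ρ : Representation k G V) (δ : G → Module.End k V)
    (hδ : IsGrading ρ δ) (h1 : ∑ g, δ g = 1) (h : G) :
    liftDouble ρ δ hδ h1 (.dlt h) = δ h := by
  rw [liftDouble_apply, Finset.sum_eq_single 1, Finset.sum_eq_single h] <;>
    simp +contextual [DrinfeldDouble.dlt, DrinfeldDouble.basis]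

variable (k G) in
/-- Finite-dimensional modules over the Drinfeld double `D(G)`. -/
structure DoubleModule where
  carrier : Type u
  [addCommGroup : AddCommGroup carrier]
  [module : Module k carrier]
  [finite : FiniteDimensional k carrier]
  /-- the action of `D(G)` -/
  act : DrinfeldDouble k G →ₐ[k] Module.End k carrier

namespace DoubleModule
instance : CoeSort (DoubleModule k G) (Type u) := ⟨carrier⟩
attribute [instance] addCommGroup module finite

variable (X Y : DoubleModule k G)

/-- The action of `G ⊆ D(G)`. -/
def ρ : Representation k G X where
  toFun g := X.act (.grp g)
  map_one' := by rw [DrinfeldDouble.grp_one, map_one]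
  map_mul' g h := by rw [← DrinfeldDouble.grp_mul, map_mul]
/-- The action of `δ_g`, that is the projection to the fiber over `g`. -/
def δ (g : G) : Module.End k X := X.act (.dlt g)
/-- The fiber `X_g = δ_g X`. -/
def fiber (g : G) : Submodule k X := LinearMap.range (X.δ g)

lemma isGrading : IsGrading X.ρ X.δ where
  orth g h := by
    simp only [δ]; rw [← map_mul, DrinfeldDouble.dlt_mul]; split_ifs <;> simp
  conj g h := by
    change X.act _ * X.act _ = X.act _ * X.act _
    rw [← map_mul, ← map_mul, DrinfeldDouble.grp_mul_dlt, DrinfeldDouble.dlt_mul_grp]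
lemma sum_δ : ∑ g, X.δ g = 1 := by
  simp only [δ]; rw [← map_sum, DrinfeldDouble.sum_dlt, map_one]

lemma act_eq (a : DrinfeldDouble k G) : X.act a = ∑ g : G, ∑ h : G, a g h • (X.ρ g * X.δ h) := by
  conv_lhs => rw [DrinfeldDouble.eq_sum a]
  simp only [map_sum, map_smul]
  refine Finset.sum_congr rfl fun g _ => Finset.sum_congr rfl fun h _ => ?_
  rw [← DrinfeldDouble.grp_mul_dlt, map_mul]; rfl

/-- The module defined by an action of `G` and a grading. -/
abbrev of {V : Type u} [AddCommGroup V] [Module k V] [FiniteDimensional k V]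
    (ρ : Representation k G V) (δ : G → Module.End k V)
    (hδ : IsGrading ρ δ) (h1 : ∑ g, δ g = 1) : DoubleModule k G where
  carrier := V
  act := liftDouble ρ δ hδ h1

@[simp] lemma of_ρ {V : Type u} [AddCommGroup V] [Module k V] [FiniteDimensional k V]
    (ρ : Representation k G V) (δ : G → Module.End k V) (hδ h1) : (of ρ δ hδ h1).ρ = ρ := by
  ext1 g; exact liftDouble_grp ρ δ hδ h1 g
@[simp] lemma of_δ {V : Type u} [AddCommGroup V] [Module k V] [FiniteDimensional k V]
    (ρ : Representation k G V) (δ : G → Module.End k V) (hδ h1) : (of ρ δ hδ h1).δ = δ := by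
  ext1 g; exact liftDouble_dlt ρ δ hδ h1 g

/-- Morphisms of `D(G)`-modules. -/
@[ext] structure Hom where
  toLin : X →ₗ[k] Y
  comm : ∀ a, toLin ∘ₗ X.act a = Y.act a ∘ₗ toLin

instance : Category (DoubleModule k G) where
  Hom := Hom
  id X := ⟨LinearMap.id, fun _ => rfl⟩
  comp f g := ⟨g.toLin ∘ₗ f.toLin, fun a => by
    rw [LinearMap.comp_assoc, f.comm, ← LinearMap.comp_assoc, g.comm, LinearMap.comp_assoc]⟩

variable {X Y} {Z : DoubleModule k G}
@[simp] lemma id_toLin : Hom.toLin (𝟙 X) = LinearMap.id := rfl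
@[simp] lemma comp_toLin (f : X ⟶ Y) (g : Y ⟶ Z) : (f ≫ g).toLin = g.toLin ∘ₗ f.toLin := rfl
lemma hom_ext {f g : X ⟶ Y} (h : f.toLin = g.toLin) : f = g := Hom.ext h

/-- A linear map commuting with `G` and the grading is a morphism. -/
def homMk (f : X →ₗ[k] Y) (hρ : ∀ g x, f (X.ρ g x) = Y.ρ g (f x))
    (hδ : ∀ g x, f (X.δ g x) = Y.δ g (f x)) : X ⟶ Y where
  toLin := f
  comm a := by
    ext x
    simp [act_eq, hρ, hδ, map_sum]
@[simp] lemma homMk_toLin (f : X →ₗ[k] Y) (hρ hδ) : (homMk f hρ hδ).toLin = f := rfl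
lemma toLin_ρ (f : X ⟶ Y) (g x) : f.toLin (X.ρ g x) = Y.ρ g (f.toLin x) :=
  LinearMap.congr_fun (f.comm (.grp g)) x
lemma toLin_δ (f : X ⟶ Y) (g x) : f.toLin (X.δ g x) = Y.δ g (f.toLin x) :=
  LinearMap.congr_fun (f.comm (.dlt g)) x
end DoubleModule

end Double
end RedCenter

namespace RedCenter
open scoped Classical
set_option linter.unusedSectionVars false
section Twist
open Supergroup (z z_comm z_sq)
variable {k : Type u} [Field k] [CharZero k] {G : Type u} [Group G] [Fintype G] [Supergroup G]
variable {V W : Type u} [AddCommGroup V] [Module k V] [AddCommGroup W] [Module k W]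

/-- The projection `e^σ = (1 + (-1)^σ z) / 2` to the even (`σ = 0`) or odd (`σ = 1`) part. -/
def par (ρ : Representation k G V) (σ : Fin 2) : Module.End k V :=
  (2 : k)⁻¹ • (1 + (-1 : k) ^ (σ : ℕ) • ρ z)

section
variable (ρ : Representation k G V) (δ : G → Module.End k V)
lemma ρ_zz : ρ z * ρ z = 1 := by rw [← map_mul, z_sq, map_one]
lemma par_zero : par ρ 0 = (2 : k)⁻¹ • (1 + ρ z) := by simp [par]
lemma par_one : par ρ 1 = (2 : k)⁻¹ • (1 - ρ z) := by simp [par, sub_eq_add_neg]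
lemma par_add : par ρ 0 + par ρ 1 = 1 := by
  rw [par_zero, par_one, ← smul_add]
  have : (1 + ρ z + (1 - ρ z)) = (2 : k) • (1 : Module.End k V) := by
    rw [two_smul]; abel
  rw [this, smul_smul]; simp
lemma par_mul (σ τ : Fin 2) : par ρ σ * par ρ τ = if σ = τ then par ρ σ else 0 := by
  fin_cases σ <;> fin_cases τ <;>
    simp only [Fin.zero_eta, Fin.mk_one, par_zero, par_one, smul_mul_smul_comm, mul_add, add_mul,
      mul_sub, sub_mul, one_mul, mul_one, ρ_zz, Fin.isValue, if_true, zero_ne_one, one_ne_zero,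
      if_false]
  all_goals module
lemma z_par (σ : Fin 2) : ρ z * par ρ σ = (-1 : k) ^ (σ : ℕ) • par ρ σ := by
  fin_cases σ <;> simp [par, mul_add, ρ_zz, add_comm, sub_eq_add_neg, smul_neg]
lemma par_comm (g : G) (σ : Fin 2) : ρ g * par ρ σ = par ρ σ * ρ g := by
  simp only [par, mul_smul_comm, smul_mul_assoc, mul_add, add_mul, one_mul, mul_one]
  rw [← map_mul, ← map_mul, z_comm]
lemma par_zpow (σ τ : Fin 2) : par ρ σ * ρ (z ^ (τ : ℕ)) = (-1 : k) ^ ((σ : ℕ) * τ) • par ρ σ := by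
  rw [← par_comm]
  fin_cases τ <;> simp [z_par]
lemma par_apply_add (x : V) : par ρ 0 x + par ρ 1 x = x := by
  rw [← LinearMap.add_apply, par_add]; rfl

variable {ρ δ}
lemma IsGrading.par_comm (h : IsGrading ρ δ) (g : G) (σ : Fin 2) :
    par ρ σ * δ g = δ g * par ρ σ := by
  simp only [par, mul_smul_comm, smul_mul_assoc, mul_add, add_mul, one_mul, mul_one]
  rw [h.conj, ← z_comm]; simp
variable (ρ δ)

/-- The regrading `δ_g ↦ δ_g e⁰ + δ_{gz} e¹`. -/
def tw (g : G) : Module.End k V := δ g * par ρ 0 + δ (g * z) * par ρ 1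

variable {ρ δ}
lemma zz (g : G) : g * z * z = g := by rw [mul_assoc, z_sq, mul_one]
lemma tw_par (g : G) (σ : Fin 2) : tw ρ δ g * par ρ σ = δ (g * z ^ (σ : ℕ)) * par ρ σ := by
  fin_cases σ <;> simp [tw, add_mul, mul_assoc, par_mul]
lemma tw_tw (g : G) : tw ρ (tw ρ δ) g = δ g := by
  have h0 := tw_par (ρ := ρ) (δ := δ) g 0
  have h1 := tw_par (ρ := ρ) (δ := δ) (g * z) 1
  rw [tw, h0, h1]
  simp [zz, ← mul_add, par_add]
lemma IsGrading.tw (h : IsGrading ρ δ) : IsGrading ρ (tw ρ δ) where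
  orth g g' := by
    have e : ∀ a b σ τ, (δ a * par ρ σ) * (δ b * par ρ τ) =
        (if σ = τ then (if a = b then δ a * par ρ σ else 0) else 0) := by
      intro a b σ τ
      rw [mul_assoc, ← mul_assoc (par ρ σ), h.par_comm, mul_assoc (δ b), ← mul_assoc, h.orth,
        par_mul]
      split_ifs <;> simp
    simp only [RedCenter.tw, mul_add, add_mul, e]
    by_cases hg : g = g' <;> simp [hg]
  conj g g' := by
    simp only [RedCenter.tw, mul_add, add_mul, mul_assoc]
    rw [← _root_.RedCenter.par_comm, ← _root_.RedCenter.par_comm]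
    simp only [← mul_assoc]
    rw [h.conj, h.conj]
    congr 4
    simp only [mul_assoc]; rw [← z_comm]
lemma sum_tw (h : ∑ g, δ g = 1) : ∑ g, tw ρ δ g = 1 := by
  simp only [tw, Finset.sum_add_distrib, ← Finset.sum_mul, h]
  have : ∑ g, δ (g * z) = 1 := by
    rw [← h]; exact Fintype.sum_equiv (Equiv.mulRight z) _ _ fun _ => rfl
  rw [this, ← mul_add, par_add, one_mul]
lemma δ_par_eq (g : G) (σ : Fin 2) : δ g * par ρ σ = tw ρ δ (g * z ^ (σ : ℕ)) * par ρ σ := by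
  rw [tw_par]; fin_cases σ <;> simp [zz]
end

variable (ρV : Representation k G V) (δV : G → Module.End k V)
variable (ρW : Representation k G W) (δW : G → Module.End k W)

/-- The operator on `V ⊗ W` whose restriction to `V^σ_g ⊗ W^τ_h` is the identity if
`g = b z^τ`, `h = b z^σ`, and zero otherwise. -/
def fiberProj (b : G) : Module.End k (V ⊗[k] W) :=
  ∑ σ : Fin 2, ∑ τ : Fin 2,
    TensorProduct.map (δV (b * z ^ (τ : ℕ)) * par ρV σ) (δW (b * z ^ (σ : ℕ)) * par ρW τ)

lemma par_tprod (σ : Fin 2) : par (ρV.tprod ρW) σ =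
    TensorProduct.map (par ρV 0) (par ρW σ) + TensorProduct.map (par ρV 1) (par ρW (1 - σ)) := by
  apply TensorProduct.ext'
  intro v w
  fin_cases σ <;>
  · simp [par, TensorProduct.add_tmul, TensorProduct.tmul_add, TensorProduct.smul_tmul',
      TensorProduct.neg_tmul, TensorProduct.tmul_neg, TensorProduct.tmul_smul]
    simp only [← TensorProduct.smul_tmul']
    module

lemma fiberProj_eq : fiberProj ρV δV ρW δW = tw (ρV.tprod ρW)
    (fun b => TensorProduct.map (tw ρV δV b) (tw ρW δW b)) := by
  ext1 b
  simp only [fiberProj, δ_par_eq (ρ := ρV) (δ := δV), δ_par_eq (ρ := ρW) (δ := δW), tw.eq_1 (ρV.tprod ρW), par_tprod,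
    mul_add, ← TensorProduct.map_mul, Fin.sum_univ_two, Fin.val_zero, Fin.val_one, pow_zero,
    pow_one, mul_one, zz, sub_zero, sub_self]
  abel
end Twist
end RedCenter

namespace RedCenter
open scoped Classical
set_option linter.unusedSectionVars false
section Tens
open Supergroup (z z_comm z_sq)
variable {k : Type u} [Field k] [CharZero k] {G : Type u} [Group G] [Fintype G] [Supergroup G]

namespace DoubleModule
variable (X Y Z U : DoubleModule k G)

/-- The even or odd part of a fiber, `X^σ_g = e^σ δ_g X`. -/
def piece (σ : Fin 2) (g : G) : Submodule k X := LinearMap.range (X.δ g * par X.ρ σ)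

/-- The `b`-fiber `⨁_{σ,τ} X^σ_{b z^τ} ⊗ Y^τ_{b z^σ}` of the `z`-twisted fiberwise product, as a
subspace of `X ⊗ Y`. -/
def twFiber (b : G) : Submodule k (X ⊗[k] Y) :=
  ⨆ σ : Fin 2, ⨆ τ : Fin 2, LinearMap.range
    (TensorProduct.mapIncl (X.piece σ (b * z ^ (τ : ℕ))) (Y.piece τ (b * z ^ (σ : ℕ))))

/-- The space underlying the `z`-twisted fiberwise product. -/
def twTensor : Submodule k (X ⊗[k] Y) := ⨆ b : G, twFiber X Y b

/-- The projection to the `b`-fiber. -/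
def fproj (b : G) : Module.End k (X ⊗[k] Y) := fiberProj X.ρ X.δ Y.ρ Y.δ b

/-- The grading `δ_g e⁰ + δ_{gz} e¹`: the twisted product is the fiberwise product for it. -/
def δ' (g : G) : Module.End k X := tw X.ρ X.δ g

lemma isGrading' : IsGrading X.ρ X.δ' := X.isGrading.tw
lemma δ'_δ' (g h : G) (x : X) : X.δ' g (X.δ' h x) = if g = h then X.δ' g x else 0 := by
  have := LinearMap.congr_fun (X.isGrading'.orth g h) x
  split_ifs at this ⊢ <;> exact this
@[simp] lemma δ'_δ'_self (g : G) (x : X) : X.δ' g (X.δ' g x) = X.δ' g x := by simp [δ'_δ']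
lemma ρ_δ' (g h : G) (x : X) : X.ρ g (X.δ' h x) = X.δ' (g * h * g⁻¹) (X.ρ g x) :=
  LinearMap.congr_fun (X.isGrading'.conj g h) x
lemma sum_δ' (x : X) : ∑ g, X.δ' g x = x := by
  have := LinearMap.congr_fun (sum_tw (ρ := X.ρ) X.sum_δ) x
  simpa [LinearMap.sum_apply, δ'] using this

lemma rel_grading : IsGrading (X.ρ.tprod Y.ρ)
    (fun b => TensorProduct.map (X.δ' b) (Y.δ' b)) where
  orth g h := by
    rw [← TensorProduct.map_mul, X.isGrading'.orth, Y.isGrading'.orth]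
    split_ifs <;> simp
  conj g h := by
    change TensorProduct.map _ _ * _ = _ * TensorProduct.map _ _
    rw [← TensorProduct.map_mul, ← TensorProduct.map_mul, X.isGrading'.conj, Y.isGrading'.conj]

lemma fproj_eq (b : G) : fproj X Y b =
    tw (X.ρ.tprod Y.ρ) (fun b => TensorProduct.map (X.δ' b) (Y.δ' b)) b := by
  rw [fproj, fiberProj_eq]; rfl

lemma fproj_grading : IsGrading (X.ρ.tprod Y.ρ) (fproj X Y) := by
  have : fproj X Y = tw (X.ρ.tprod Y.ρ) (fun b => TensorProduct.map (X.δ' b) (Y.δ' b)) :=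
    funext (fproj_eq X Y)
  rw [this]; exact (rel_grading X Y).tw

/-- The sum of the projections to the fibers. -/
def tproj : Module.End k (X ⊗[k] Y) := ∑ b, fproj X Y b

lemma tproj_eq : tproj X Y = ∑ b, TensorProduct.map (X.δ' b) (Y.δ' b) := by
  simp only [tproj, fproj_eq, tw, Finset.sum_add_distrib, ← Finset.sum_mul]
  have : ∑ b : G, TensorProduct.map (X.δ' (b * z)) (Y.δ' (b * z)) =
      ∑ b, TensorProduct.map (X.δ' b) (Y.δ' b) :=
    Fintype.sum_equiv (Equiv.mulRight z) _ _ fun _ => rfl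
  rw [this, ← mul_add, par_add, mul_one]

variable {X Y}
lemma range_map_eq {V W V' W' : Type u} [AddCommGroup V] [Module k V] [AddCommGroup W] [Module k W]
    [AddCommGroup V'] [Module k V'] [AddCommGroup W'] [Module k W']
    (f : V →ₗ[k] V') (g : W →ₗ[k] W') :
    LinearMap.range (TensorProduct.mapIncl (LinearMap.range f) (LinearMap.range g)) =
      LinearMap.range (TensorProduct.map f g) := by
  have : TensorProduct.map f g = TensorProduct.mapIncl (LinearMap.range f) (LinearMap.range g) ∘ₗ
      TensorProduct.map f.rangeRestrict g.rangeRestrict := by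
    rw [TensorProduct.mapIncl, ← TensorProduct.map_comp]; rfl
  rw [this, LinearMap.range_comp_of_range_eq_top]
  exact LinearMap.range_eq_top.mpr
    (TensorProduct.map_surjective f.surjective_rangeRestrict g.surjective_rangeRestrict)

lemma fproj_mem_fiber (b : G) (t : X ⊗[k] Y) : fproj X Y b t ∈ twFiber X Y b := by
  simp only [fproj, fiberProj, LinearMap.sum_apply]
  refine Submodule.sum_mem _ fun σ _ => Submodule.sum_mem _ fun τ _ => ?_
  refine Submodule.mem_iSup_of_mem σ (Submodule.mem_iSup_of_mem τ ?_)
  rw [piece, piece, range_map_eq]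
  exact ⟨t, rfl⟩
lemma fproj_mem (b : G) (t : X ⊗[k] Y) : fproj X Y b t ∈ twTensor X Y :=
  Submodule.mem_iSup_of_mem b (fproj_mem_fiber b t)
lemma tproj_mem (t : X ⊗[k] Y) : tproj X Y t ∈ twTensor X Y := by
  rw [tproj, LinearMap.sum_apply]
  exact Submodule.sum_mem _ fun b _ => fproj_mem b t
lemma tproj_of_mem {t : X ⊗[k] Y} (ht : t ∈ twTensor X Y) : tproj X Y t = t := by
  have : twTensor X Y ≤ LinearMap.eqLocus (tproj X Y) LinearMap.id := by
    refine iSup_le fun b => iSup_le fun σ => iSup_le fun τ => ?_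
    rw [piece, piece, range_map_eq]
    rintro _ ⟨s, rfl⟩
    change tproj X Y _ = _
    have hc : b * z ^ (τ : ℕ) * z ^ (σ : ℕ) = b * z ^ (σ : ℕ) * z ^ (τ : ℕ) := by
      rw [mul_assoc, mul_assoc, ← pow_add, ← pow_add, add_comm]
    rw [δ_par_eq (ρ := X.ρ), δ_par_eq (ρ := Y.ρ), hc, TensorProduct.map_mul, tproj_eq,
      ← Module.End.mul_apply, ← mul_assoc, Finset.sum_mul]
    change ((∑ i, _ * TensorProduct.map (X.δ' _) (Y.δ' _)) * _) s = (TensorProduct.map (X.δ' _) (Y.δ' _) * _) s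
    congr 2
    rw [Finset.sum_eq_single (b * z ^ (σ : ℕ) * z ^ (τ : ℕ))]
    · simpa using (rel_grading X Y).orth (b * z ^ (σ : ℕ) * z ^ (τ : ℕ)) (b * z ^ (σ : ℕ) * z ^ (τ : ℕ))
    · intro c _ hc
      simpa [hc] using (rel_grading X Y).orth c (b * z ^ (σ : ℕ) * z ^ (τ : ℕ))
    · simp
  exact this ht
lemma tprod_tproj (g : G) (t : X ⊗[k] Y) :
    (X.ρ.tprod Y.ρ) g (tproj X Y t) = tproj X Y ((X.ρ.tprod Y.ρ) g t) := by
  rw [tproj, LinearMap.sum_apply, LinearMap.sum_apply, map_sum]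
  refine Fintype.sum_equiv (MulAut.conj g).toEquiv _ _ fun b => ?_
  exact LinearMap.congr_fun ((fproj_grading X Y).conj g b) t
lemma tprod_mem (g : G) {t : X ⊗[k] Y} (ht : t ∈ twTensor X Y) :
    (X.ρ.tprod Y.ρ) g t ∈ twTensor X Y := by
  rw [← tproj_of_mem ht, tprod_tproj]; exact tproj_mem _

variable (X Y)
/-- The diagonal action of `G` on the twisted product. -/
def tensρ : Representation k G (twTensor X Y) where
  toFun g := ((X.ρ.tprod Y.ρ) g).restrict fun _ ht => tprod_mem g ht
  map_one' := by ext t; simp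
  map_mul' g h := by ext t; exact LinearMap.congr_fun (map_mul (X.ρ.tprod Y.ρ) g h) t.1

/-- The grading of the twisted product. -/
def tensδ (b : G) : Module.End k (twTensor X Y) :=
  (fproj X Y b).restrict fun t _ => fproj_mem b t

lemma tens_grading : IsGrading (tensρ X Y) (tensδ X Y) where
  orth g h := by
    ext t
    have := LinearMap.congr_fun ((fproj_grading X Y).orth g h) t
    split_ifs at this ⊢ <;> exact this
  conj g h := by
    ext t
    exact LinearMap.congr_fun ((fproj_grading X Y).conj g h) t.1
lemma sum_tensδ : ∑ b, tensδ X Y b = 1 := by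
  ext t
  have := tproj_of_mem t.2
  rw [tproj, LinearMap.sum_apply] at this
  simpa [LinearMap.sum_apply, tensδ] using this

/-- The `z`-twisted fiberwise tensor product of `D(G)`-modules. -/
def tens : DoubleModule k G := .of (tensρ X Y) (tensδ X Y) (tens_grading X Y) (sum_tensδ X Y)

/-- The inclusion of the twisted product in the tensor product. -/
def J : tens X Y →ₗ[k] X ⊗[k] Y := (twTensor X Y).subtype
/-- The projection onto the twisted product. -/
def R : X ⊗[k] Y →ₗ[k] tens X Y := (tproj X Y).codRestrict _ tproj_mem

variable {X Y Z U}
lemma J_injective : Function.Injective (J X Y) := Subtype.val_injective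
@[simp] lemma J_R (t) : J X Y (R X Y t) = tproj X Y t := rfl
@[simp] lemma R_J (t) : R X Y (J X Y t) = t := J_injective (tproj_of_mem t.2)

/-- The image of `x ⊗ y` in the twisted product. -/
def tz (x : X) (y : Y) : tens X Y := R X Y (x ⊗ₜ y)

lemma J_tz (x : X) (y : Y) : J X Y (tz x y) = ∑ b, X.δ' b x ⊗ₜ Y.δ' b y := by
  simp [tz, tproj_eq, LinearMap.sum_apply]
lemma tens_δ : (tens X Y).δ = tensδ X Y := of_δ _ _ _ _
lemma tens_ρ : (tens X Y).ρ = tensρ X Y := of_ρ _ _ _ _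
@[simp] lemma tens_ρ_tz (g : G) (x : X) (y : Y) : (tens X Y).ρ g (tz x y) = tz (X.ρ g x) (Y.ρ g y) := by
  rw [tens_ρ]
  apply J_injective
  exact tprod_tproj g (x ⊗ₜ y)
lemma J_δ (b : G) (t : tens X Y) : J X Y ((tens X Y).δ b t) = fproj X Y b (J X Y t) := by
  rw [tens_δ]; rfl
lemma J_ρ (b : G) (t : tens X Y) : J X Y ((tens X Y).ρ b t) = (X.ρ.tprod Y.ρ) b (J X Y t) := by
  rw [tens_ρ]; rfl
lemma J_δ' (b : G) (t : tens X Y) :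
    J X Y ((tens X Y).δ' b t) = TensorProduct.map (X.δ' b) (Y.δ' b) (J X Y t) := by
  have hp : ∀ σ (t : tens X Y), J X Y (par (tens X Y).ρ σ t) = par (X.ρ.tprod Y.ρ) σ (J X Y t) := by
    intro σ t
    simp [par, J_ρ]
  have : J X Y ((tens X Y).δ' b t) = tw (X.ρ.tprod Y.ρ) (fproj X Y) b (J X Y t) := by
    simp only [δ', tw, LinearMap.add_apply, Module.End.mul_apply, map_add, J_δ, hp]
  rw [this]
  have e : fproj X Y = tw (X.ρ.tprod Y.ρ) (fun b => TensorProduct.map (X.δ' b) (Y.δ' b)) :=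
    funext (fproj_eq X Y)
  rw [e, tw_tw]

lemma tz_left (b : G) (x : X) (y : Y) : tz (X.δ' b x) y = (tens X Y).δ' b (tz x y) := by
  apply J_injective
  rw [J_δ', J_tz, J_tz, map_sum]
  refine Finset.sum_congr rfl fun c _ => ?_
  simp only [TensorProduct.map_tmul, δ'_δ']
  by_cases h : c = b
  · simp [h]
  · simp [h, Ne.symm h]
lemma tz_right (b : G) (x : X) (y : Y) : tz x (Y.δ' b y) = (tens X Y).δ' b (tz x y) := by
  apply J_injective
  rw [J_δ', J_tz, J_tz, map_sum]
  refine Finset.sum_congr rfl fun c _ => ?_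
  simp only [TensorProduct.map_tmul, δ'_δ']
  by_cases h : c = b
  · simp [h]
  · simp [h, Ne.symm h]
lemma tz_mid (b : G) (x : X) (y : Y) : tz (X.δ' b x) y = tz x (Y.δ' b y) := by
  rw [tz_left, tz_right]

lemma tz_add (x : X) (y y' : Y) : tz x (y + y') = tz x y + tz x y' := by
  simp [tz, TensorProduct.tmul_add]
lemma add_tz (x x' : X) (y : Y) : tz (x + x') y = tz x y + tz x' y := by
  simp [tz, TensorProduct.add_tmul]
lemma tz_smul (c : k) (x : X) (y : Y) : tz x (c • y) = c • tz x y := by simp [tz]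
lemma smul_tz (c : k) (x : X) (y : Y) : tz (c • x) y = c • tz x y := by
  simp [tz, ← TensorProduct.smul_tmul']
lemma tz_sum {ι : Type*} (s : Finset ι) (x : X) (y : ι → Y) :
    tz x (∑ i ∈ s, y i) = ∑ i ∈ s, tz x (y i) := by simp [tz, TensorProduct.tmul_sum]
lemma sum_tz {ι : Type*} (s : Finset ι) (x : ι → X) (y : Y) :
    tz (∑ i ∈ s, x i) y = ∑ i ∈ s, tz (x i) y := by simp [tz, TensorProduct.sum_tmul]

lemma tens_lin_ext {V : Type*} [AddCommGroup V] [Module k V] {f g : tens X Y →ₗ[k] V}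
    (h : ∀ x y, f (tz x y) = g (tz x y)) : f = g := by
  have : f ∘ₗ R X Y = g ∘ₗ R X Y := TensorProduct.ext' h
  ext t
  rw [← R_J t]
  exact LinearMap.congr_fun this _
lemma tens_hom_ext {f g : tens X Y ⟶ Z} (h : ∀ x y, f.toLin (tz x y) = g.toLin (tz x y)) : f = g :=
  hom_ext (tens_lin_ext h)
lemma tens_lin_ext3 {V : Type*} [AddCommGroup V] [Module k V] {f g : tens (tens X Y) Z →ₗ[k] V}
    (h : ∀ x y w, f (tz (tz x y) w) = g (tz (tz x y) w)) : f = g := by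
  refine tens_lin_ext fun t w => ?_
  let A (f : tens (tens X Y) Z →ₗ[k] V) : tens X Y →ₗ[k] V :=
    { toFun := fun t => f (tz t w)
      map_add' := fun a b => by rw [add_tz, map_add]
      map_smul' := fun a b => by rw [smul_tz, map_smul]; rfl }
  have : A f = A g := tens_lin_ext fun x y => h x y w
  exact LinearMap.congr_fun this t
lemma tens_lin_ext3' {V : Type*} [AddCommGroup V] [Module k V] {f g : tens X (tens Y Z) →ₗ[k] V}
    (h : ∀ x y w, f (tz x (tz y w)) = g (tz x (tz y w))) : f = g := by
  refine tens_lin_ext fun w t => ?_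
  let A (f : tens X (tens Y Z) →ₗ[k] V) : tens Y Z →ₗ[k] V :=
    { toFun := fun t => f (tz w t)
      map_add' := fun a b => by rw [tz_add, map_add]
      map_smul' := fun a b => by rw [tz_smul, map_smul]; rfl }
  have : A f = A g := tens_lin_ext fun x y => h w x y
  exact LinearMap.congr_fun this t
lemma tens_lin_ext4 {V : Type*} [AddCommGroup V] [Module k V]
    {f g : tens (tens (tens X Y) Z) U →ₗ[k] V}
    (h : ∀ x y w u, f (tz (tz (tz x y) w) u) = g (tz (tz (tz x y) w) u)) : f = g := by
  refine tens_lin_ext fun t u => ?_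
  let A (f : tens (tens (tens X Y) Z) U →ₗ[k] V) : tens (tens X Y) Z →ₗ[k] V :=
    { toFun := fun t => f (tz t u)
      map_add' := fun a b => by rw [add_tz, map_add]
      map_smul' := fun a b => by rw [smul_tz, map_smul]; rfl }
  have : A f = A g := tens_lin_ext3 fun x y w => h x y w u
  exact LinearMap.congr_fun this t

/-- Commuting with `δ'` is the same as commuting with `δ`. -/
lemma comm_δ_of_δ' (f : X →ₗ[k] Y) (hρ : ∀ g x, f (X.ρ g x) = Y.ρ g (f x))
    (hδ : ∀ g x, f (X.δ' g x) = Y.δ' g (f x)) (g : G) (x : X) : f (X.δ g x) = Y.δ g (f x) := by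
  have hp : ∀ σ x, f (par X.ρ σ x) = par Y.ρ σ (f x) := by
    intro σ x; simp [par, hρ]
  rw [← tw_tw (ρ := X.ρ) (δ := X.δ), ← tw_tw (ρ := Y.ρ) (δ := Y.δ)]
  simp only [tw.eq_1 X.ρ (tw X.ρ X.δ), tw.eq_1 Y.ρ (tw Y.ρ Y.δ), LinearMap.add_apply,
    Module.End.mul_apply, map_add]
  have := hδ
  simp only [δ'] at this
  simp only [this, hp]
lemma toLin_δ' (f : X ⟶ Y) (g : G) (x : X) : f.toLin (X.δ' g x) = Y.δ' g (f.toLin x) := by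
  have hp : ∀ σ x, f.toLin (par X.ρ σ x) = par Y.ρ σ (f.toLin x) := by
    intro σ x; simp [par, toLin_ρ]
  simp [δ', tw, hp, toLin_δ]

/-- Morphisms out of a twisted product, checked on generators. -/
def homTens (f : tens X Y →ₗ[k] Z) (hρ : ∀ g x y, f (tz (X.ρ g x) (Y.ρ g y)) = Z.ρ g (f (tz x y)))
    (hδ : ∀ g x y, f (tz (X.δ' g x) y) = Z.δ' g (f (tz x y))) : tens X Y ⟶ Z :=
  homMk f
    (fun g t => by
      have : f ∘ₗ (tens X Y).ρ g = Z.ρ g ∘ₗ f :=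
        tens_lin_ext fun x y => by simp [hρ]
      exact LinearMap.congr_fun this t)
    (fun g t => by
      refine comm_δ_of_δ' f ?_ ?_ g t
      · intro g t
        have : f ∘ₗ (tens X Y).ρ g = Z.ρ g ∘ₗ f :=
          tens_lin_ext fun x y => by simp [hρ]
        exact LinearMap.congr_fun this t
      · intro g t
        have : f ∘ₗ (tens X Y).δ' g = Z.δ' g ∘ₗ f :=
          tens_lin_ext fun x y => by simp [← tz_left, hδ]
        exact LinearMap.congr_fun this t)
@[simp] lemma homTens_toLin (f : tens X Y →ₗ[k] Z) (hρ hδ) : (homTens f hρ hδ).toLin = f := rfl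

end DoubleModule
end Tens
end RedCenter

namespace RedCenter
open scoped Classical
set_option linter.unusedSectionVars false
section Mon
open Supergroup (z z_comm z_sq)
variable {k : Type u} [Field k] [CharZero k] {G : Type u} [Group G] [Fintype G] [Supergroup G]

namespace DoubleModule
variable {X Y Z U X' Y' Z' : DoubleModule k G}

/-- The unit: each fiber is `k`. -/
def unitρ : Representation k G (G → k) where
  toFun g := LinearMap.funLeft k k (fun h => g⁻¹ * h * g)
  map_one' := by ext f h; simp
  map_mul' a b := by
    apply LinearMap.ext; intro f; funext h
    simp [LinearMap.funLeft_apply, mul_assoc]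
/-- The grading of the unit. -/
def unitδ (g : G) : Module.End k (G → k) := LinearMap.single k (fun _ => k) g ∘ₗ LinearMap.proj g

lemma unitδ_apply (g : G) (f : G → k) (h : G) : unitδ g f h = if h = g then f g else 0 := by
  by_cases hh : h = g <;> simp [unitδ, hh]
lemma unitρ_apply (g : G) (f : G → k) (h : G) : unitρ g f h = f (g⁻¹ * h * g) := rfl
lemma unit_grading : IsGrading (k := k) (G := G) unitρ unitδ where
  orth g h := by
    apply LinearMap.ext; intro f; funext x
    rw [Module.End.mul_apply, unitδ_apply]
    by_cases hg : g = h <;> by_cases hx : x = g <;> simp [unitδ_apply, hg, hx]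
  conj g h := by
    apply LinearMap.ext; intro f; funext x
    simp only [Module.End.mul_apply, unitδ_apply, unitρ_apply]
    have : g⁻¹ * x * g = h ↔ x = g * h * g⁻¹ := by
      constructor
      · rintro rfl; group
      · rintro rfl; group
    have h2 : g⁻¹ * (g * h * g⁻¹) * g = h := by group
    simp [this, h2]
lemma sum_unitδ : ∑ g : G, unitδ (k := k) g = 1 := by
  apply LinearMap.ext; intro f; funext x
  simp [LinearMap.sum_apply, Finset.sum_apply, unitδ_apply]

variable (k G) in
/-- The unit object `⨁_g k_g` of the twisted product. -/
def unit : DoubleModule k G := .of unitρ unitδ unit_grading sum_unitδ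

/-- The basis vector of the fiber of the unit over `h`. -/
def sgl (h : G) : unit k G := Pi.single h (1 : k)
/-- The sum of the coordinates of an element of the unit. -/
def tot : unit k G →ₗ[k] k := ∑ g : G, LinearMap.proj (R := k) (φ := fun _ : G => k) g

@[simp] lemma tot_sgl (h : G) : tot (k := k) (sgl h) = 1 := by
  have : tot (k := k) (sgl h) = ∑ g : G, (Pi.single h (1 : k) : G → k) g := by
    change (∑ g : G, LinearMap.proj (R := k) (φ := fun _ : G => k) g) (Pi.single h (1 : k)) = _
    rw [LinearMap.sum_apply]; rfl
  rw [this]; simp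
lemma unit_ρ : (unit k G).ρ = unitρ := of_ρ _ _ _ _
lemma unit_δ : (unit k G).δ = unitδ := of_δ _ _ _ _
@[simp] lemma unit_ρ_sgl (g h : G) : (unit k G).ρ g (sgl h) = sgl (g * h * g⁻¹) := by
  rw [unit_ρ]
  funext x
  change (Pi.single h (1 : k) : G → k) (g⁻¹ * x * g) = (Pi.single (g * h * g⁻¹) (1 : k) : G → k) x
  rw [Pi.single_apply, Pi.single_apply]
  congr 1
  apply propext
  constructor
  · rintro rfl; group
  · rintro rfl; group
lemma unit_δ_sgl (g h : G) : (unit k G).δ g (sgl h) = if g = h then sgl h else 0 := by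
  rw [unit_δ]
  have : ∀ x, unitδ (k := k) g (Pi.single h (1 : k) : G → k) x =
      (if g = h then (Pi.single h (1 : k) : G → k) else 0) x := by
    intro x
    rw [unitδ_apply]
    by_cases hg : g = h
    · subst hg; simp [Pi.single_apply]
    · simp [hg]
  funext x
  refine (this x).trans ?_
  split_ifs <;> rfl
lemma unit_ext {V : Type*} [AddCommGroup V] [Module k V] {f g : unit k G →ₗ[k] V}
    (h : ∀ a, f (sgl a) = g (sgl a)) : f = g := by
  apply LinearMap.pi_ext'
  intro a
  ext
  exact h a
lemma unit_δ'_sgl (g h : G) : (unit k G).δ' g (sgl h) = if g = h then sgl h else 0 := by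
  have hz : (unit k G).ρ z = 1 := unit_ext fun a => by
    rw [unit_ρ_sgl, ← z_comm]; simp
  have h0 : par (unit k G).ρ 0 = 1 := by
    rw [par_zero, hz]; module
  have h1 : par (unit k G).ρ 1 = 0 := by
    rw [par_one, hz]; simp
  rw [δ', tw, h0, h1]
  simpa using unit_δ_sgl g h

lemma R_sum (x : X) (y : Y) : R X Y (∑ b, X.δ' b x ⊗ₜ Y.δ' b y) = tz x y := by
  rw [← J_tz, R_J]

/-- The tensor product of morphisms, restricted to the twisted product. -/
def mapLin (f : X ⟶ X') (g : Y ⟶ Y') : tens X Y →ₗ[k] tens X' Y' :=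
  R X' Y' ∘ₗ TensorProduct.map f.toLin g.toLin ∘ₗ J X Y
@[simp] lemma mapLin_tz (f : X ⟶ X') (g : Y ⟶ Y') (x : X) (y : Y) :
    mapLin f g (tz x y) = tz (f.toLin x) (g.toLin y) := by
  simp only [mapLin, LinearMap.comp_apply, J_tz, map_sum, TensorProduct.map_tmul, toLin_δ']
  rw [← map_sum, R_sum]
/-- The tensor product of morphisms. -/
def tensHom (f : X ⟶ X') (g : Y ⟶ Y') : tens X Y ⟶ tens X' Y' :=
  homTens (mapLin f g) (fun a x y => by simp [toLin_ρ])
    (fun a x y => by rw [mapLin_tz, mapLin_tz, toLin_δ', tz_left])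

variable (X Y Z)
/-- The associativity constraint is that of vector spaces, restricted to twisted products. -/
def assocLin : tens (tens X Y) Z →ₗ[k] tens X (tens Y Z) :=
  R X (tens Y Z) ∘ₗ (R Y Z).lTensor X ∘ₗ (TensorProduct.assoc k X Y Z).toLinearMap ∘ₗ
    (J X Y).rTensor Z ∘ₗ J (tens X Y) Z
/-- The inverse of the associativity constraint. -/
def assocInvLin : tens X (tens Y Z) →ₗ[k] tens (tens X Y) Z :=
  R (tens X Y) Z ∘ₗ (R X Y).rTensor Z ∘ₗ (TensorProduct.assoc k X Y Z).symm.toLinearMap ∘ₗ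
    (J Y Z).lTensor X ∘ₗ J X (tens Y Z)
variable {X Y Z}
lemma tz_δ'_sum (x : X) (y : Y) : ∑ b, tz (X.δ' b x) (Y.δ' b y) = tz x y := by
  simp only [tz_right, tz_left, δ'_δ'_self, sum_δ']
@[simp] lemma assocLin_tz (x : X) (y : Y) (w : Z) :
    assocLin X Y Z (tz (tz x y) w) = tz x (tz y w) := by
  simp only [assocLin, LinearMap.comp_apply, J_tz, map_sum, LinearMap.rTensor_tmul, ← tz_left,
    TensorProduct.sum_tmul, δ'_δ']
  refine Eq.trans (b := ∑ b, tz (X.δ' b x) (tz (Y.δ' b y) (Z.δ' b w))) ?_ ?_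
  · refine Finset.sum_congr rfl fun b _ => ?_
    rw [Finset.sum_eq_single b]
    · rw [if_pos rfl]; rfl
    · intro c _ hc; rw [if_neg hc]; simp
    · simp
  simp only [tz_right, tz_left, δ'_δ'_self, sum_δ']
@[simp] lemma assocInvLin_tz (x : X) (y : Y) (w : Z) :
    assocInvLin X Y Z (tz x (tz y w)) = tz (tz x y) w := by
  simp only [assocInvLin, LinearMap.comp_apply, J_tz, map_sum, LinearMap.lTensor_tmul, ← tz_left,
    TensorProduct.tmul_sum, δ'_δ']
  refine Eq.trans (b := ∑ b, tz (tz (X.δ' b x) (Y.δ' b y)) (Z.δ' b w)) ?_ ?_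
  · refine Finset.sum_congr rfl fun b _ => ?_
    rw [Finset.sum_eq_single b]
    · rw [if_pos rfl]; rfl
    · intro c _ hc; rw [if_neg hc]; simp
    · simp
  simp only [tz_right, tz_left, δ'_δ'_self, sum_δ']

/-- Morphisms out of an iterated twisted product, checked on generators. -/
def homTens3 (f : tens (tens X Y) Z →ₗ[k] U)
    (hρ : ∀ g x y w, f (tz (tz (X.ρ g x) (Y.ρ g y)) (Z.ρ g w)) = U.ρ g (f (tz (tz x y) w)))
    (hδ : ∀ g x y w, f (tz (tz (X.δ' g x) y) w) = U.δ' g (f (tz (tz x y) w))) :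
    tens (tens X Y) Z ⟶ U :=
  have h1 : ∀ g t, f ((tens (tens X Y) Z).ρ g t) = U.ρ g (f t) := fun g t => by
      have : f ∘ₗ (tens (tens X Y) Z).ρ g = U.ρ g ∘ₗ f :=
        tens_lin_ext3 fun x y w => by simp [hρ]
      exact LinearMap.congr_fun this t
  homMk f h1 (comm_δ_of_δ' f h1 fun g t => by
        have : f ∘ₗ (tens (tens X Y) Z).δ' g = U.δ' g ∘ₗ f :=
          tens_lin_ext3 fun x y w => by simp [← tz_left, hδ]
        exact LinearMap.congr_fun this t)
/-- Morphisms out of an iterated twisted product, checked on generators. -/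
def homTens3' (f : tens X (tens Y Z) →ₗ[k] U)
    (hρ : ∀ g x y w, f (tz (X.ρ g x) (tz (Y.ρ g y) (Z.ρ g w))) = U.ρ g (f (tz x (tz y w))))
    (hδ : ∀ g x y w, f (tz (X.δ' g x) (tz y w)) = U.δ' g (f (tz x (tz y w)))) :
    tens X (tens Y Z) ⟶ U :=
  have h1 : ∀ g t, f ((tens X (tens Y Z)).ρ g t) = U.ρ g (f t) := fun g t => by
      have : f ∘ₗ (tens X (tens Y Z)).ρ g = U.ρ g ∘ₗ f :=
        tens_lin_ext3' fun x y w => by simp [hρ]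
      exact LinearMap.congr_fun this t
  homMk f h1 (comm_δ_of_δ' f h1 fun g t => by
        have : f ∘ₗ (tens X (tens Y Z)).δ' g = U.δ' g ∘ₗ f :=
          tens_lin_ext3' fun x y w => by simp [← tz_left, hδ]
        exact LinearMap.congr_fun this t)

variable (X Y Z) in
/-- The associativity constraint. -/
def assocIso : tens (tens X Y) Z ≅ tens X (tens Y Z) where
  hom := homTens3 (assocLin X Y Z) (fun g x y w => by simp)
    (fun g x y w => by rw [assocLin_tz, assocLin_tz, tz_left])
  inv := homTens3' (assocInvLin X Y Z) (fun g x y w => by simp)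
    (fun g x y w => by rw [assocInvLin_tz, assocInvLin_tz, tz_left, tz_left])
  hom_inv_id := hom_ext (tens_lin_ext3 fun x y w => by simp [homTens3, homTens3'])
  inv_hom_id := hom_ext (tens_lin_ext3' fun x y w => by simp [homTens3, homTens3'])
@[simp] lemma assocIso_hom_toLin : (assocIso X Y Z).hom.toLin = assocLin X Y Z := rfl
@[simp] lemma assocIso_inv_toLin : (assocIso X Y Z).inv.toLin = assocInvLin X Y Z := rfl
@[simp] lemma tensHom_toLin (f : X ⟶ X') (g : Y ⟶ Y') : (tensHom f g).toLin = mapLin f g := rfl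

variable (X) in
/-- `1_g ⊗ x ↦ x` on the twisted product. -/
def lunitLin : tens (unit k G) X →ₗ[k] X :=
  (TensorProduct.lid k X).toLinearMap ∘ₗ tot.rTensor X ∘ₗ J (unit k G) X
variable (X) in
/-- `x ⊗ 1_g ↦ x` on the twisted product. -/
def runitLin : tens X (unit k G) →ₗ[k] X :=
  (TensorProduct.rid k X).toLinearMap ∘ₗ tot.lTensor X ∘ₗ J X (unit k G)

@[simp] lemma lunitLin_tz (h : G) (x : X) : lunitLin X (tz (sgl h) x) = X.δ' h x := by
  simp only [lunitLin, LinearMap.comp_apply, J_tz, map_sum, unit_δ'_sgl, LinearMap.rTensor_tmul]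
  rw [Finset.sum_eq_single h] <;> simp +contextual
@[simp] lemma runitLin_tz (h : G) (x : X) : runitLin X (tz x (sgl h)) = X.δ' h x := by
  simp only [runitLin, LinearMap.comp_apply, J_tz, map_sum, unit_δ'_sgl, LinearMap.lTensor_tmul]
  rw [Finset.sum_eq_single h] <;> simp +contextual

lemma tens_unit_ext {V : Type*} [AddCommGroup V] [Module k V] {f g : tens (unit k G) X →ₗ[k] V}
    (h : ∀ a x, f (tz (sgl a) x) = g (tz (sgl a) x)) : f = g := by
  refine tens_lin_ext fun t x => ?_
  let A (f : tens (unit k G) X →ₗ[k] V) : unit k G →ₗ[k] V :=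
    { toFun := fun t => f (tz t x)
      map_add' := fun a b => by rw [add_tz, map_add]
      map_smul' := fun a b => by rw [smul_tz, map_smul]; rfl }
  have : A f = A g := unit_ext fun a => h a x
  exact LinearMap.congr_fun this t
lemma tens_unit_ext' {V : Type*} [AddCommGroup V] [Module k V] {f g : tens X (unit k G) →ₗ[k] V}
    (h : ∀ a x, f (tz x (sgl a)) = g (tz x (sgl a))) : f = g := by
  refine tens_lin_ext fun x t => ?_
  let A (f : tens X (unit k G) →ₗ[k] V) : unit k G →ₗ[k] V :=
    { toFun := fun t => f (tz x t)
      map_add' := fun a b => by rw [tz_add, map_add]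
      map_smul' := fun a b => by rw [tz_smul, map_smul]; rfl }
  have : A f = A g := unit_ext fun a => h a x
  exact LinearMap.congr_fun this t

/-- A bijective morphism is an isomorphism. -/
def isoOfInv (f : X ⟶ Y) (g : Y →ₗ[k] X) (h1 : g ∘ₗ f.toLin = LinearMap.id)
    (h2 : f.toLin ∘ₗ g = LinearMap.id) : X ≅ Y where
  hom := f
  inv := ⟨g, fun a => by
    have := f.comm a
    calc g ∘ₗ Y.act a = g ∘ₗ Y.act a ∘ₗ (f.toLin ∘ₗ g) := by rw [h2, LinearMap.comp_id]
      _ = g ∘ₗ (Y.act a ∘ₗ f.toLin) ∘ₗ g := rfl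
      _ = (g ∘ₗ f.toLin) ∘ₗ X.act a ∘ₗ g := by rw [← this]; rfl
      _ = X.act a ∘ₗ g := by rw [h1]; rfl⟩
  hom_inv_id := hom_ext h1
  inv_hom_id := hom_ext h2

/-- The sum of the basis vectors of the unit. -/
def ones : unit k G := ∑ h : G, sgl h
lemma δ'_ones (h : G) : (unit k G).δ' h ones = sgl h := by
  simp [ones, unit_δ'_sgl]

variable (X) in
/-- The left unit constraint. -/
def lunitIso : tens (unit k G) X ≅ X :=
  isoOfInv
    (homMk (lunitLin X)
      (fun g t => by
        have : lunitLin X ∘ₗ (tens (unit k G) X).ρ g = X.ρ g ∘ₗ lunitLin X :=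
          tens_unit_ext fun a x => by simp [ρ_δ']
        exact LinearMap.congr_fun this t)
      (comm_δ_of_δ' _ (fun g t => by
        have : lunitLin X ∘ₗ (tens (unit k G) X).ρ g = X.ρ g ∘ₗ lunitLin X :=
          tens_unit_ext fun a x => by simp [ρ_δ']
        exact LinearMap.congr_fun this t)
        (fun g t => by
        have : lunitLin X ∘ₗ (tens (unit k G) X).δ' g = X.δ' g ∘ₗ lunitLin X :=
          tens_unit_ext fun a x => by
            by_cases h : g = a
            · simp [← tz_right, δ'_δ', h]
            · simp [← tz_right, δ'_δ', h, Ne.symm h]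
        exact LinearMap.congr_fun this t)))
    { toFun := fun x => tz ones x
      map_add' := fun x y => tz_add _ _ _
      map_smul' := fun c x => tz_smul _ _ _ }
    (tens_unit_ext fun a x => by simp [← tz_mid, δ'_ones])
    (by ext x; simp [ones, sum_tz, sum_δ'])
variable (X) in
/-- The right unit constraint. -/
def runitIso : tens X (unit k G) ≅ X :=
  isoOfInv
    (homMk (runitLin X)
      (fun g t => by
        have : runitLin X ∘ₗ (tens X (unit k G)).ρ g = X.ρ g ∘ₗ runitLin X :=
          tens_unit_ext' fun a x => by simp [ρ_δ']
        exact LinearMap.congr_fun this t)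
      (comm_δ_of_δ' _ (fun g t => by
        have : runitLin X ∘ₗ (tens X (unit k G)).ρ g = X.ρ g ∘ₗ runitLin X :=
          tens_unit_ext' fun a x => by simp [ρ_δ']
        exact LinearMap.congr_fun this t)
        (fun g t => by
        have : runitLin X ∘ₗ (tens X (unit k G)).δ' g = X.δ' g ∘ₗ runitLin X :=
          tens_unit_ext' fun a x => by
            by_cases h : g = a
            · simp [← tz_left, δ'_δ', h]
            · simp [← tz_left, δ'_δ', h, Ne.symm h]
        exact LinearMap.congr_fun this t)))
    { toFun := fun x => tz x ones
      map_add' := fun x y => add_tz _ _ _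
      map_smul' := fun c x => smul_tz _ _ _ }
    (tens_unit_ext' fun a x => by simp [tz_mid, δ'_ones])
    (by ext x; simp [ones, tz_sum, sum_δ'])
@[simp] lemma lunitIso_hom_toLin : (lunitIso X).hom.toLin = lunitLin X := rfl
@[simp] lemma runitIso_hom_toLin : (runitIso X).hom.toLin = runitLin X := rfl
@[simp] lemma lunitIso_inv_apply (x : X) : (lunitIso X).inv.toLin x = tz ones x := rfl
@[simp] lemma runitIso_inv_apply (x : X) : (runitIso X).inv.toLin x = tz x ones := rfl

/-- `D(G)`-modules form a monoidal category under the `z`-twisted fiberwise product. -/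
instance : MonoidalCategory (DoubleModule k G) :=
  letI : MonoidalCategoryStruct (DoubleModule k G) :=
    { tensorObj := tens
      tensorHom := tensHom
      whiskerLeft := fun X _ _ f => tensHom (𝟙 X) f
      whiskerRight := fun f Y => tensHom f (𝟙 Y)
      tensorUnit := unit k G
      associator := assocIso
      leftUnitor := lunitIso
      rightUnitor := runitIso }
  .ofTensorHom
    (id_tensorHom_id := fun X Y => tens_hom_ext fun x y => mapLin_tz _ _ _ _)
    (id_tensorHom := fun X _ _ f => rfl)
    (tensorHom_id := fun f Y => rfl)
    (tensorHom_comp_tensorHom := fun f g f' g' => tens_hom_ext fun x y => by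
      change mapLin _ _ (mapLin _ _ (tz x y)) = mapLin _ _ (tz x y)
      simp)
    (associator_naturality := fun f g h => hom_ext (tens_lin_ext3 fun x y w => by
      change assocLin _ _ _ (mapLin (tensHom f g) h (tz (tz x y) w)) =
        mapLin f (tensHom g h) (assocLin _ _ _ (tz (tz x y) w))
      simp))
    (leftUnitor_naturality := fun {X Y} f => hom_ext (tens_unit_ext fun a x => by
      change lunitLin _ (mapLin (𝟙 (unit k G)) f (tz (sgl a) x)) = f.toLin (lunitLin _ (tz (sgl a) x))
      simp [toLin_δ']))
    (rightUnitor_naturality := fun {X Y} f => hom_ext (tens_unit_ext' fun a x => by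
      change runitLin _ (mapLin f (𝟙 (unit k G)) (tz x (sgl a))) = f.toLin (runitLin _ (tz x (sgl a)))
      simp [toLin_δ']))
    (pentagon := fun W X Y Z => hom_ext (tens_lin_ext4 fun w x y v => by
      change mapLin (𝟙 W) (assocIso X Y Z).hom (assocLin W (tens X Y) Z (mapLin (assocIso W X Y).hom (𝟙 Z)
        (tz (tz (tz w x) y) v))) = assocLin W X (tens Y Z) (assocLin (tens W X) Y Z (tz (tz (tz w x) y) v))
      simp))
    (triangle := fun X Y => hom_ext (by
      refine tens_lin_ext fun t y => ?_
      let A (f : tens (tens X (unit k G)) Y →ₗ[k] tens X Y) : tens X (unit k G) →ₗ[k] tens X Y :=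
        { toFun := fun t => f (tz t y)
          map_add' := fun a b => by rw [add_tz, map_add]
          map_smul' := fun a b => by rw [smul_tz, map_smul]; rfl }
      refine LinearMap.congr_fun
        (f := A (mapLin (𝟙 X) (lunitIso Y).hom ∘ₗ assocLin X (unit k G) Y))
        (g := A (mapLin (runitIso X).hom (𝟙 Y))) (tens_unit_ext' fun a x => ?_) t
      change mapLin (𝟙 X) (lunitIso Y).hom (assocLin X (unit k G) Y (tz (tz x (sgl a)) y)) =
        mapLin (runitIso X).hom (𝟙 Y) (tz (tz x (sgl a)) y)
      simp [tz_mid]))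

end DoubleModule
end Mon
end RedCenter

namespace RedCenter
open scoped Classical
set_option linter.unusedSectionVars false
section Dual
open Supergroup (z z_comm z_sq)
variable {k : Type u} [Field k] [CharZero k] {G : Type u} [Group G] [Fintype G] [Supergroup G]

namespace DoubleModule
variable (X : DoubleModule k G)

/-- The action of `δ_g` on the dual. -/
def dualδ (g : G) : Module.End k (Module.Dual k X) := Module.Dual.transpose (X.δ g)

lemma dual_grading : IsGrading X.ρ.dual X.dualδ where
  orth g h := by
    apply LinearMap.ext; intro f; apply LinearMap.ext; intro v
    have := LinearMap.congr_fun (X.isGrading.orth h g) v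
    change f (X.δ h (X.δ g v)) = _
    rw [Module.End.mul_apply] at this
    rw [this]
    by_cases hg : g = h
    · subst hg; simp [dualδ]; rfl
    · simp [hg, Ne.symm hg]
  conj g h := by
    apply LinearMap.ext; intro f; apply LinearMap.ext; intro v
    have := LinearMap.congr_fun (X.isGrading.conj g⁻¹ (g * h * g⁻¹)) v
    change f (X.δ h (X.ρ g⁻¹ v)) = f (X.ρ g⁻¹ (X.δ _ v))
    rw [Module.End.mul_apply] at this
    rw [this, Module.End.mul_apply]
    congr 3
    group
lemma sum_dualδ : ∑ g, X.dualδ g = 1 := by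
  apply LinearMap.ext; intro f; apply LinearMap.ext; intro v
  have := LinearMap.congr_fun X.sum_δ v
  rw [LinearMap.sum_apply, LinearMap.sum_apply]
  change ∑ g, f (X.δ g v) = f v
  rw [← map_sum, ← LinearMap.sum_apply, this]; rfl

/-- The dual `X^∨`, with fibers `(X^∨)_g = (X_g)^*`. -/
def dual : DoubleModule k G := .of X.ρ.dual X.dualδ X.dual_grading X.sum_dualδ

variable {X}
lemma dual_ρ : (dual X).ρ = X.ρ.dual := of_ρ _ _ _ _
lemma dual_δ : (dual X).δ = X.dualδ := of_δ _ _ _ _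

variable (X) in
/-- The pairing of `X^∨` and `X`. -/
def pair : (dual X) ⊗[k] X →ₗ[k] k := contractLeft k X
variable (X) in
/-- The canonical element `∑ v_s ⊗ v^s` of `X ⊗ X^∨`. -/
def can : X ⊗[k] (dual X) := coevaluation k X (1 : k)

/-- Evaluation of a functional. -/
def app (f : dual X) (x : X) : k := (show Module.Dual k X from f) x
lemma pair_tmul (f : dual X) (x : X) : pair X (f ⊗ₜ x) = app f x := contractLeft_apply _ _
lemma app_ρ (g : G) (f : dual X) (x : X) : app ((dual X).ρ g f) x = app f (X.ρ g⁻¹ x) := by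
  rw [dual_ρ]; rfl
lemma app_δ (g : G) (f : dual X) (x : X) : app ((dual X).δ g f) x = app f (X.δ g x) := by
  rw [dual_δ]; rfl
lemma app_add (f f' : dual X) (x : X) : app (f + f') x = app f x + app f' x := rfl
lemma app_smul (c : k) (f : dual X) (x : X) : app (c • f) x = c * app f x := rfl
lemma app_add' (f : dual X) (x y : X) : app f (x + y) = app f x + app f y := map_add _ _ _
lemma app_smul' (c : k) (f : dual X) (x : X) : app f (c • x) = c * app f x := map_smul _ _ _
lemma app_zero' (f : dual X) : app f (0 : X) = 0 := map_zero _
lemma dual_ext {f f' : dual X} (h : ∀ x, app f x = app f' x) : f = f' := LinearMap.ext h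
lemma z_inv : (z : G)⁻¹ = z := by
  rw [inv_eq_iff_mul_eq_one, z_sq]
lemma app_par (σ : Fin 2) (f : dual X) (x : X) :
    app (par (dual X).ρ σ f) x = app f (par X.ρ σ x) := by
  simp only [par, LinearMap.smul_apply, LinearMap.add_apply, Module.End.one_apply, app_add,
    app_smul, app_add', app_smul', app_ρ, z_inv]
lemma app_δ' (g : G) (f : dual X) (x : X) : app ((dual X).δ' g f) x = app f (X.δ' g x) := by
  have hc : ∀ σ h x, par X.ρ σ (X.δ h x) = X.δ h (par X.ρ σ x) := fun σ h x =>
    LinearMap.congr_fun (X.isGrading.par_comm h σ) x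
  simp only [δ', tw, LinearMap.add_apply, Module.End.mul_apply, app_add, app_δ, app_par, app_add', hc]

variable (X) in
/-- A basis of `X`. -/
abbrev bas := Module.Basis.ofVectorSpace k X
/-- The dual basis. -/
def cob (s : Module.Basis.ofVectorSpaceIndex k X) : dual X := (bas X).coord s
lemma can_eq : can X = ∑ s, bas X s ⊗ₜ cob s := coevaluation_apply_one k X
lemma sum_cob (f : dual X) : ∑ s, app f (bas X s) • cob s = f :=
  (bas X).sum_dual_apply_smul_coord f
lemma sum_bas (x : X) : ∑ s, app (cob s) x • bas X s = x := (bas X).sum_repr x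

lemma can_move (A : X →ₗ[k] X) (B : dual X →ₗ[k] dual X) (h : ∀ f x, app (B f) x = app f (A x)) :
    TensorProduct.map LinearMap.id B (can X) = TensorProduct.map A LinearMap.id (can X) := by
  rw [can_eq, map_sum, map_sum]
  simp only [TensorProduct.map_tmul, LinearMap.id_apply]
  have h1 : ∀ t, B (cob t) = ∑ s, app (cob t) (A (bas X s)) • cob s := by
    intro t
    rw [← sum_cob (B (cob t))]
    simp only [h]
  have h2 : ∀ s, A (bas X s) = ∑ t, app (cob t) (A (bas X s)) • bas X t := fun s =>
    (sum_bas _).symm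
  calc _ = ∑ t, ∑ s, app (cob t) (A (bas X s)) • (bas X t ⊗ₜ[k] cob s) := by
        refine Finset.sum_congr rfl fun t _ => ?_
        rw [h1, TensorProduct.tmul_sum]
        simp only [TensorProduct.tmul_smul]
    _ = ∑ s, ∑ t, app (cob t) (A (bas X s)) • (bas X t ⊗ₜ[k] cob s) := Finset.sum_comm
    _ = _ := by
        refine Finset.sum_congr rfl fun s _ => ?_
        conv_rhs => rw [h2, TensorProduct.sum_tmul]
        simp only [TensorProduct.smul_tmul']
lemma map_can (A A' : X →ₗ[k] X) (B : dual X →ₗ[k] dual X) (h : ∀ f x, app (B f) x = app f (A x)) :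
    TensorProduct.map A' B (can X) = TensorProduct.map (A' ∘ₗ A) LinearMap.id (can X) := by
  have e1 : TensorProduct.map A' B = TensorProduct.map A' LinearMap.id ∘ₗ
      TensorProduct.map LinearMap.id B := by
    rw [← TensorProduct.map_comp]; rfl
  rw [e1, LinearMap.comp_apply, can_move A B h, ← LinearMap.comp_apply, ← TensorProduct.map_comp]
  rfl
lemma tprod_can (g : G) : (X.ρ.tprod (dual X).ρ) g (can X) = can X := by
  change TensorProduct.map (X.ρ g) ((dual X).ρ g) (can X) = can X
  rw [map_can (X.ρ g⁻¹) _ _ (app_ρ g)]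
  have : X.ρ g ∘ₗ X.ρ g⁻¹ = LinearMap.id := by
    change X.ρ g * X.ρ g⁻¹ = 1
    rw [← map_mul]; simp
  rw [this, TensorProduct.map_id]; rfl
lemma pair_tprod (g : G) (t) : pair X (((dual X).ρ.tprod X.ρ) g t) = pair X t := by
  have : pair X ∘ₗ ((dual X).ρ.tprod X.ρ) g = pair X := by
    refine TensorProduct.ext' fun f x => ?_
    change pair X ((dual X).ρ g f ⊗ₜ X.ρ g x) = _
    rw [pair_tmul, pair_tmul, app_ρ]; simp
  exact LinearMap.congr_fun this t

lemma pair_fproj (g : G) (t) : pair X (fproj (dual X) X g t) =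
    pair X (TensorProduct.map ((dual X).δ' g) (X.δ' g) t) := by
  have h0 : ∀ t, pair X (par ((dual X).ρ.tprod X.ρ) 0 t) = pair X t := by
    intro t
    rw [par_zero]
    simp only [LinearMap.smul_apply, LinearMap.add_apply, Module.End.one_apply, map_smul, map_add,
      pair_tprod]
    rw [← two_smul k, smul_smul]; simp
  have h1 : ∀ t, pair X (par ((dual X).ρ.tprod X.ρ) 1 t) = 0 := by
    intro t
    rw [par_one]
    simp only [LinearMap.smul_apply, LinearMap.sub_apply, Module.End.one_apply, map_smul, map_sub,
      pair_tprod]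
    simp
  rw [fproj_eq, tw, ← (rel_grading (dual X) X).par_comm, ← (rel_grading (dual X) X).par_comm]
  simp only [LinearMap.add_apply, Module.End.mul_apply, map_add, h0, h1, add_zero]
lemma fproj_can (g : G) : fproj X (dual X) g (can X) =
    TensorProduct.map (X.δ' g) LinearMap.id (can X) := by
  have h0 : par (X.ρ.tprod (dual X).ρ) 0 (can X) = can X := by
    rw [par_zero]
    simp only [LinearMap.smul_apply, LinearMap.add_apply, Module.End.one_apply, tprod_can]
    rw [← two_smul k, smul_smul]; simp
  have h1 : par (X.ρ.tprod (dual X).ρ) 1 (can X) = 0 := by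
    rw [par_one]
    simp only [LinearMap.smul_apply, LinearMap.sub_apply, Module.End.one_apply, tprod_can]
    simp
  rw [fproj_eq, tw, LinearMap.add_apply, Module.End.mul_apply, Module.End.mul_apply, h0, h1,
    map_zero, add_zero, map_can (X.δ' g) _ _ (app_δ' g)]
  congr 2
  ext x; simp

variable (X) in
/-- The evaluation: it sends `t` in the fiber over `g` to its contraction, in the fiber of the unit
over `g` (it vanishes on the odd part). -/
def evLin : tens (dual X) X →ₗ[k] unit k G :=
  LinearMap.pi (fun g => pair X ∘ₗ fproj (dual X) X g ∘ₗ J (dual X) X)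
variable (X) in
/-- The coevaluation: it sends the basis vector of the unit over `g` to the `g`-component of the
canonical element of `X ⊗ X^∨`. -/
def coevLin : unit k G →ₗ[k] tens X (dual X) :=
  ∑ g : G, LinearMap.smulRight (LinearMap.proj (R := k) (φ := fun _ : G => k) g)
    (show tens X (dual X) from ⟨fproj X (dual X) g (can X), fproj_mem g _⟩)

lemma sgl_apply (h g : G) : (sgl h : unit k G) g = if g = h then (1 : k) else 0 := Pi.single_apply _ _ _
lemma unit_eq_sum (f : unit k G) : f = ∑ h, (f h) • (sgl h : unit k G) := by
  have : ∀ f : G → k, f = ∑ h, f h • (Pi.single h (1 : k) : G → k) := by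
    intro f; funext x; simp [Finset.sum_apply, Pi.single_apply]
  exact this f
lemma evLin_tz (f : dual X) (x : X) :
    evLin X (tz f x) = ∑ h, app f (X.δ' h x) • (sgl h : unit k G) := by
  rw [unit_eq_sum (evLin X (tz f x))]
  refine Finset.sum_congr rfl fun h _ => ?_
  congr 1
  change pair X (fproj (dual X) X h (J (dual X) X (tz f x))) = _
  rw [pair_fproj, ← J_δ', ← tz_right, J_tz, map_sum]
  simp only [pair_tmul, δ'_δ', app_δ']
  rw [Finset.sum_eq_single h]
  · simp
  · intro b _ hb; simp [hb, app_zero']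
  · simp
lemma coevLin_sgl' (g : G) : J X (dual X) (coevLin X (sgl g)) = fproj X (dual X) g (can X) := by
  rw [coevLin, LinearMap.sum_apply, map_sum, Finset.sum_eq_single g]
  · change J X (dual X) (((sgl g : unit k G) g) • _) = _
    rw [sgl_apply, if_pos rfl, one_smul]; rfl
  · intro b _ hb
    change J X (dual X) (((sgl g : unit k G) b) • _) = _
    rw [sgl_apply, if_neg hb, zero_smul, map_zero]
  · simp
lemma coevLin_sgl (g : G) : coevLin X (sgl g) = ∑ s, tz (X.δ' g (bas X s)) (cob s) := by
  apply J_injective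
  rw [coevLin_sgl']
  have h1 : fproj X (dual X) g (can X) = tproj X (dual X) (TensorProduct.map (X.δ' g) LinearMap.id (can X)) := by
    rw [← fproj_can, tproj_of_mem (fproj_mem g _)]
  rw [h1, can_eq, map_sum, map_sum, map_sum]
  rfl

variable (X) in
/-- The evaluation morphism. -/
def ev : tens (dual X) X ⟶ unit k G :=
  homTens (evLin X)
    (fun g f x => by
      rw [evLin_tz, evLin_tz, map_sum]
      refine (Fintype.sum_equiv (MulAut.conj g).toEquiv _ _ fun h => ?_).symm
      simp only [map_smul, unit_ρ_sgl, MulEquiv.toEquiv_eq_coe, EquivLike.coe_coe,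
        MulAut.conj_apply, app_ρ, ρ_δ']
      congr 2
      rw [← Module.End.mul_apply (X.ρ g⁻¹), ← map_mul]
      simp [mul_assoc])
    (fun g f x => by
      rw [evLin_tz, evLin_tz, map_sum]
      refine Finset.sum_congr rfl fun h _ => ?_
      rw [map_smul, unit_δ'_sgl, app_δ', δ'_δ']
      by_cases hg : g = h
      · simp [hg]
      · simp [hg, app_zero'])
variable (X) in
/-- The coevaluation morphism. -/
def coev : unit k G ⟶ tens X (dual X) :=
  homMk (coevLin X)
    (fun g t => by
      have : coevLin X ∘ₗ (unit k G).ρ g = (tens X (dual X)).ρ g ∘ₗ coevLin X := by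
        refine unit_ext fun a => J_injective ?_
        rw [LinearMap.comp_apply, LinearMap.comp_apply, J_ρ, coevLin_sgl', unit_ρ_sgl, coevLin_sgl']
        have := LinearMap.congr_fun ((fproj_grading X (dual X)).conj g a) (can X)
        rw [Module.End.mul_apply, Module.End.mul_apply, tprod_can] at this
        exact this.symm
      exact LinearMap.congr_fun this t)
    (fun g t => by
      have : coevLin X ∘ₗ (unit k G).δ g = (tens X (dual X)).δ g ∘ₗ coevLin X := by
        refine unit_ext fun a => J_injective ?_
        rw [LinearMap.comp_apply, LinearMap.comp_apply, J_δ, coevLin_sgl', unit_δ_sgl]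
        have := LinearMap.congr_fun ((fproj_grading X (dual X)).orth g a) (can X)
        rw [Module.End.mul_apply] at this
        rw [this]
        split_ifs with h
        · rw [coevLin_sgl', h]
        · simp
      exact LinearMap.congr_fun this t)

/-- `X^∨` is a dual of `X`. -/
instance exactPairing : ExactPairing X (dual X) where
  coevaluation' := coev X
  evaluation' := ev X
  coevaluation_evaluation' := hom_ext (tens_unit_ext' fun g f => by
    change mapLin (ev X) (𝟙 (dual X)) (assocInvLin (dual X) X (dual X)
      (mapLin (𝟙 (dual X)) (coev X) (tz f (sgl g)))) = (lunitIso (dual X)).inv.toLin (runitLin _ (tz f (sgl g)))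
    rw [mapLin_tz]
    change mapLin (ev X) (𝟙 (dual X)) (assocInvLin (dual X) X (dual X) (tz f (coevLin X (sgl g)))) = _
    rw [coevLin_sgl, tz_sum, map_sum, map_sum]
    simp only [assocInvLin_tz, mapLin_tz, id_toLin, LinearMap.id_apply]
    change ∑ s, tz (evLin X (tz f (X.δ' g (bas X s)))) (cob s) = _
    simp only [evLin_tz, δ'_δ']
    have : ∀ x : X, ∑ h, app f (if h = g then X.δ' h x else 0) • (sgl h : unit k G) =
        app f (X.δ' g x) • (sgl g : unit k G) := by
      intro x
      rw [Finset.sum_eq_single g]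
      · simp
      · intro b _ hb; simp [hb, app_zero']
      · simp
    simp only [this, smul_tz, ← tz_smul, ← app_δ']
    rw [← tz_sum, sum_cob, runitLin_tz, lunitIso_inv_apply, ← tz_mid, ← tz_mid, δ'_ones]
    rw [unit_δ'_sgl, if_pos rfl])
  evaluation_coevaluation' := hom_ext (tens_unit_ext fun g x => by
    change mapLin (𝟙 X) (ev X) (assocLin X (dual X) X
      (mapLin (coev X) (𝟙 X) (tz (sgl g) x))) = (runitIso X).inv.toLin (lunitLin _ (tz (sgl g) x))
    rw [mapLin_tz]
    change mapLin (𝟙 X) (ev X) (assocLin X (dual X) X (tz (coevLin X (sgl g)) x)) = _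
    rw [coevLin_sgl, sum_tz, map_sum, map_sum]
    simp only [assocLin_tz, mapLin_tz, id_toLin, LinearMap.id_apply]
    change ∑ s, tz (X.δ' g (bas X s)) (evLin X (tz (cob s) x)) = _
    have h1 : ∀ s, tz (X.δ' g (bas X s)) (evLin X (tz (cob s) x)) =
        tz (app (cob s) (X.δ' g x) • bas X s) (sgl g : unit k G) := by
      intro s
      rw [tz_mid, evLin_tz, map_sum]
      simp only [map_smul, unit_δ'_sgl]
      rw [Finset.sum_eq_single g]
      · simp [smul_tz, tz_smul]
      · intro b _ hb; simp [Ne.symm hb]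
      · simp
    simp only [h1]
    rw [← sum_tz, sum_bas, lunitLin_tz, runitIso_inv_apply, tz_mid, tz_mid, δ'_ones, unit_δ'_sgl,
      if_pos rfl])

instance : RightRigidCategory (DoubleModule k G) where
  rightDual X := { rightDual := dual X }

variable (X) in
/-- The natural isomorphism of vector spaces `X → X^**`. -/
def dblDual : X →ₗ[k] dual (dual X) := Module.Dual.eval k X

end DoubleModule
end Dual
end RedCenter

namespace RedCenter
open scoped Classical
set_option linter.unusedSectionVars false
instance {k : Type u} [Field k] {G : Type u} [Group G] : Limits.HasFiniteBiproducts (FDRep k G) :=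
  Abelian.hasFiniteBiproducts
section SuperRep
open Supergroup (z z_comm z_sq)
variable {k : Type u} [Field k] {G : Type u} [Group G]

section Duals

lemma map_coevaluation {V : Type u} [AddCommGroup V] [Module k V] [FiniteDimensional k V]
    (A B : V →ₗ[k] V) (h : A ∘ₗ B = LinearMap.id) :
    TensorProduct.map A (Module.Dual.transpose B) (coevaluation k V (1 : k)) =
      coevaluation k V (1 : k) := by
  set b := Module.Basis.ofVectorSpace k V with hb
  have hc : coevaluation k V (1 : k) = ∑ s, b s ⊗ₜ b.coord s := coevaluation_apply_one k V
  have h1 : ∀ t, Module.Dual.transpose (R := k) B (b.coord t) = ∑ s, b.coord t (B (b s)) • b.coord s :=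
    fun t => (b.sum_dual_apply_smul_coord (Module.Dual.transpose (R := k) B (b.coord t))).symm
  have h2 : ∀ s, ∑ t, b.coord t (B (b s)) • A (b t) = b s := by
    intro s
    have := congrArg A (b.sum_repr (B (b s)))
    rw [map_sum] at this
    simp only [map_smul] at this
    exact this.trans (LinearMap.congr_fun h (b s))
  rw [hc, map_sum]
  simp only [TensorProduct.map_tmul, h1, TensorProduct.tmul_sum, TensorProduct.tmul_smul]
  rw [Finset.sum_comm]
  refine Finset.sum_congr rfl fun s _ => ?_
  rw [← h2 s, TensorProduct.sum_tmul, h2 s]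
  simp only [TensorProduct.smul_tmul']

lemma ρ_inv_comp (X : FDRep k G) (g : G) : X.ρ g ∘ₗ X.ρ g⁻¹ = LinearMap.id := by
  change X.ρ g * X.ρ g⁻¹ = 1
  rw [← map_mul]; simp

variable (X : FDRep k G)

/-- The evaluation `X^* ⊗ X → 1`, `f ⊗ x ↦ f x`. -/
def evalL : dualRep X ⊗ X ⟶ 𝟙_ (FDRep k G) :=
  homOf (X := dualRep X ⊗ X) (Y := 𝟙_ (FDRep k G)) (contractLeft k X) (fun g t => by
    have : contractLeft k X ∘ₗ TensorProduct.map (Representation.dual X.ρ g) (X.ρ g) = contractLeft k X := by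
      refine TensorProduct.ext' fun f x => ?_
      change f (X.ρ g⁻¹ (X.ρ g x)) = f x
      rw [← Module.End.mul_apply, ← map_mul]; simp
    exact LinearMap.congr_fun this t)
/-- The evaluation `X ⊗ X^* → 1`, `x ⊗ f ↦ f x`. -/
def evalR : X ⊗ dualRep X ⟶ 𝟙_ (FDRep k G) :=
  homOf (X := X ⊗ dualRep X) (Y := 𝟙_ (FDRep k G)) (contractRight k X) (fun g t => by
    have : contractRight k X ∘ₗ TensorProduct.map (X.ρ g) (Representation.dual X.ρ g) = contractRight k X := by
      refine TensorProduct.ext' fun x f => ?_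
      change f (X.ρ g⁻¹ (X.ρ g x)) = f x
      rw [← Module.End.mul_apply, ← map_mul]; simp
    exact LinearMap.congr_fun this t)
/-- The coevaluation `1 → X ⊗ X^*`, `1 ↦ ∑ x_s ⊗ x^s`. -/
def coevL : 𝟙_ (FDRep k G) ⟶ X ⊗ dualRep X :=
  homOf (X := 𝟙_ (FDRep k G)) (Y := X ⊗ dualRep X) (coevaluation k X) (fun g t => by
    have : TensorProduct.map (X.ρ g) (Representation.dual X.ρ g) ∘ₗ coevaluation k X = coevaluation k X :=
      LinearMap.ext_ring (map_coevaluation _ _ (ρ_inv_comp X g))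
    change coevaluation k X t = (TensorProduct.map (X.ρ g) (Representation.dual X.ρ g) ∘ₗ coevaluation k X) t
    rw [this])
/-- The coevaluation `1 → X^* ⊗ X`, `1 ↦ ∑ x^s ⊗ x_s`. -/
def coevR : 𝟙_ (FDRep k G) ⟶ dualRep X ⊗ X :=
  homOf (X := 𝟙_ (FDRep k G)) (Y := dualRep X ⊗ X)
    ((TensorProduct.comm k X (Module.Dual k X)).toLinearMap ∘ₗ coevaluation k X) (fun g t => by
    have : TensorProduct.map (Representation.dual X.ρ g) (X.ρ g) ∘ₗ
        ((TensorProduct.comm k X (Module.Dual k X)).toLinearMap ∘ₗ coevaluation k X) =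
        (TensorProduct.comm k X (Module.Dual k X)).toLinearMap ∘ₗ coevaluation k X := by
      rw [← LinearMap.comp_assoc, TensorProduct.map_comp_comm_eq, LinearMap.comp_assoc]
      have h : TensorProduct.map (X.ρ g) (Representation.dual X.ρ g) ∘ₗ coevaluation k X = coevaluation k X :=
        LinearMap.ext_ring (map_coevaluation _ _ (ρ_inv_comp X g))
      rw [h]
    change ((TensorProduct.comm k X (Module.Dual k X)).toLinearMap ∘ₗ coevaluation k X) t =
      (TensorProduct.map (Representation.dual X.ρ g) (X.ρ g) ∘ₗ
        ((TensorProduct.comm k X (Module.Dual k X)).toLinearMap ∘ₗ coevaluation k X)) t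
    rw [this])

variable {X} in
/-- The transpose `Y^* → X^*` of a morphism `X → Y`. -/
def dualMap {Y : FDRep k G} (f : X ⟶ Y) : dualRep Y ⟶ dualRep X :=
  homOf (X := dualRep Y) (Y := dualRep X) (Module.Dual.transpose (R := k) (lin f)) (fun g t => by
    apply LinearMap.ext; intro x
    exact congrArg (show Module.Dual k Y from t) (lin_ρ f g⁻¹ x).symm)
/-- The natural map `X → X^**`. -/
def dblDualRep : X ⟶ dualRep (dualRep X) :=
  homOf (X := X) (Y := dualRep (dualRep X)) (Module.Dual.eval k X) (fun g x => by
    apply LinearMap.ext; intro f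
    have : X.ρ g x = X.ρ g⁻¹⁻¹ x := by rw [inv_inv]
    exact congrArg (show Module.Dual k X from f) this)
end Duals

section Braiding
variable [CharZero k] [Fintype G] [Supergroup G] (X Y : FDRep k G)

/-- The operator `x ⊗ y ↦ (-1)^{στ} y ⊗ x` for `x` of parity `σ` and `y` of parity `τ`. -/
def koszul : X ⊗[k] Y →ₗ[k] Y ⊗[k] X :=
  ∑ σ : Fin 2, ∑ τ : Fin 2, (-1 : k) ^ ((σ : ℕ) * τ) •
    ((TensorProduct.comm k X Y).toLinearMap ∘ₗ TensorProduct.map (par X.ρ σ) (par Y.ρ τ))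

lemma koszul_tmul (x : X) (y : Y) : koszul X Y (x ⊗ₜ y) =
    ∑ σ : Fin 2, ∑ τ : Fin 2, (-1 : k) ^ ((σ : ℕ) * τ) • (par Y.ρ τ y ⊗ₜ par X.ρ σ x) := by
  simp [koszul]
lemma koszul_koszul (x : X) (y : Y) : koszul Y X (koszul X Y (x ⊗ₜ y)) = x ⊗ₜ y := by
  have e : ∀ (Z : FDRep k G) σ τ (w : Z), par Z.ρ σ (par Z.ρ τ w) = if σ = τ then par Z.ρ σ w else 0 := by
    intro Z σ τ w
    have := LinearMap.congr_fun (par_mul Z.ρ σ τ) w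
    split_ifs at this ⊢ <;> exact this
  conv_rhs => rw [← par_apply_add X.ρ x, ← par_apply_add Y.ρ y]
  simp [koszul_tmul, Fin.sum_univ_two, e, TensorProduct.add_tmul, TensorProduct.tmul_add]
  abel

/-- The braiding of `Rep(G, z)`: the flip with the Koszul sign. -/
def braid : X ⊗ Y ⟶ Y ⊗ X :=
  homOf (X := X ⊗ Y) (Y := Y ⊗ X) (koszul X Y) (fun g t => by
    have hp : ∀ (Z : FDRep k G) σ (w : Z), par Z.ρ σ (Z.ρ g w) = Z.ρ g (par Z.ρ σ w) := fun Z σ w =>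
      (LinearMap.congr_fun (par_comm Z.ρ g σ) w).symm
    have : koszul X Y ∘ₗ TensorProduct.map (X.ρ g) (Y.ρ g) =
        TensorProduct.map (Y.ρ g) (X.ρ g) ∘ₗ koszul X Y := by
      refine TensorProduct.ext' fun x y => ?_
      simp [koszul_tmul, hp]
    exact LinearMap.congr_fun this t)

/-- The braiding as an isomorphism. -/
def braidIso : X ⊗ Y ≅ Y ⊗ X where
  hom := braid X Y
  inv := braid Y X
  hom_inv_id := lin_injective (TensorProduct.ext' fun x y => koszul_koszul X Y x y)
  inv_hom_id := lin_injective (TensorProduct.ext' fun x y => koszul_koszul Y X x y)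
end Braiding
end SuperRep
end RedCenter

namespace RedCenter
open scoped Classical
set_option linter.unusedSectionVars false
section TFunctor
open Supergroup (z z_comm z_sq)
variable {k : Type u} [Field k] [CharZero k] {G : Type u} [Group G] [Fintype G] [Supergroup G]

/-- The half-braiding of an object `(X, γ)` of the center, as natural isomorphism
`γ_A : A ⊗ X → X ⊗ A` (the structure `HalfBraiding` records the inverse direction). -/
def gam (X : Center (FDRep k G)) (A : FDRep k G) : A ⊗ X.1 ⟶ X.1 ⊗ A := (X.2.β A).inv

lemma gam_naturality (X : Center (FDRep k G)) {A B : FDRep k G} (f : A ⟶ B) :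
    f ▷ X.1 ≫ gam X B = gam X A ≫ X.1 ◁ f := by
  have := X.2.naturality f
  rw [gam, gam, Iso.eq_inv_comp, ← Category.assoc, ← this, Category.assoc, Iso.hom_inv_id,
    Category.comp_id]
lemma gam_tensor (X : Center (FDRep k G)) (A B : FDRep k G) :
    gam X (A ⊗ B) = (α_ A B X.1).hom ≫ A ◁ gam X B ≫ (α_ A X.1 B).inv ≫ gam X A ▷ B ≫
      (α_ X.1 A B).hom := by
  have h : X.2.β (A ⊗ B) = (α_ X.1 A B).symm ≪≫ whiskerRightIso (X.2.β A) B ≪≫ α_ A X.1 B ≪≫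
      whiskerLeftIso A (X.2.β B) ≪≫ (α_ A B X.1).symm := Iso.ext (X.2.monoidal A B)
  rw [gam, h]
  simp [gam]
lemma gam_comm {X Y : Center (FDRep k G)} (f : X ⟶ Y) (A : FDRep k G) :
    A ◁ f.f ≫ gam Y A = gam X A ≫ f.f ▷ A := by
  have := f.comm A
  rw [gam, gam, Iso.eq_inv_comp, ← Category.assoc, ← this, Category.assoc, Iso.hom_inv_id,
    Category.comp_id]

variable (k G) in
/-- The regular representation `k[G]`; the basis vector `g` is `Pi.single g 1`. -/
def reg : FDRep k G := FDRep.of (V := G → k)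
  { toFun := fun g => LinearMap.funLeft k k (fun h => g⁻¹ * h)
    map_one' := by ext f h; simp
    map_mul' := fun a b => by
      apply LinearMap.ext; intro f; funext h
      simp [LinearMap.funLeft_apply, mul_assoc] }

/-- The basis vectors of the regular representation. -/
def regb (g : G) : reg k G := (Pi.single g (1 : k) : G → k)
/-- The coordinate `δ_g` on the regular representation. -/
def regc (g : G) : reg k G →ₗ[k] k := LinearMap.proj (R := k) (φ := fun _ : G => k) g
lemma regc_regb (g h : G) : regc g (regb (k := k) h) = if g = h then 1 else 0 := by
  change (Pi.single h (1 : k) : G → k) g = _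
  rw [Pi.single_apply]
lemma reg_eq_sum (f : reg k G) : f = ∑ h, regc h f • regb h := by
  have : ∀ f : G → k, f = ∑ h, f h • (Pi.single h (1 : k) : G → k) := by
    intro f; funext x; simp [Finset.sum_apply, Pi.single_apply]
  exact this f
lemma reg_ρ_regb (g h : G) : (reg k G).ρ g (regb h) = regb (g * h) := by
  funext x
  change (Pi.single h (1 : k) : G → k) (g⁻¹ * x) = (Pi.single (g * h) (1 : k) : G → k) x
  rw [Pi.single_apply, Pi.single_apply]
  congr 1
  exact propext inv_mul_eq_iff_eq_mul
lemma regc_ρ (g h : G) (f : reg k G) : regc h ((reg k G).ρ g f) = regc (g⁻¹ * h) f := rfl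

/-- The operator `δ_g` on `X`, for `(X, γ)` in the center: `δ_g x = ⟨id ⊗ δ_g, γ_{k[G]}(e ⊗ x)⟩`. -/
def cδ (X : Center (FDRep k G)) (g : G) : Module.End k X.1 :=
  (TensorProduct.rid k X.1).toLinearMap ∘ₗ (regc g).lTensor X.1 ∘ₗ
    lin (gam X (reg k G)) ∘ₗ TensorProduct.mk k (reg k G) X.1 (regb 1)

/-- The map `k[G] → A` determined by a vector of `A`. -/
def regMap {A : FDRep k G} (a : A) : reg k G ⟶ A :=
  homOf (∑ h : G, (regc h).smulRight (A.ρ h a)) (fun g f => by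
    simp only [LinearMap.sum_apply, LinearMap.smulRight_apply, map_sum, map_smul, regc_ρ]
    refine Fintype.sum_equiv (Equiv.mulLeft g⁻¹) _ _ fun h => ?_
    rw [Equiv.coe_mulLeft, ← Module.End.mul_apply, ← map_mul]
    simp)
lemma regMap_regb {A : FDRep k G} (a : A) (g : G) : lin (regMap a) (regb g) = A.ρ g a := by
  simp only [regMap, lin_homOf, LinearMap.sum_apply, LinearMap.smulRight_apply, regc_regb]
  simp

lemma tm_reg_eq_sum {Y : FDRep k G} (t : (Y ⊗ reg k G : FDRep k G)) :
    t = ∑ g, tm (TensorProduct.rid k Y ((regc g).lTensor Y t)) (regb g) := by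
  let F : (Y ⊗ reg k G : FDRep k G) →ₗ[k] (Y ⊗ reg k G : FDRep k G) :=
    ∑ g : G, (TensorProduct.mk k Y (reg k G)).flip (regb g) ∘ₗ
      (TensorProduct.rid k Y).toLinearMap ∘ₗ (regc g).lTensor Y
  have : LinearMap.id = F := by
    refine tensor_ext fun y f => ?_
    simp only [F, LinearMap.sum_apply]
    conv_lhs => rw [LinearMap.id_apply, reg_eq_sum f, tm_sum]
    refine Finset.sum_congr rfl fun h _ => ?_
    rw [tm_smul, ← smul_tm]
    rfl
  have h := LinearMap.congr_fun this t
  simp only [F, LinearMap.sum_apply] at h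
  exact h

lemma gam_reg (X : Center (FDRep k G)) (x : X.1) :
    lin (gam X (reg k G)) (tm (regb 1) x) = ∑ g, tm (cδ X g x) (regb g) := tm_reg_eq_sum _
/-- The half-braiding in terms of the operators `δ_g`. -/
lemma gam_tm (X : Center (FDRep k G)) {A : FDRep k G} (a : A) (x : X.1) :
    lin (gam X A) (tm a x) = ∑ g, tm (cδ X g x) (A.ρ g a) := by
  have h := congrArg (fun f => lin f (tm (regb 1) x)) (gam_naturality X (regMap a))
  simp only [lin_comp, LinearMap.comp_apply, lin_whiskerRight, gam_reg, map_sum, lin_whiskerLeft,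
    regMap_regb] at h
  simpa using h

/-- The coefficient of `e_a` of an element of `Y ⊗ k[G]`. -/
def rcoef {Y : FDRep k G} (a : G) : (Y ⊗ reg k G : FDRep k G) →ₗ[k] Y :=
  (TensorProduct.rid k Y).toLinearMap ∘ₗ (regc a).lTensor Y
lemma rcoef_tm {Y : FDRep k G} (a b : G) (y : Y) :
    rcoef a (tm y (regb b)) = if a = b then y else 0 := by
  change TensorProduct.rid k Y (y ⊗ₜ regc a (regb b)) = _
  rw [regc_regb]; split_ifs <;> simp

lemma cδ_cδ (X : Center (FDRep k G)) (a b : G) (x : X.1) :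
    cδ X a (cδ X b x) = if a = b then cδ X a x else 0 := by
  have h1 := gam_tm X (A := reg k G ⊗ reg k G) (tm (regb 1) (regb 1)) x
  rw [gam_tensor] at h1
  simp only [lin_comp, LinearMap.comp_apply, lin_assoc_hom, lin_whiskerLeft, gam_tm, tm_sum,
    map_sum, lin_assoc_inv, lin_whiskerRight, sum_tm, reg_ρ_regb, mul_one, ρ_tm] at h1
  have h2 := congrArg (fun t => rcoef a (rcoef b (lin (α_ X.1 (reg k G) (reg k G)).inv t))) h1
  simp only [map_sum, lin_assoc_inv, rcoef_tm] at h2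
  rw [Finset.sum_eq_single b] at h2
  · rw [Finset.sum_eq_single a, Finset.sum_eq_single b] at h2
    · simp only [if_true, rcoef_tm] at h2
      rw [h2]
      split_ifs with hab
      · rw [hab]
      · rfl
    · intro c _ hc; rw [if_neg (Ne.symm hc), map_zero]
    · simp
    · intro c _ hc; rw [if_pos rfl]; exact (rcoef_tm _ _ _).trans (if_neg (Ne.symm hc))
    · simp
  · intro c _ hc
    refine Finset.sum_eq_zero fun d _ => ?_
    rw [if_neg (Ne.symm hc), map_zero]
  · simp
lemma cδ_ρ (X : Center (FDRep k G)) (g h : G) (x : X.1) :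
    X.1.ρ g (cδ X h x) = cδ X (g * h * g⁻¹) (X.1.ρ g x) := by
  have h1 := lin_ρ (gam X (reg k G)) g (tm (regb 1) x)
  rw [ρ_tm, gam_tm, gam_tm, map_sum] at h1
  simp only [ρ_tm, reg_ρ_regb, mul_one] at h1
  have h2 := congrArg (rcoef (g * h)) h1
  simp only [map_sum, rcoef_tm] at h2
  rw [Finset.sum_eq_single (g * h * g⁻¹), Finset.sum_eq_single h] at h2
  · simpa using h2.symm
  · intro c _ hc; simp [Ne.symm hc]
  · simp
  · intro c _ hc
    rw [if_neg]
    intro h; exact hc (by rw [h]; group)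
  · simp
lemma sum_cδ (X : Center (FDRep k G)) (x : X.1) : ∑ g, cδ X g x = x := by
  have inj : ∀ x y : X.1, ∑ g, cδ X g x = ∑ g, cδ X g y → x = y := by
    intro x y h
    have e : ∀ x, lin (X.2.β (𝟙_ _)).hom (∑ g, tm (cδ X g x) (un 1)) = tm (un 1) x := by
      intro x
      have h1 := gam_tm X (un 1 : 𝟙_ (FDRep k G)) x
      simp only [ρ_un] at h1
      rw [← h1, ← LinearMap.comp_apply, ← lin_comp, gam, Iso.inv_hom_id]; rfl
    have h2 := e x
    rw [← sum_tm, h, sum_tm, e y] at h2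
    have h3 := congrArg (lin (λ_ X.1).hom) h2
    exact (one_smul k x).symm.trans (h3.symm.trans (one_smul k y))
  refine inj _ _ ?_
  simp only [map_sum, cδ_cδ]
  rw [Finset.sum_comm]
  simp
lemma center_grading (X : Center (FDRep k G)) : IsGrading X.1.ρ (cδ X) where
  orth g h := by
    ext x
    have := cδ_cδ X g h x
    split_ifs at this ⊢ <;> exact this
  conj g h := by ext x; exact cδ_ρ X g h x
lemma center_sum (X : Center (FDRep k G)) : ∑ g, cδ X g = 1 := by
  ext x; rw [LinearMap.sum_apply]; exact sum_cδ X x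
lemma cδ_comm {X Y : Center (FDRep k G)} (f : X ⟶ Y) (g : G) (x : X.1) :
    lin f.f (cδ X g x) = cδ Y g (lin f.f x) := by
  have h := congrArg (fun f => lin f (tm (regb 1) x)) (gam_comm f (reg k G))
  simp only [lin_comp, LinearMap.comp_apply, lin_whiskerRight, gam_tm, map_sum, lin_whiskerLeft,
    reg_ρ_regb, mul_one] at h
  have h2 := congrArg (rcoef g) h
  simp only [map_sum, rcoef_tm] at h2
  simpa using h2.symm

variable (k G) in
/-- The Drinfeld center of `Rep(G, z)`; its objects are pairs `(X, γ)` of a finite-dimensional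
representation and a half-braiding. The name is a synonym of `Center`, to be equipped with the
reduced tensor product instead of the usual one. -/
def ReducedCenter := Center (FDRep k G)

instance : Category (ReducedCenter k G) := inferInstanceAs (Category (Center (FDRep k G)))

variable (k G) in
/-- The functor `T : Z(Rep(G, z)) → D(G)`-mod: the module `T(X, γ)` is `X` with its action of `G`,
and with `δ_g` acting by `x ↦ ⟨id ⊗ δ_g, γ_{k[G]}(e ⊗ x)⟩`. -/
def T : ReducedCenter k G ⥤ DoubleModule k G where
  obj X := .of (V := X.1) X.1.ρ (cδ X) (center_grading X) (center_sum X)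
  map {X Y} f := DoubleModule.homMk (lin f.f)
    (fun g x => by
      rw [DoubleModule.of_ρ, DoubleModule.of_ρ]; exact lin_ρ f.f g x)
    (fun g x => by
      rw [DoubleModule.of_δ, DoubleModule.of_δ]; exact cδ_comm f g x)
end TFunctor
end RedCenter

namespace RedCenter
open scoped Classical
set_option linter.unusedSectionVars false

section Pivotal
universe v₁ v₂ u₁ u₂
variable {C : Type u₁} [Category.{v₁} C] [MonoidalCategory C] [RightRigidCategory C]
variable {D : Type u₂} [Category.{v₂} D] [MonoidalCategory D] [RightRigidCategory D]

/-- The canonical isomorphism `(X ⊗ Y)^** ≅ X^** ⊗ Y^**`. -/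
def dblDualTensorIso (X Y : C) : ((X ⊗ Y)ᘁ)ᘁ ≅ (Xᘁ)ᘁ ⊗ (Yᘁ)ᘁ :=
  rightDualIso (X := (X ⊗ Y)ᘁ) HasRightDual.exact
    (letI : ExactPairing (Yᘁ ⊗ Xᘁ) ((Xᘁ)ᘁ ⊗ (Yᘁ)ᘁ) := ExactPairing.tensor
     exactPairingCongrLeft (rightDualTensorIso X Y))

variable (C) in
/-- A pivotal structure: a monoidal natural isomorphism from the identity to the double dual. -/
structure PivotalStructure where
  iso : ∀ X : C, X ≅ (Xᘁ)ᘁ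
  natural : ∀ {X Y : C} (f : X ⟶ Y), f ≫ (iso Y).hom = (iso X).hom ≫ (fᘁ)ᘁ
  monoidal : ∀ X Y : C,
    (iso (X ⊗ Y)).hom ≫ (dblDualTensorIso X Y).hom = (iso X).hom ⊗ₘ (iso Y).hom

/-- The canonical comparison `F(X^*) → F(X)^*` of a monoidal functor, characterized by its
compatibility with the evaluations. -/
def dualComparison (F : C ⥤ D) [F.Monoidal] (X : C) : F.obj (Xᘁ) ⟶ (F.obj X)ᘁ :=
  tensorRightHomEquiv (F.obj (Xᘁ)) (F.obj X) ((F.obj X)ᘁ) (𝟙_ D)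
    (Functor.LaxMonoidal.μ F (Xᘁ) X ≫ F.map (ε_ X (Xᘁ)) ≫ Functor.OplaxMonoidal.η F) ≫ (λ_ _).hom

/-- A monoidal functor between pivotal categories is pivotal if it maps the isomorphism
`X ≅ X^**` to `F(X) ≅ F(X)^**`, under the canonical identification of `F(X^**)` and `F(X)^**`. -/
def IsPivotalFunctor (F : C ⥤ D) [F.Monoidal] (P : PivotalStructure C) (P' : PivotalStructure D) :
    Prop :=
  ∀ X : C, F.map (P.iso X).hom ≫ dualComparison F (Xᘁ) =
    (P'.iso (F.obj X)).hom ≫ (dualComparison F X)ᘁ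
end Pivotal

section Reduced
open Limits
variable {k : Type u} [Field k] [CharZero k] {G : Type u} [Group G] [Fintype G] [Supergroup G]

variable (k G) in
/-- A choice of representatives `X_i` of the isomorphism classes of irreducible representations,
of square roots of their dimensions `d_i`, and of a square root of `𝒟 = ∑ d_i²`. -/
structure IrrData where
  ι : Type
  [fintype : Fintype ι]
  obj : ι → FDRep k G
  simple : ∀ i, Simple (obj i)
  distinct : ∀ i j, Nonempty (obj i ≅ obj j) → i = j
  complete : ∀ V : FDRep k G, Simple V → ∃ i, Nonempty (V ≅ obj i)
  sqrtd : ι → k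
  sqrtd_sq : ∀ i, sqrtd i ^ 2 = (Module.finrank k (obj i) : k)
  sqrtD : k
  sqrtD_sq : sqrtD ^ 2 = ∑ i, (Module.finrank k (obj i) : k) ^ 2

attribute [instance] IrrData.fintype

/-- The dimension `d_i`. -/
def IrrData.d (S : IrrData k G) (i : S.ι) : k := (Module.finrank k (S.obj i) : k)
/-- `𝒟 = ∑ d_i²`. -/
def IrrData.D (S : IrrData k G) : k := ∑ i, S.d i ^ 2

/-- The part of the loop colored by `A` before the half-braiding of `X`:
`X ⊗ Y → X ⊗ A ⊗ A^* ⊗ Y → A ⊗ X ⊗ Y ⊗ A^*`. -/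
def loopTop (A : FDRep k G) (X Y : Center (FDRep k G)) :
    X.1 ⊗ Y.1 ⟶ (A ⊗ X.1) ⊗ (Y.1 ⊗ dualRep A) :=
  𝟙 (X.1 ⊗ Y.1) ⊗≫ X.1 ◁ coevL A ▷ Y.1 ⊗≫ ((braidIso A X.1).inv ⊗ₘ gam Y (dualRep A))

/-- The rest of the loop colored by `A`:
`A ⊗ X ⊗ Y ⊗ A^* → X ⊗ A ⊗ A^* ⊗ Y → X ⊗ Y`. -/
def loopBot (A : FDRep k G) (X Y : Center (FDRep k G)) :
    (A ⊗ X.1) ⊗ (Y.1 ⊗ dualRep A) ⟶ X.1 ⊗ Y.1 :=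
  (gam X A ⊗ₘ (braidIso Y.1 (dualRep A)).hom) ⊗≫ X.1 ◁ evalR A ▷ Y.1 ⊗≫ 𝟙 (X.1 ⊗ Y.1)

/-- A basis `φ_α` of `Hom(P, Q)`. -/
def homBasis (P Q : FDRep k G) : Module.Basis (Fin (Module.finrank k (P ⟶ Q))) k (P ⟶ Q) :=
  Module.finBasis k (P ⟶ Q)

/-- The dual basis `φ^α` of `Hom(Q, P)` with respect to the trace pairing `tr_Q (φ_β ∘ φ^α)`
(a perfect pairing, as the category is semisimple). -/
def dualHom (P Q : FDRep k G) (α : Fin (Module.finrank k (P ⟶ Q))) : Q ⟶ P :=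
  Classical.epsilon fun ψ : Q ⟶ P =>
    ∀ β, LinearMap.trace k Q (lin (ψ ≫ homBasis P Q β)) = if α = β then 1 else 0

/-- The morphism `P^* → Q^* ⊗ B` obtained from `ψ : Q → B ⊗ P` by duality. -/
def mate {B P Q : FDRep k G} (ψ : Q ⟶ B ⊗ P) : dualRep P ⟶ dualRep Q ⊗ B :=
  𝟙 (dualRep P) ⊗≫ coevR Q ▷ dualRep P ⊗≫ (dualRep Q ◁ ψ) ▷ dualRep P ⊗≫
    (dualRep Q ⊗ B) ◁ evalR P ⊗≫ 𝟙 (dualRep Q ⊗ B)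

namespace IrrData
variable (S : IrrData k G)

/-- The projection `Q_{γ,μ}` of `X ⊗ Y`, whose image is the reduced tensor product. -/
def Q (X Y : Center (FDRep k G)) : X.1 ⊗ Y.1 ⟶ X.1 ⊗ Y.1 :=
  S.D⁻¹ • ∑ i, S.d i • (loopTop (S.obj i) X Y ≫ loopBot (S.obj i) X Y)

/-- The transformation `γ ⊗̄ μ`: in the loop defining `Q_{γ,μ}`, a pair of dual bases `φ_α` of
`Hom(B ⊗ X_i, X_j)` and `φ^α` of `Hom(X_j, B ⊗ X_i)` is inserted. -/
def redHalf (X Y : Center (FDRep k G)) (B : FDRep k G) : B ⊗ (X.1 ⊗ Y.1) ⟶ (X.1 ⊗ Y.1) ⊗ B :=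
  S.D⁻¹ • ∑ i, ∑ j, (S.d i * S.d j) • ∑ α,
    (B ◁ loopTop (S.obj i) X Y ⊗≫
      ((homBasis (B ⊗ S.obj i) (S.obj j) α ▷ X.1) ⊗ₘ
        (Y.1 ◁ mate (dualHom (B ⊗ S.obj i) (S.obj j) α))) ⊗≫
      loopBot (S.obj j) X Y ▷ B)

/-- The representation `⨁ X_i ⊗ X_i^*` underlying the unit object `I(1)`. -/
def unitRep : FDRep k G := ⨁ fun i => S.obj i ⊗ dualRep (S.obj i)
/-- The projection of `⨁ X_i ⊗ X_i^*` to a summand. -/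
def unitπ (i : S.ι) : S.unitRep ⟶ S.obj i ⊗ dualRep (S.obj i) := biproduct.π _ i
/-- The inclusion of a summand in `⨁ X_i ⊗ X_i^*`. -/
def unitι (i : S.ι) : S.obj i ⊗ dualRep (S.obj i) ⟶ S.unitRep := biproduct.ι (fun i => S.obj i ⊗ dualRep (S.obj i)) i

/-- The half-braiding `Γ` of the unit object `I(1)`. -/
def unitHalf (B : FDRep k G) : B ⊗ S.unitRep ⟶ S.unitRep ⊗ B :=
  ∑ i, ∑ j, (S.sqrtd i * S.sqrtd j) • ∑ α,
    (B ◁ S.unitπ i ⊗≫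
      (homBasis (B ⊗ S.obj i) (S.obj j) α ⊗ₘ mate (dualHom (B ⊗ S.obj i) (S.obj j) α)) ⊗≫
      S.unitι j ▷ B)

/-- The left unit constraint, on `I(1) ⊗ X`. -/
def leftUnit (X : Center (FDRep k G)) : S.unitRep ⊗ X.1 ⟶ X.1 :=
  ∑ i, (S.sqrtd i / S.sqrtD) •
    (S.unitπ i ▷ X.1 ⊗≫ S.obj i ◁ (braidIso (dualRep (S.obj i)) X.1).hom ⊗≫
      gam X (S.obj i) ▷ dualRep (S.obj i) ⊗≫ X.1 ◁ evalR (S.obj i) ⊗≫ 𝟙 X.1)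

/-- The right unit constraint, on `X ⊗ I(1)`. -/
def rightUnit (X : Center (FDRep k G)) : X.1 ⊗ S.unitRep ⟶ X.1 :=
  ∑ i, (S.sqrtd i / S.sqrtD) •
    (X.1 ◁ S.unitπ i ⊗≫ (braidIso (S.obj i) X.1).inv ▷ dualRep (S.obj i) ⊗≫
      gam X (S.obj i) ▷ dualRep (S.obj i) ⊗≫ X.1 ◁ evalR (S.obj i) ⊗≫ 𝟙 X.1)

/-- The evaluation, on `X^* ⊗ X`. -/
def evalMap (X : Center (FDRep k G)) : dualRep X.1 ⊗ X.1 ⟶ S.unitRep :=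
  ∑ i, (S.sqrtd i / S.sqrtD) •
    (𝟙 (dualRep X.1 ⊗ X.1) ⊗≫ dualRep X.1 ◁ coevL (S.obj i) ▷ X.1 ⊗≫
      (dualRep X.1 ⊗ S.obj i) ◁ gam X (dualRep (S.obj i)) ⊗≫
      (dualRep X.1 ◁ (braidIso (S.obj i) X.1).hom) ▷ dualRep (S.obj i) ⊗≫
      evalL X.1 ▷ (S.obj i ⊗ dualRep (S.obj i)) ⊗≫ S.unitι i)

/-- The coevaluation, to `X ⊗ X^*`. -/
def coevMap (X : Center (FDRep k G)) : S.unitRep ⟶ X.1 ⊗ dualRep X.1 :=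
  ∑ i, (S.sqrtd i / S.sqrtD) •
    (S.unitπ i ⊗≫ S.obj i ◁ coevL X.1 ▷ dualRep (S.obj i) ⊗≫
      gam X (S.obj i) ▷ (dualRep X.1 ⊗ dualRep (S.obj i)) ⊗≫
      (X.1 ⊗ S.obj i) ◁ (braidIso (dualRep X.1) (dualRep (S.obj i))).hom ⊗≫
      X.1 ◁ evalR (S.obj i) ▷ dualRep X.1 ⊗≫ 𝟙 (X.1 ⊗ dualRep X.1))
end IrrData

/-- The half-braiding `γ^∨` of the dual. -/
def dualHalf (X : Center (FDRep k G)) (A : FDRep k G) : A ⊗ dualRep X.1 ⟶ dualRep X.1 ⊗ A :=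
  (braidIso A (dualRep X.1)).hom ⊗≫ (dualRep X.1 ⊗ A) ◁ coevL X.1 ⊗≫
    dualRep X.1 ◁ gam X A ▷ dualRep X.1 ⊗≫ evalL X.1 ▷ (A ⊗ dualRep X.1) ⊗≫
    (braidIso A (dualRep X.1)).hom

/-- The pivotal monoidal category `(Z(Rep(G, z)), ⊗̄)` of the reduced tensor product. -/
structure ReducedStructure (S : IrrData k G) where
  [mon : MonoidalCategory (ReducedCenter k G)]
  /-- the inclusion of `X ⊗̄ Y` in `X ⊗ Y` -/
  incl : ∀ X Y : ReducedCenter k G, (X ⊗ Y : ReducedCenter k G).1 ⟶ X.1 ⊗ Y.1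
  /-- the projection of `X ⊗ Y` to `X ⊗̄ Y` -/
  proj : ∀ X Y : ReducedCenter k G, X.1 ⊗ Y.1 ⟶ (X ⊗ Y : ReducedCenter k G).1
  /-- `X ⊗̄ Y` is the image of `Q` -/
  incl_proj : ∀ X Y, incl X Y ≫ proj X Y = 𝟙 _
  proj_incl : ∀ X Y, proj X Y ≫ incl X Y = S.Q X Y
  /-- its half-braiding is the restriction of `γ ⊗̄ μ` -/
  half : ∀ X Y B, gam (X ⊗ Y : ReducedCenter k G) B ≫ incl X Y ▷ B = B ◁ incl X Y ≫ S.redHalf X Y B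
  /-- the tensor product of morphisms is the restriction of the usual one -/
  map : ∀ {X X' Y Y' : ReducedCenter k G} (f : X ⟶ X') (g : Y ⟶ Y'),
    (f ⊗ₘ g).f ≫ incl X' Y' = incl X Y ≫ (f.f ⊗ₘ g.f)
  /-- the associativity constraint is the restriction of the usual one -/
  assoc : ∀ X Y Z : ReducedCenter k G,
    (α_ X Y Z).hom.f ≫ incl X (Y ⊗ Z) ≫ X.1 ◁ incl Y Z =
      incl (X ⊗ Y) Z ≫ incl X Y ▷ Z.1 ≫ (α_ X.1 Y.1 Z.1).hom
  /-- the unit object is `I(1) = ⨁ X_i ⊗ X_i^*` -/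
  unit : (𝟙_ (ReducedCenter k G)).1 ≅ S.unitRep
  unit_half : ∀ B, gam (𝟙_ (ReducedCenter k G)) B ≫ unit.hom ▷ B = B ◁ unit.hom ≫ S.unitHalf B
  left_unit : ∀ X : ReducedCenter k G,
    (λ_ X).hom.f = incl (𝟙_ _) X ≫ unit.hom ▷ X.1 ≫ S.leftUnit X
  right_unit : ∀ X : ReducedCenter k G,
    (ρ_ X).hom.f = incl X (𝟙_ _) ≫ X.1 ◁ unit.hom ≫ S.rightUnit X
  [rigid : RightRigidCategory (ReducedCenter k G)]
  /-- the dual of `(X, γ)` is `(X^*, γ^∨)` -/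
  dual : ∀ X : ReducedCenter k G, (Xᘁ).1 ≅ dualRep X.1
  dual_half : ∀ (X : ReducedCenter k G) A,
    gam (Xᘁ : ReducedCenter k G) A ≫ (dual X).hom ▷ A = A ◁ (dual X).hom ≫ dualHalf X A
  dual_ev : ∀ X : ReducedCenter k G,
    (ε_ X (Xᘁ)).f ≫ unit.hom = incl (Xᘁ) X ≫ (dual X).hom ▷ X.1 ≫ S.evalMap X
  dual_coev : ∀ X : ReducedCenter k G,
    (η_ X (Xᘁ)).f = unit.hom ≫ S.coevMap X ≫ X.1 ◁ (dual X).inv ≫ proj X (Xᘁ)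
  /-- the pivotal structure is that of `Rep(G)` -/
  pivotal : PivotalStructure (ReducedCenter k G)
  pivotal_eq : ∀ X : ReducedCenter k G,
    (pivotal.iso X).hom.f ≫ (dual (Xᘁ)).hom ≫ dualMap (dual X).inv = dblDualRep X.1
end Reduced
end RedCenter

end

open RedCenter

/-! Testing a half-braiding on the maps `k[G] → A`, `e ↦ a`, gives `γ_A(a ⊗ x) = ∑_g δ_g x ⊗ g a`
(`gam_tm`): it is the same thing as an equivariant grading of `X` by `G`. Hence `T` is fully
faithful, and `DoubleModule.toCenter`, which builds a half-braiding from a grading by this formula,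
makes it an equivalence.

The twisted product of `D(G)`-modules is already a monoidal product: for the regrading `δ_g e⁰ +
δ_{gz} e¹` it is the plain fiberwise product. Its structure is pulled back along `T` to the center,
so that `T` is monoidal with constraint the identity of vectors. What has to be proved is that the
structure thus obtained is the one given by the diagrams. For this, every diagram is evaluated on
vectors.

Two facts make the evaluation possible. The Koszul sign is an action of `z`: `c(x ⊗ y) = ∑_τ y^τ ⊗
z^τ x` (`lin_braid`). So for `x` of parity `σ` and degree `g`, and `y` of parity `τ` and degree `h`,
the loop colored by `A` is multiplication by the trace of `h⁻¹ z^τ g z^σ` on `A` (`lin_loop`). Next,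
`𝒟⁻¹ ∑ d_i χ_i` is the delta function at the identity, by the character of the regular
representation (`sum_d_trace`). The sum over colors therefore keeps exactly the components with `h =
z^τ g z^σ`; with `b = z^τ g` this reads `g = b z^τ`, `h = b z^σ`, and `Q` is the projection to the
twisted product (`lin_Q`). In the half-braiding, `∑_j d_j ∑_α φ^α φ_α` is the identity by Schur's
lemma (`sum_homBasis_dualHom`), which removes the inserted bases and leaves `b` acting on `B`
(`lin_redHalf`). Matrix coefficients identify `⨁ X_i ⊗ X_i^*` with the functions on `G`
(`theta_bijective`), and turn the unit constraints, evaluation and coevaluation into sums over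
fibers.

For pivotality, a faithful monoidal functor to `D(G)`-modules turns a form `A ⊗ B → 1` into a
bilinear map with values in functions on `G`, and the evaluation of a tensor product becomes a
pointwise product (`val_tensor`). A morphism `X → X^**` is the canonical one when pairing with the
image of `x` is evaluation at `x` (`IsDoubleDual`). Naturality, monoidality and preservation by `T`
all follow from this characterization. -/

noncomputable section

namespace RedCenter
open scoped Classical
open Supergroup (z z_comm z_sq)
set_option linter.unusedSectionVars false
set_option linter.unusedSimpArgs false

/-! ### Semisimplicity, dual bases and the character of the regular representation. -/

section Semisimple
variable {k : Type u} [Field k] {G : Type u} [Group G]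

/-- A bijective morphism of representations is an isomorphism. -/
lemma isIso_of_bijective {X Y : FDRep k G} (f : X ⟶ Y) (hf : Function.Bijective (lin f)) :
    IsIso f := by
  let e := LinearEquiv.ofBijective (lin f) hf
  refine ⟨homOf (e.symm : Y →ₗ[k] X) (fun g y => ?_), ?_, ?_⟩
  · obtain ⟨x, rfl⟩ := e.surjective y
    have : Y.ρ g (e x) = e (X.ρ g x) := (lin_ρ f g x).symm
    change e.symm (Y.ρ g (e x)) = X.ρ g (e.symm (e x))
    rw [this, e.symm_apply_apply, e.symm_apply_apply]
  · exact lin_injective (LinearMap.ext fun x => e.symm_apply_apply x)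
  · exact lin_injective (LinearMap.ext fun x => e.apply_symm_apply x)

/-- The kernel is stable under `G`, so its inclusion is a morphism killed by `f`, hence zero. -/
lemma lin_injective_of_mono {X Y : FDRep k G} (f : X ⟶ Y) [Mono f] :
    Function.Injective (lin f) := by
  let K := LinearMap.ker (lin f)
  let ρK : Representation k G K :=
    { toFun := fun g => (X.ρ g).restrict (p := K) (q := K) (fun x hx => by
        have hx' : lin f x = 0 := hx
        change lin f (X.ρ g x) = 0
        rw [lin_ρ, hx', map_zero])
      map_one' := by ext x; simp
      map_mul' := fun g h => by ext x; simp }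
  let i : FDRep.of ρK ⟶ X := homOf (X := FDRep.of ρK) K.subtype (fun g x => rfl)
  have h : i ≫ f = 0 := lin_injective (LinearMap.ext fun x => 
    (show lin f (K.subtype x) = 0 from LinearMap.mem_ker.mp x.2))
  have h0 : i = 0 := Limits.zero_of_comp_mono f h
  rw [← LinearMap.ker_eq_bot, LinearMap.ker_eq_bot']
  intro x hx
  exact LinearMap.congr_fun (congrArg lin h0) (⟨x, hx⟩ : K)

/-- A representation that is not simple has a nonzero proper subobject, of strictly smaller
dimension; the induction is on a bound for the dimension. -/
lemma exists_simple_mono (n : ℕ) : ∀ V : FDRep k G, Module.finrank k V ≤ n → 𝟙 V ≠ 0 →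
    ∃ (S : FDRep k G) (_ : Simple S) (i : S ⟶ V), Mono i := by
  induction n with
  | zero =>
    intro V hV h1
    refine absurd (lin_injective (LinearMap.ext fun x => ?_)) h1
    have := Module.finrank_zero_iff.mp (Nat.le_zero.mp hV)
    exact Subsingleton.elim _ _
  | succ n ih =>
    intro V hV h1
    by_cases hs : Simple V
    · exact ⟨V, hs, 𝟙 V, inferInstance⟩
    · obtain ⟨Y, f, hf, hn⟩ : ∃ (Y : FDRep k G) (f : Y ⟶ V) (_ : Mono f), ¬ (IsIso f ↔ f ≠ 0) := by
        by_contra hc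
        push Not at hc
        exact hs ⟨fun {Y} f hm => hc Y f hm⟩
      -- Since `V` is nonzero, an isomorphism onto it is nonzero; so simplicity can only fail
      -- through a nonzero `f` that is not an isomorphism.
      have hiso : IsIso f → f ≠ 0 := fun hi h0 => h1 (by
        rw [← IsIso.inv_hom_id f]; simp [h0])
      have hf0 : f ≠ 0 := by
        intro h0; exact hn ⟨hiso, fun h => absurd h0 h⟩
      have hni : ¬ IsIso f := fun hi => hn ⟨hiso, fun _ => hi⟩
      have hinj := lin_injective_of_mono f
      have hlt : Module.finrank k Y < Module.finrank k V := by
        refine lt_of_le_of_ne (LinearMap.finrank_le_finrank_of_injective hinj) fun he => hni ?_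
        exact isIso_of_bijective f ⟨hinj,
          (LinearMap.injective_iff_surjective_of_finrank_eq_finrank he).mp hinj⟩
      have hY : 𝟙 Y ≠ 0 := fun h => hf0 (by rw [← Category.id_comp f, h]; simp)
      obtain ⟨S, hS, i, hi⟩ := ih Y (by omega) hY
      exact ⟨S, hS, i ≫ f, mono_comp i f⟩

variable [CharZero k] [Fintype G] [Supergroup G]

/-- The condition of Maschke's theorem, on which the injectivity and projectivity of all objects
rest. -/
instance : NeZero (Nat.card G : k) := ⟨by simp⟩

/-- The morphisms from a representation to the simple ones are jointly faithful. -/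
lemma eq_zero_of_comp_simple {U V : FDRep k G} (f : U ⟶ V)
    (h : ∀ (S : FDRep k G) (_ : Simple S) (r : V ⟶ S), f ≫ r = 0) : f = 0 := by
  by_contra hf
  let ι := Abelian.image.ι f
  let e := Abelian.factorThruImage f
  have hef : e ≫ ι = f := Abelian.image.fac f
  have hW : 𝟙 (Abelian.image f) ≠ 0 := fun h0 => hf (by
    rw [← hef, ← Category.comp_id e, h0]; simp)
  obtain ⟨S, hS, i, hi⟩ := exists_simple_mono _ _ le_rfl hW
  have := mono_comp i ι
  -- A simple subobject of the image of `f` is a direct summand of `V`; the retraction onto it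
  -- cannot kill `f`.
  let r : V ⟶ S := Injective.factorThru (𝟙 S) (i ≫ ι)
  have hr : (i ≫ ι) ≫ r = 𝟙 S := Injective.comp_factorThru _ _
  have h0 : e ≫ (ι ≫ r) = 0 := by rw [← Category.assoc, hef]; exact h S hS r
  have h1 : ι ≫ r = 0 := (cancel_epi e).mp (h0.trans Limits.comp_zero.symm)
  rw [Category.assoc, h1, Limits.comp_zero] at hr
  exact id_nonzero S hr.symm

lemma finrank_ne_zero_of_simple (S : FDRep k G) [Simple S] : (Module.finrank k S : k) ≠ 0 := by
  intro h
  have := Module.finrank_zero_iff.mp (Nat.cast_eq_zero.mp h)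
  exact id_nonzero S (lin_injective (LinearMap.ext fun x => Subsingleton.elim _ _))

/-- The trace pairing `Hom(Q, P) × Hom(P, Q) → k`. -/
def trPair (P Q : FDRep k G) : (Q ⟶ P) →ₗ[k] (P ⟶ Q) →ₗ[k] k :=
  LinearMap.mk₂ k (fun ψ φ => LinearMap.trace k Q (lin (ψ ≫ φ)))
    (fun a b c => by simp)
    (fun c a b => by simp)
    (fun a b c => by simp)
    (fun c a b => by simp)

/-- A nonzero `φ : P → Q` is epi because `Q` is simple, and splits by projectivity; pairing it with
a section gives `dim Q`, nonzero in characteristic zero. In finite dimension, injectivity in one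
variable is surjectivity in the other. -/
lemma trPair_surjective (P Q : FDRep k G) [Simple Q] : Function.Surjective (trPair P Q) := by
  have h : Function.Injective (trPair P Q).flip := by
    rw [← LinearMap.ker_eq_bot, LinearMap.ker_eq_bot']
    intro φ hφ
    by_contra h0
    have := epi_of_nonzero_to_simple h0
    have h1 := LinearMap.congr_fun hφ (Projective.factorThru (𝟙 Q) φ)
    change LinearMap.trace k Q (lin (Projective.factorThru (𝟙 Q) φ ≫ φ)) = 0 at h1
    rw [Projective.factorThru_comp, lin_id, LinearMap.trace_id] at h1
    exact finrank_ne_zero_of_simple Q h1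
  exact LinearMap.flip_injective_iff₁.mp h

/-- The condition by which `dualHom` is chosen can be met: the coordinate functionals are
represented by the trace pairing. -/
lemma dualHom_spec (P Q : FDRep k G) [Simple Q] (α) (β) :
    LinearMap.trace k Q (lin (dualHom P Q α ≫ homBasis P Q β)) = if α = β then 1 else 0 := by
  have : ∃ ψ : Q ⟶ P, ∀ β, LinearMap.trace k Q (lin (ψ ≫ homBasis P Q β)) =
      if α = β then 1 else 0 := by
    obtain ⟨ψ, hψ⟩ := trPair_surjective P Q ((homBasis P Q).coord α)
    refine ⟨ψ, fun β => ?_⟩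
    have := LinearMap.congr_fun hψ (homBasis P Q β)
    refine this.trans ?_
    rw [Module.Basis.coord_apply, Module.Basis.repr_self, Finsupp.single_apply]
    simp [eq_comm]
  exact Classical.epsilon_spec this β

variable [IsAlgClosed k]

/-- By Schur's lemma the composite is a scalar, and its trace, which is `dim Q` times the scalar, is
prescribed. -/
lemma dualHom_comp (P Q : FDRep k G) [Simple Q] (α) (β) :
    dualHom P Q α ≫ homBasis P Q β =
      (if α = β then (Module.finrank k Q : k)⁻¹ else 0) • 𝟙 Q := by
  obtain ⟨c, hc⟩ := endomorphism_simple_eq_smul_id k (dualHom P Q α ≫ homBasis P Q β)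
  have h := dualHom_spec P Q α β
  rw [← hc, lin_smul, map_smul, lin_id, LinearMap.trace_id, smul_eq_mul] at h
  rw [← hc]
  congr 1
  have hd := finrank_ne_zero_of_simple Q
  split_ifs at h ⊢
  · exact eq_inv_of_mul_eq_one_left h
  · exact (mul_eq_zero.mp h).resolve_right hd

variable (S : IrrData k G)

lemma hom_eq_zero_of_ne {i j : S.ι} (hij : i ≠ j) (f : S.obj i ⟶ S.obj j) : f = 0 := by
  by_contra h
  have := S.simple i
  have := S.simple j
  have := isIso_of_hom_simple h
  exact hij (S.distinct i j ⟨asIso f⟩)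

/-- The decomposition of the identity of a representation into simple components. -/
lemma sum_homBasis_dualHom (V : FDRep k G) :
    ∑ j, S.d j • ∑ α, homBasis V (S.obj j) α ≫ dualHom V (S.obj j) α = 𝟙 V := by
  set E := ∑ j, S.d j • ∑ α, homBasis V (S.obj j) α ≫ dualHom V (S.obj j) α with hE
  -- Only `j = i` and `α = β` contribute, and there the factor `d_i` cancels the scalar of
  -- `dualHom_comp`.
  have h1 : ∀ i β, E ≫ homBasis V (S.obj i) β = homBasis V (S.obj i) β := by
    intro i β
    have := S.simple i
    rw [hE, Preadditive.sum_comp, Finset.sum_eq_single i]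
    · rw [Linear.smul_comp, Preadditive.sum_comp, Finset.sum_eq_single β]
      · rw [Category.assoc, dualHom_comp, if_pos rfl, Linear.comp_smul, Category.comp_id,
          smul_smul, IrrData.d, mul_inv_cancel₀ (finrank_ne_zero_of_simple _), one_smul]
      · intro α _ hα
        rw [Category.assoc, dualHom_comp, if_neg hα, zero_smul, Limits.comp_zero]
      · simp
    · intro j _ hj
      rw [Linear.smul_comp, Preadditive.sum_comp, Finset.sum_eq_zero, smul_zero]
      intro α _
      rw [Category.assoc, hom_eq_zero_of_ne S hj (dualHom V (S.obj j) α ≫ homBasis V (S.obj i) β),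
        Limits.comp_zero]
    · simp
  have h2 : ∀ i (r : V ⟶ S.obj i), E ≫ r = r := by
    intro i r
    rw [← (homBasis V (S.obj i)).sum_repr r, Preadditive.comp_sum]
    simp only [Linear.comp_smul, h1]
  -- `E` and the identity agree after every morphism to a simple object, and these morphisms
  -- separate.
  refine sub_eq_zero.mp (eq_zero_of_comp_simple _ fun W hW r => ?_)
  obtain ⟨i, ⟨e⟩⟩ := S.complete W hW
  have h3 : r = (r ≫ e.hom) ≫ e.inv := by simp
  rw [h3, ← Category.assoc, Preadditive.sub_comp, Category.id_comp, h2, sub_self,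
    Limits.zero_comp]

lemma comp_sum_lin {V W Z : Type u} [AddCommGroup V] [Module k V] [AddCommGroup W] [Module k W]
    [AddCommGroup Z] [Module k Z] {ι : Type*} (s : Finset ι) (f : W →ₗ[k] Z) (h : ι → V →ₗ[k] W) :
    f ∘ₗ ∑ i ∈ s, h i = ∑ i ∈ s, f ∘ₗ h i := by
  ext x; simp [LinearMap.sum_apply]

lemma trace_lin_comm {V W : FDRep k G} (f : V ⟶ W) (h : W →ₗ[k] V) :
    LinearMap.trace k V (h ∘ₗ lin f) = LinearMap.trace k W (lin f ∘ₗ h) :=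
  LinearMap.trace_comp_comm' _ _

/-- Translation by `g` permutes the basis, and has a fixed point only for `g = 1`. -/
lemma trace_reg (g : G) :
    LinearMap.trace k (reg k G) ((reg k G).ρ g) = if g = 1 then (Fintype.card G : k) else 0 := by
  have h := LinearMap.trace_eq_matrix_trace k (Pi.basisFun k G)
    (LinearMap.funLeft k k (fun h => g⁻¹ * h))
  refine h.trans ?_
  simp only [Matrix.trace, Matrix.diag, LinearMap.toMatrix_apply, Pi.basisFun_apply,
    Pi.basisFun_repr, LinearMap.funLeft_apply, Pi.single_apply]
  by_cases hg : g = 1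
  · subst hg; simp
  · simp [hg]

/-- Morphisms from the regular representation are determined by a vector. -/
def regHomEquiv (V : FDRep k G) : (reg k G ⟶ V) ≃ₗ[k] V where
  toFun f := lin f (regb 1)
  map_add' _ _ := rfl
  map_smul' _ _ := rfl
  invFun v := regMap v
  left_inv f := by
    refine lin_injective (LinearMap.ext fun x => ?_)
    rw [reg_eq_sum x, map_sum, map_sum]
    refine Finset.sum_congr rfl fun h _ => ?_
    rw [map_smul, map_smul, regMap_regb, ← lin_ρ, reg_ρ_regb, mul_one]
  right_inv v := by
    change lin (regMap v) (regb 1) = v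
    rw [regMap_regb]; simp

/-- The character of the regular representation. -/
lemma sum_d_trace (g : G) :
    ∑ i, S.d i * LinearMap.trace k (S.obj i) ((S.obj i).ρ g) =
      if g = 1 then (Fintype.card G : k) else 0 := by
  -- Each term factors through `X_i`; cyclicity of the trace moves it there, where `dualHom_comp`
  -- gives the scalar.
  have h1 : ∀ i α, LinearMap.trace k (reg k G) ((reg k G).ρ g ∘ₗ
      lin (homBasis (reg k G) (S.obj i) α ≫ dualHom (reg k G) (S.obj i) α)) =
      (S.d i)⁻¹ * LinearMap.trace k (S.obj i) ((S.obj i).ρ g) := by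
    intro i α
    have := S.simple i
    rw [lin_comp, ← LinearMap.comp_assoc, trace_lin_comm, ← LinearMap.comp_assoc]
    have h2 : (lin (homBasis (reg k G) (S.obj i) α) ∘ₗ (reg k G).ρ g) ∘ₗ
        lin (dualHom (reg k G) (S.obj i) α) = (S.obj i).ρ g ∘ₗ
        lin (dualHom (reg k G) (S.obj i) α ≫ homBasis (reg k G) (S.obj i) α) := by
      ext x; exact lin_ρ _ _ _
    rw [h2, dualHom_comp, if_pos rfl, lin_smul, lin_id, LinearMap.comp_smul, map_smul]
    rfl
  rw [← trace_reg g]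
  have h2 : (reg k G).ρ g = (reg k G).ρ g ∘ₗ lin (𝟙 (reg k G)) := rfl
  rw [h2, ← sum_homBasis_dualHom S (reg k G), lin_sum, comp_sum_lin, map_sum]
  refine Finset.sum_congr rfl fun i _ => ?_
  have := S.simple i
  rw [lin_smul, LinearMap.comp_smul, map_smul, lin_sum, comp_sum_lin, map_sum]
  simp only [h1, Finset.sum_const, Finset.card_univ, Fintype.card_fin, smul_eq_mul, nsmul_eq_mul]
  -- The number of indices `α` is the multiplicity of `X_i` in `k[G]`, that is `d_i`; it cancels the
  -- scalar `d_i⁻¹`.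
  rw [(regHomEquiv (S.obj i)).finrank_eq]
  change _ = S.d i * (S.d i * _)
  rw [mul_inv_cancel_left₀ (show S.d i ≠ 0 from finrank_ne_zero_of_simple (S.obj i))]

/-- The character of the regular representation at the identity. -/
lemma D_eq : S.D = (Fintype.card G : k) := by
  have := sum_d_trace S 1
  rw [if_pos rfl] at this
  rw [← this, IrrData.D]
  refine Finset.sum_congr rfl fun i _ => ?_
  rw [map_one, Module.End.one_eq_id, LinearMap.trace_id, sq]; rfl
lemma D_ne_zero : S.D ≠ 0 := by rw [D_eq]; simp
lemma sqrtD_mul_self : S.sqrtD * S.sqrtD = S.D := by rw [← sq, S.sqrtD_sq]; rfl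
lemma sqrtD_ne_zero : S.sqrtD ≠ 0 := fun h => D_ne_zero S (by rw [← sqrtD_mul_self, h, zero_mul])
lemma sqrtd_mul_self (i : S.ι) : S.sqrtd i * S.sqrtd i = S.d i := by rw [← sq, S.sqrtd_sq]; rfl

instance simpleSetoid : Setoid {V : FDRep k G // Simple V} where
  r V W := Nonempty (V.1 ≅ W.1)
  iseqv := ⟨fun V => ⟨Iso.refl _⟩, fun ⟨e⟩ => ⟨e.symm⟩, fun ⟨e⟩ ⟨f⟩ => ⟨e ≪≫ f⟩⟩

variable (k G) in
-- Characters of non-isomorphic simple objects are orthonormal, so linearly independent in the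
-- finite-dimensional space of functions on `G`.
lemma finite_simple : Finite (Quotient (simpleSetoid (k := k) (G := G))) := by
  have := invertibleOfNonzero (NeZero.ne (Nat.card G : k))
  have h : LinearIndependent k (fun q : Quotient (simpleSetoid (k := k) (G := G)) =>
      q.out.1.character) := by
    rw [linearIndependent_iff']
    intro s c hc q hq
    have h1 := congrArg (fun f : G → k =>
      (Nat.card G : k)⁻¹ * ∑ g : G, f g * q.out.1.character g⁻¹) hc
    simp only [Finset.sum_apply, Pi.smul_apply, smul_eq_mul, Pi.zero_apply, zero_mul,
      Finset.sum_const_zero, mul_zero, Finset.sum_mul, mul_assoc] at h1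
    rw [Finset.sum_comm, Finset.mul_sum, Finset.sum_eq_single q] at h1
    · have := q.out.2
      rw [← Finset.mul_sum, mul_left_comm, FDRep.char_orthonormal, if_pos ⟨Iso.refl _⟩,
        mul_one] at h1
      exact h1
    · intro p _ hp
      have := q.out.2
      have := p.out.2
      rw [← Finset.mul_sum, mul_left_comm, FDRep.char_orthonormal, if_neg, mul_zero]
      intro he
      exact hp (by rw [← Quotient.out_eq p, ← Quotient.out_eq q]; exact Quotient.sound he)
    · exact fun h => absurd hq h
  exact h.finite_of_isNoetherian

variable (k G) in
-- The isomorphism classes are numbered by some `Fin n`, since the index set has to live in the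
-- lowest universe; the square roots exist because `k` is algebraically closed.
lemma nonempty_irrData : Nonempty (IrrData k G) := by
  have := finite_simple k G
  obtain ⟨n, ⟨e⟩⟩ := Finite.exists_equiv_fin (Quotient (simpleSetoid (k := k) (G := G)))
  have hs : ∀ x : k, ∃ y, y ^ 2 = x := fun x => IsAlgClosed.exists_pow_nat_eq x two_pos
  choose r hr using hs
  exact ⟨{
    ι := Fin n
    obj := fun i => (e.symm i).out.1
    simple := fun i => (e.symm i).out.2
    distinct := fun i j h => e.symm.injective (by
      rw [← Quotient.out_eq (e.symm i), ← Quotient.out_eq (e.symm j)]; exact Quotient.sound h)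
    complete := fun V hV => ⟨e ⟦⟨V, hV⟩⟧, by
      rw [e.symm_apply_apply]
      exact Setoid.symm (Quotient.mk_out (s := simpleSetoid) ⟨V, hV⟩)⟩
    sqrtd := fun i => r _
    sqrtd_sq := fun i => hr _
    sqrtD := r _
    sqrtD_sq := hr _ }⟩

end Semisimple

/-! ### The loops on vectors: `Q` is the projection to the twisted product. -/

section Elements
variable {k : Type u} [Field k] {G : Type u} [Group G]

/-- The value of an element of the dual representation. -/
def dapp {X : FDRep k G} (f : dualRep X) (x : X) : k := (show Module.Dual k X from f) x

section
variable {X Y : FDRep k G}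
lemma dapp_add (f : dualRep X) (x y : X) : dapp f (x + y) = dapp f x + dapp f y := map_add _ _ _
lemma dapp_smul (f : dualRep X) (c : k) (x : X) : dapp f (c • x) = c * dapp f x := map_smul _ _ _
lemma dapp_ρ (f : dualRep X) (g : G) (x : X) : dapp ((dualRep X).ρ g f) x = dapp f (X.ρ g⁻¹ x) :=
  rfl
variable (X) in
/-- A basis of a representation. -/
abbrev rbas := Module.Basis.ofVectorSpace k X
variable (X) in
/-- The dual basis. -/
def rcob (s : Module.Basis.ofVectorSpaceIndex k X) : dualRep X := (rbas X).coord s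
lemma sum_rcob (f : dualRep X) : ∑ s, dapp f (rbas X s) • rcob X s = f :=
  (rbas X).sum_dual_apply_smul_coord f
lemma sum_rbas (x : X) : ∑ s, dapp (rcob X s) x • rbas X s = x := (rbas X).sum_repr x
lemma trace_eq_sum (f : X →ₗ[k] X) : LinearMap.trace k X f = ∑ s, dapp (rcob X s) (f (rbas X s)) := by
  rw [LinearMap.trace_eq_matrix_trace k (rbas X), Matrix.trace]
  simp only [Matrix.diag, LinearMap.toMatrix_apply]
  rfl

@[simp] lemma lin_evalR (x : X) (f : dualRep X) : lin (evalR X) (tm x f) = un (dapp f x) := rfl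
@[simp] lemma lin_evalL (x : X) (f : dualRep X) : lin (evalL X) (tm f x) = un (dapp f x) := rfl
@[simp] lemma lin_coevL : lin (coevL X) (un 1) = ∑ s, tm (rbas X s) (rcob X s) :=
  coevaluation_apply_one k X
@[simp] lemma lin_coevR : lin (coevR X) (un 1) = ∑ s, tm (rcob X s) (rbas X s) := by
  have : lin (coevR X) (un 1) = TensorProduct.comm k X (Module.Dual k X) (coevaluation k X 1) := rfl
  rw [this, coevaluation_apply_one, map_sum]; rfl
end

lemma tensor_induction {X Y : FDRep k G} {p : (X ⊗ Y : FDRep k G) → Prop}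
    (t : (X ⊗ Y : FDRep k G)) (h : ∀ x y, p (tm x y)) (ha : ∀ a b, p a → p b → p (a + b)) :
    p t :=
  TensorProduct.induction_on t (by simpa only [zero_tm] using h 0 0) h ha

/-- The contraction `B ⊗ P → B` with an element of the dual of `P`. -/
def contr {B P : FDRep k G} (f : dualRep P) : (B ⊗ P : FDRep k G) →ₗ[k] B :=
  (TensorProduct.rid k B).toLinearMap ∘ₗ (show Module.Dual k P from f).lTensor B
lemma contr_tm {B P : FDRep k G} (f : dualRep P) (b : B) (p : P) :
    contr f (tm b p) = dapp f p • b := rfl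

/-- The coevaluation of `Q` supplies the dual bases, and the evaluation of `P` contracts the result
with `f`. -/
lemma lin_mate {B P Q : FDRep k G} (ψ : Q ⟶ B ⊗ P) (f : dualRep P) :
    lin (mate ψ) f = ∑ t, tm (rcob Q t) (contr f (lin ψ (rbas Q t))) := by
  simp only [mate, monoidalComp, MonoidalCoherence.refl_iso, MonoidalCoherence.whiskerLeft_iso,
    MonoidalCoherence.whiskerRight_iso, MonoidalCoherence.tensor_right_iso,
    MonoidalCoherence.tensor_right'_iso, MonoidalCoherence.left_iso, MonoidalCoherence.left'_iso,
    MonoidalCoherence.right_iso, MonoidalCoherence.right'_iso, MonoidalCoherence.assoc_iso,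
    MonoidalCoherence.assoc'_iso, Iso.trans_hom, Iso.symm_hom, Iso.refl_hom, whiskerLeftIso_hom,
    whiskerRightIso_hom, Category.comp_id, Category.id_comp, whiskerLeft_id, id_whiskerRight,
    lin_comp, lin_id, LinearMap.comp_apply, LinearMap.id_apply, lin_whiskerLeft, lin_whiskerRight,
    lin_tensorHom, lin_assoc_hom, lin_assoc_inv, lin_leftUnitor_hom, lin_leftUnitor_inv,
    lin_rightUnitor_hom, lin_rightUnitor_inv, lin_coevL, lin_coevR, lin_evalR, lin_evalL,
    tm_sum, sum_tm, map_sum]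
  refine Finset.sum_congr rfl fun s _ => ?_
  -- The rest of the diagram is linear in this vector, and its structure maps compute only on pure
  -- tensors.
  generalize lin ψ (rbas Q s) = t
  induction t using tensor_induction with
  | h b p => simp only [monoidalComp, MonoidalCoherence.refl_iso, MonoidalCoherence.whiskerLeft_iso,
    MonoidalCoherence.whiskerRight_iso, MonoidalCoherence.tensor_right_iso,
    MonoidalCoherence.tensor_right'_iso, MonoidalCoherence.left_iso, MonoidalCoherence.left'_iso,
    MonoidalCoherence.right_iso, MonoidalCoherence.right'_iso, MonoidalCoherence.assoc_iso,
    MonoidalCoherence.assoc'_iso, Iso.trans_hom, Iso.symm_hom, Iso.refl_hom, whiskerLeftIso_hom,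
    whiskerRightIso_hom, Category.comp_id, Category.id_comp, whiskerLeft_id, id_whiskerRight,
    lin_comp, lin_id, LinearMap.comp_apply, LinearMap.id_apply, lin_whiskerLeft, lin_whiskerRight,
    lin_tensorHom, lin_assoc_hom, lin_assoc_inv, lin_leftUnitor_hom, lin_leftUnitor_inv,
    lin_rightUnitor_hom, lin_rightUnitor_inv, lin_coevL, lin_coevR, lin_evalR, lin_evalL,
    tm_sum, sum_tm, map_sum, contr_tm]
  | ha a b ha hb => simp only [add_tm, tm_add, map_add, ha, hb]

variable [CharZero k] [Fintype G] [Supergroup G]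

/-- Since `z` is `(-1)^σ` on the part of parity `σ`, the Koszul sign against parity `τ` is the
action of `z^τ`. -/
lemma sum_sign_par (X : FDRep k G) (τ : Fin 2) (x : X) :
    ∑ σ : Fin 2, (-1 : k) ^ ((σ : ℕ) * τ) • par X.ρ σ x = X.ρ (z ^ (τ : ℕ)) x := by
  have := LinearMap.congr_fun (congrArg₂ (· + ·) (par_zpow X.ρ 0 τ) (par_zpow X.ρ 1 τ)) x
  simp only [Fin.sum_univ_two]
  refine this.symm.trans ?_
  simp only [← add_mul, par_add, one_mul]

/-- One of the two parity sums is absorbed into a power of `z`. Either factor can be the one that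
keeps its parity projections, whence a second form, `lin_braid'`. -/
lemma lin_braid (X Y : FDRep k G) (x : X) (y : Y) :
    lin (braid X Y) (tm x y) = ∑ τ : Fin 2, tm (par Y.ρ τ y) (X.ρ (z ^ (τ : ℕ)) x) := by
  refine (koszul_tmul X Y x y).trans ?_
  rw [Finset.sum_comm]
  refine Finset.sum_congr rfl fun τ _ => ?_
  rw [← sum_sign_par, tm_sum]
  exact Finset.sum_congr rfl fun σ _ => (tm_smul _ _ _).symm
lemma lin_braid' (X Y : FDRep k G) (x : X) (y : Y) :
    lin (braid X Y) (tm x y) = ∑ σ : Fin 2, tm (Y.ρ (z ^ (σ : ℕ)) y) (par X.ρ σ x) := by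
  refine (koszul_tmul X Y x y).trans ?_
  refine Finset.sum_congr rfl fun τ _ => ?_
  rw [← sum_sign_par, sum_tm]
  refine Finset.sum_congr rfl fun σ _ => ?_
  rw [mul_comm]
  exact (smul_tm _ _ _).symm

/-- The parity projections are kept on `X`, so that the power of `z` falls on the color `A`;
everything that happens to `A` can then be collected into one group element. -/
lemma lin_loopTop (A : FDRep k G) (X Y : Center (FDRep k G)) (x : X.1) (y : Y.1) :
    lin (loopTop A X Y) (tm x y) = ∑ s, ∑ σ : Fin 2, ∑ h : G,
      tm (tm (A.ρ (z ^ (σ : ℕ)) (rbas A s)) (par X.1.ρ σ x))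
        (tm (cδ Y h y) ((dualRep A).ρ h (rcob A s))) := by
  simp only [loopTop, monoidalComp, MonoidalCoherence.refl_iso, MonoidalCoherence.whiskerLeft_iso,
    MonoidalCoherence.whiskerRight_iso, MonoidalCoherence.tensor_right_iso,
    MonoidalCoherence.tensor_right'_iso, MonoidalCoherence.left_iso, MonoidalCoherence.left'_iso,
    MonoidalCoherence.right_iso, MonoidalCoherence.right'_iso, MonoidalCoherence.assoc_iso,
    MonoidalCoherence.assoc'_iso, Iso.trans_hom, Iso.symm_hom, Iso.refl_hom, whiskerLeftIso_hom,
    whiskerRightIso_hom, Category.comp_id, Category.id_comp, whiskerLeft_id, id_whiskerRight,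
    lin_comp, lin_id, LinearMap.comp_apply, LinearMap.id_apply, lin_whiskerLeft, lin_whiskerRight,
    lin_tensorHom, lin_assoc_hom, lin_assoc_inv, lin_leftUnitor_hom, lin_leftUnitor_inv,
    lin_rightUnitor_hom, lin_rightUnitor_inv, lin_coevL, lin_coevR, lin_evalR, lin_evalL,
    tm_sum, sum_tm, map_sum,
    braidIso, lin_braid', gam_tm]
  refine Finset.sum_congr rfl fun s _ => Finset.sum_comm

lemma pow_z_inv (τ : Fin 2) : ((z : G) ^ (τ : ℕ))⁻¹ = z ^ (τ : ℕ) := by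
  rw [inv_eq_iff_mul_eq_one, ← pow_add, ← two_mul, pow_mul, sq, z_sq, one_pow]

lemma lin_loopBot (A : FDRep k G) (X Y : Center (FDRep k G)) (a : A) (x : X.1) (y : Y.1)
    (f : dualRep A) :
    lin (loopBot A X Y) (tm (tm a x) (tm y f)) = ∑ g : G, ∑ τ : Fin 2,
      dapp f (A.ρ (z ^ (τ : ℕ)) (A.ρ g a)) • tm (cδ X g x) (par Y.1.ρ τ y) := by
  simp only [loopBot, monoidalComp, MonoidalCoherence.refl_iso, MonoidalCoherence.whiskerLeft_iso,
    MonoidalCoherence.whiskerRight_iso, MonoidalCoherence.tensor_right_iso,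
    MonoidalCoherence.tensor_right'_iso, MonoidalCoherence.left_iso, MonoidalCoherence.left'_iso,
    MonoidalCoherence.right_iso, MonoidalCoherence.right'_iso, MonoidalCoherence.assoc_iso,
    MonoidalCoherence.assoc'_iso, Iso.trans_hom, Iso.symm_hom, Iso.refl_hom, whiskerLeftIso_hom,
    whiskerRightIso_hom, Category.comp_id, Category.id_comp, whiskerLeft_id, id_whiskerRight,
    lin_comp, lin_id, LinearMap.comp_apply, LinearMap.id_apply, lin_whiskerLeft, lin_whiskerRight,
    lin_tensorHom, lin_assoc_hom, lin_assoc_inv, lin_leftUnitor_hom, lin_leftUnitor_inv,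
    lin_rightUnitor_hom, lin_rightUnitor_inv, lin_coevL, lin_coevR, lin_evalR, lin_evalL,
    tm_sum, sum_tm, map_sum,
    braidIso, lin_braid', gam_tm]
  rw [Finset.sum_comm]
  simp only [smul_tm, tm_smul, dapp_ρ, pow_z_inv]

lemma trace_ρ_eq_sum (A : FDRep k G) (h m : G) : ∑ s, dapp ((dualRep A).ρ h (rcob A s))
    (A.ρ m (rbas A s)) = LinearMap.trace k A (A.ρ (h⁻¹ * m)) := by
  rw [trace_eq_sum]
  refine Finset.sum_congr rfl fun s _ => ?_
  rw [dapp_ρ, ← Module.End.mul_apply, ← map_mul]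

lemma ρ_ρ (A : FDRep k G) (g h : G) (a : A) : A.ρ g (A.ρ h a) = A.ρ (g * h) a := by
  rw [map_mul]; rfl

/-- Around the loop a basis vector of `A` meets `z^σ`, then `g` from the half-braiding of `X`, then
`z^τ`, while its dual vector meets `h` from the half-braiding of `Y`. The sum over dual bases is a
trace. -/
lemma lin_loop (A : FDRep k G) (X Y : Center (FDRep k G)) (x : X.1) (y : Y.1) :
    lin (loopTop A X Y ≫ loopBot A X Y) (tm x y) = ∑ σ : Fin 2, ∑ τ : Fin 2, ∑ g : G, ∑ h : G,
      LinearMap.trace k A (A.ρ (h⁻¹ * (z ^ (τ : ℕ) * g * z ^ (σ : ℕ)))) •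
        tm (cδ X g (par X.1.ρ σ x)) (par Y.1.ρ τ (cδ Y h y)) := by
  rw [lin_comp, LinearMap.comp_apply, lin_loopTop]
  simp only [map_sum, lin_loopBot, ρ_ρ]
  rw [Finset.sum_comm]
  refine Finset.sum_congr rfl fun σ _ => ?_
  calc _ = ∑ s, ∑ τ : Fin 2, ∑ g : G, ∑ h : G, dapp ((dualRep A).ρ h (rcob A s))
          (A.ρ (z ^ (τ : ℕ) * g * z ^ (σ : ℕ)) (rbas A s)) •
          (tm (cδ X g (par X.1.ρ σ x)) (par Y.1.ρ τ (cδ Y h y)) : (X.1 ⊗ Y.1 : FDRep k G)) := by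
        refine Finset.sum_congr rfl fun s _ => ?_
        rw [Finset.sum_comm, Finset.sum_comm (s := (Finset.univ : Finset (Fin 2)))]
        refine Finset.sum_congr rfl fun g _ => ?_
        rw [Finset.sum_comm]
        simp only [mul_assoc]
    _ = _ := by
        rw [Finset.sum_comm]
        refine Finset.sum_congr rfl fun τ _ => ?_
        rw [Finset.sum_comm]
        refine Finset.sum_congr rfl fun g _ => ?_
        rw [Finset.sum_comm]
        refine Finset.sum_congr rfl fun h _ => ?_
        rw [← Finset.sum_smul, trace_ρ_eq_sum]

/-- The projection of `X ⊗ Y` to the `b`-fiber of the twisted product. -/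
def cproj (X Y : Center (FDRep k G)) (b : G) : (X.1 ⊗ Y.1 : FDRep k G) →ₗ[k] (X.1 ⊗ Y.1 : FDRep k G) :=
  fiberProj X.1.ρ (cδ X) Y.1.ρ (cδ Y) b
lemma cproj_tm (X Y : Center (FDRep k G)) (b : G) (x : X.1) (y : Y.1) :
    cproj X Y b (tm x y) = ∑ σ : Fin 2, ∑ τ : Fin 2,
      tm (cδ X (b * z ^ (τ : ℕ)) (par X.1.ρ σ x)) (cδ Y (b * z ^ (σ : ℕ)) (par Y.1.ρ τ y)) := by
  change fiberProj X.1.ρ (cδ X) Y.1.ρ (cδ Y) b (x ⊗ₜ y) = _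
  simp only [fiberProj, LinearMap.sum_apply, TensorProduct.map_tmul]
  rfl

lemma z_pow_comm (τ : Fin 2) (g : G) : z ^ (τ : ℕ) * g = g * z ^ (τ : ℕ) := by
  fin_cases τ <;> simp [z_comm]
lemma mul_z_mul_z (τ : Fin 2) (g : G) : g * z ^ (τ : ℕ) * z ^ (τ : ℕ) = g := by
  fin_cases τ <;> simp [zz]

/-- A sum over pairs of group elements related by the parities, as a sum over fibers. -/
lemma sum_fiber (X Y : Center (FDRep k G)) {M : Type u} [AddCommGroup M] [Module k M]
    (F : (X.1 ⊗ Y.1 : FDRep k G) → G → M) (hF : ∀ a b g, F (a + b) g = F a g + F b g)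
    (x : X.1) (y : Y.1) :
    ∑ σ : Fin 2, ∑ τ : Fin 2, ∑ g : G, F (tm (cδ X g (par X.1.ρ σ x)) (par Y.1.ρ τ
      (cδ Y (z ^ (τ : ℕ) * g * z ^ (σ : ℕ)) y))) (z ^ (τ : ℕ) * g) =
    ∑ b, F (cproj X Y b (tm x y)) b := by
  simp only [cproj_tm, Fin.sum_univ_two, hF, Finset.sum_add_distrib]
  -- Substitute `b = z^τ g`. As `z` is central of square one, the two degrees become `b z^τ` and `b
  -- z^σ`, those of the fiber over `b`.
  have key : ∀ σ τ : Fin 2, ∑ g : G, F (tm (cδ X g (par X.1.ρ σ x)) (par Y.1.ρ τ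
      (cδ Y (z ^ (τ : ℕ) * g * z ^ (σ : ℕ)) y))) (z ^ (τ : ℕ) * g) =
      ∑ b, F (tm (cδ X (b * z ^ (τ : ℕ)) (par X.1.ρ σ x))
        (cδ Y (b * z ^ (σ : ℕ)) (par Y.1.ρ τ y))) b := by
    intro σ τ
    refine Fintype.sum_equiv (Equiv.mulLeft (z ^ (τ : ℕ))) _ _ fun g => ?_
    have hp : par Y.1.ρ τ (cδ Y (z ^ (τ : ℕ) * g * z ^ (σ : ℕ)) y) =
        cδ Y (z ^ (τ : ℕ) * g * z ^ (σ : ℕ)) (par Y.1.ρ τ y) :=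
      LinearMap.congr_fun ((center_grading Y).par_comm _ τ) y
    simp only [Equiv.coe_mulLeft, hp]
    rw [z_pow_comm τ g, mul_z_mul_z]
  simp only [key]

variable [IsAlgClosed k] (S : IrrData k G)

/-- The orthogonality that eliminates the color of a loop: it forces the degrees met along its two
halves to match. -/
lemma sum_d_trace' (a b : G) : S.D⁻¹ * ∑ i, S.d i * LinearMap.trace k (S.obj i)
    ((S.obj i).ρ (a⁻¹ * b)) = if a = b then 1 else 0 := by
  rw [sum_d_trace, ← D_eq S]
  by_cases h : a = b
  · rw [if_pos h, if_pos (by rw [h]; simp), inv_mul_cancel₀ (D_ne_zero S)]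
  · rw [if_neg h, if_neg (fun h' => h (inv_mul_eq_one.mp h')), mul_zero]

/-- The projection `Q` is the projection to the twisted fiberwise product. -/
lemma lin_Q (X Y : Center (FDRep k G)) (x : X.1) (y : Y.1) :
    lin (S.Q X Y) (tm x y) = ∑ b, cproj X Y b (tm x y) := by
  rw [← sum_fiber X Y (fun t _ => t) (fun _ _ _ => rfl)]
  simp only [IrrData.Q, lin_smul, lin_sum, LinearMap.smul_apply, LinearMap.sum_apply, lin_loop,
    Finset.smul_sum, smul_smul]
  rw [Finset.sum_comm]
  refine Finset.sum_congr rfl fun σ _ => ?_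
  rw [Finset.sum_comm]
  refine Finset.sum_congr rfl fun τ _ => ?_
  rw [Finset.sum_comm]
  refine Finset.sum_congr rfl fun g _ => ?_
  rw [Finset.sum_comm]
  simp only [← Finset.sum_smul, mul_assoc, ← Finset.mul_sum]
  -- With the color summed first, only `h = z^τ g z^σ` survives in the sum over the degree of `y`.
  simp only [sum_d_trace']
  simp [ite_smul]

end Elements

/-! ### The half-braiding of the reduced tensor product. -/

section HalfBraiding
variable {k : Type u} [Field k] [CharZero k] {G : Type u} [Group G] [Fintype G] [Supergroup G]

lemma sum_dapp_rcob {A M : FDRep k G} (a : A) (F : A →ₗ[k] M) :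
    ∑ t, dapp (rcob A t) a • F (rbas A t) = F a := by
  conv_rhs => rw [← sum_rbas a, map_sum]
  simp only [map_smul]

/-- The mate of `ψ` opens a dual basis of `A'` that the lower half of the loop closes on the image
of `φ`. So `A'` disappears and only the composite endomorphism of `B ⊗ A` remains. -/
lemma lin_redTerm {B A A' : FDRep k G} (φ : B ⊗ A ⟶ A') (ψ : A' ⟶ B ⊗ A)
    (X Y : Center (FDRep k G)) (b : B) (x : X.1) (y : Y.1) :
    lin (B ◁ loopTop A X Y ⊗≫ ((φ ▷ X.1) ⊗ₘ (Y.1 ◁ mate ψ)) ⊗≫ loopBot A' X Y ▷ B)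
      (tm b (tm x y)) = ∑ σ : Fin 2, ∑ τ : Fin 2, ∑ g : G, ∑ h : G, ∑ s,
        tm (tm (cδ X g (par X.1.ρ σ x)) (par Y.1.ρ τ (cδ Y h y)))
          (contr ((dualRep A).ρ h (rcob A s)) (lin (φ ≫ ψ)
            (tm (B.ρ (z ^ (τ : ℕ) * g) b) (A.ρ (z ^ (τ : ℕ) * g * z ^ (σ : ℕ)) (rbas A s))))) := by
  simp only [monoidalComp, MonoidalCoherence.refl_iso, MonoidalCoherence.whiskerLeft_iso,
    MonoidalCoherence.whiskerRight_iso, MonoidalCoherence.tensor_right_iso,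
    MonoidalCoherence.tensor_right'_iso, MonoidalCoherence.left_iso, MonoidalCoherence.left'_iso,
    MonoidalCoherence.right_iso, MonoidalCoherence.right'_iso, MonoidalCoherence.assoc_iso,
    MonoidalCoherence.assoc'_iso, Iso.trans_hom, Iso.symm_hom, Iso.refl_hom, whiskerLeftIso_hom,
    whiskerRightIso_hom, Category.comp_id, Category.id_comp, whiskerLeft_id, id_whiskerRight,
    lin_comp, lin_id, LinearMap.comp_apply, LinearMap.id_apply, lin_whiskerLeft, lin_whiskerRight,
    lin_tensorHom, lin_assoc_hom, lin_assoc_inv, lin_leftUnitor_hom, lin_leftUnitor_inv,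
    lin_rightUnitor_hom, lin_rightUnitor_inv, lin_coevL, lin_coevR, lin_evalR, lin_evalL,
    tm_sum, sum_tm, map_sum, lin_loopTop, lin_mate, lin_loopBot, ρ_ρ, smul_tm]
  have key : ∀ (h : G) s (m : G) (t : (B ⊗ A : FDRep k G)) (v : (X.1 ⊗ Y.1 : FDRep k G)),
      ∑ p, dapp (rcob A' p) (A'.ρ m (lin φ t)) •
        tm v (contr ((dualRep A).ρ h (rcob A s)) (lin ψ (rbas A' p))) =
      tm v (contr ((dualRep A).ρ h (rcob A s)) (lin ψ (lin φ ((B ⊗ A : FDRep k G).ρ m t)))) := by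
    intro h s m t v
    -- By equivariance the group element acting on `A'` passes through `φ`, where it acts on `B` as
    -- well as on `A`. This is how `B` comes to feel the degree.
    rw [lin_ρ]
    exact sum_dapp_rcob (M := (X.1 ⊗ Y.1) ⊗ B) _ (TensorProduct.mk k (X.1 ⊗ Y.1 : FDRep k G) B v ∘ₗ
      contr ((dualRep A).ρ h (rcob A s)) ∘ₗ lin ψ)
  rw [Finset.sum_comm]
  refine Finset.sum_congr rfl fun σ _ => ?_
  calc _ = ∑ s, ∑ h : G, ∑ g : G, ∑ τ : Fin 2,
        tm (tm (cδ X g (par X.1.ρ σ x)) (par Y.1.ρ τ (cδ Y h y)))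
          (contr ((dualRep A).ρ h (rcob A s)) (lin ψ (lin φ
            (tm (B.ρ (z ^ (τ : ℕ) * g) b) (A.ρ (z ^ (τ : ℕ) * g * z ^ (σ : ℕ)) (rbas A s)))))) := by
        refine Finset.sum_congr rfl fun s _ => Finset.sum_congr rfl fun h _ => ?_
        rw [Finset.sum_comm]
        refine Finset.sum_congr rfl fun g _ => ?_
        rw [Finset.sum_comm]
        refine Finset.sum_congr rfl fun τ _ => ?_
        rw [key h s]
        simp only [ρ_tm, ρ_ρ]
    _ = ∑ τ : Fin 2, ∑ s, ∑ h : G, ∑ g : G,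
        tm (tm (cδ X g (par X.1.ρ σ x)) (par Y.1.ρ τ (cδ Y h y)))
          (contr ((dualRep A).ρ h (rcob A s)) (lin ψ (lin φ
            (tm (B.ρ (z ^ (τ : ℕ) * g) b) (A.ρ (z ^ (τ : ℕ) * g * z ^ (σ : ℕ)) (rbas A s)))))) := by
        rw [Finset.sum_comm]
        simp only [Finset.sum_comm (s := (Finset.univ : Finset (Fin 2)))]
        rw [Finset.sum_comm]
    _ = _ := by
        refine Finset.sum_congr rfl fun τ _ => ?_
        rw [Finset.sum_comm]
        conv_rhs => rw [Finset.sum_comm]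
        refine Finset.sum_congr rfl fun h _ => Finset.sum_comm

variable [IsAlgClosed k] (S : IrrData k G)

lemma sum_homBasis_apply (V : FDRep k G) {M : Type*} [AddCommGroup M] [Module k M]
    (F : (V ⟶ V) →ₗ[k] M) :
    ∑ j, S.d j • ∑ α, F (homBasis V (S.obj j) α ≫ dualHom V (S.obj j) α) = F (𝟙 V) := by
  rw [← sum_homBasis_dualHom S V]
  simp only [map_sum, map_smul]

/-- The half-braiding of the reduced tensor product is that of the twisted fibers. -/
lemma lin_redHalf (X Y : Center (FDRep k G)) (B : FDRep k G) (b : B) (x : X.1) (y : Y.1) :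
    lin (S.redHalf X Y B) (tm b (tm x y)) = ∑ c, tm (cproj X Y c (tm x y)) (B.ρ c b) := by
  rw [← sum_fiber X Y (fun t c => (tm t (B.ρ c b) : ((X.1 ⊗ Y.1) ⊗ B : FDRep k G)))
    (fun _ _ _ => add_tm _ _ _)]
  -- The diagram depends linearly on the inserted endomorphism of `B ⊗ A`, so the sum over `j` and
  -- `α` can be replaced by the identity.
  let F (A : FDRep k G) : (B ⊗ A ⟶ B ⊗ A) →ₗ[k] ((X.1 ⊗ Y.1) ⊗ B : FDRep k G) :=
    { toFun := fun f => ∑ σ : Fin 2, ∑ τ : Fin 2, ∑ g : G, ∑ h : G, ∑ s,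
        tm (tm (cδ X g (par X.1.ρ σ x)) (par Y.1.ρ τ (cδ Y h y)))
          (contr ((dualRep A).ρ h (rcob A s)) (lin f
            (tm (B.ρ (z ^ (τ : ℕ) * g) b) (A.ρ (z ^ (τ : ℕ) * g * z ^ (σ : ℕ)) (rbas A s)))))
      map_add' := fun f f' => by
        simp only [lin_add, LinearMap.add_apply, map_add, tm_add, Finset.sum_add_distrib]
      map_smul' := fun c f => by
        simp only [lin_smul, LinearMap.smul_apply, map_smul, tm_smul, Finset.smul_sum,
          RingHom.id_apply] }
  have h1 : lin (S.redHalf X Y B) (tm b (tm x y)) = S.D⁻¹ • ∑ i, S.d i • F (S.obj i) (𝟙 _) := by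
    simp only [IrrData.redHalf, lin_smul, lin_sum, LinearMap.smul_apply, LinearMap.sum_apply,
      lin_redTerm]
    congr 1
    refine Finset.sum_congr rfl fun i _ => ?_
    rw [← sum_homBasis_apply S, Finset.smul_sum]
    refine Finset.sum_congr rfl fun j _ => ?_
    rw [smul_smul]; rfl
  -- With the identity inserted, the contraction over `A` is the same trace as in `lin_loop`; the
  -- rest is the computation of `Q`.
  have h2 : ∀ A, F A (𝟙 _) = ∑ σ : Fin 2, ∑ τ : Fin 2, ∑ g : G, ∑ h : G,
      LinearMap.trace k A (A.ρ (h⁻¹ * (z ^ (τ : ℕ) * g * z ^ (σ : ℕ)))) •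
        tm (tm (cδ X g (par X.1.ρ σ x)) (par Y.1.ρ τ (cδ Y h y))) (B.ρ (z ^ (τ : ℕ) * g) b) := by
    intro A
    simp only [F, LinearMap.coe_mk, AddHom.coe_mk, lin_id, LinearMap.id_apply, contr_tm, tm_smul,
      ← Finset.sum_smul, trace_ρ_eq_sum]
  rw [h1]
  simp only [h2, Finset.smul_sum, smul_smul]
  rw [Finset.sum_comm]
  refine Finset.sum_congr rfl fun σ _ => ?_
  rw [Finset.sum_comm]
  refine Finset.sum_congr rfl fun τ _ => ?_
  rw [Finset.sum_comm]
  refine Finset.sum_congr rfl fun g _ => ?_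
  rw [Finset.sum_comm]
  simp only [← Finset.sum_smul, mul_assoc, ← Finset.mul_sum]
  simp only [sum_d_trace']
  simp [ite_smul]

end HalfBraiding

/-! ### The unit, the unit constraints and the duality maps as functions on `G`. -/

section UnitAndDual
variable {k : Type u} [Field k] [CharZero k] {G : Type u} [Group G] [Fintype G] [Supergroup G]

lemma sum_comm_three {α β κ M : Type*} [Fintype α] [Fintype β] [Fintype κ] [AddCommMonoid M]
    (F : α → β → κ → M) : ∑ x, ∑ y, ∑ w, F x y w = ∑ y, ∑ w, ∑ x, F x y w := by
  rw [Finset.sum_comm]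
  exact Finset.sum_congr rfl fun y _ => Finset.sum_comm
lemma sum_comm_four {α κ ι M : Type*} {β : α → Type*} [Fintype α] [∀ a, Fintype (β a)]
    [Fintype κ] [Fintype ι] [AddCommMonoid M] (F : (x : α) → β x → κ → ι → M) :
    ∑ x, ∑ y, ∑ w, ∑ t, F x y w t = ∑ t, ∑ w, ∑ x, ∑ y, F x y w t := by
  rw [← sum_comm_three (fun x t w => ∑ y, F x y w t)]
  refine Finset.sum_congr rfl fun x _ => ?_
  rw [sum_comm_three]
  exact Finset.sum_comm

/-- The grading `δ_g e⁰ + δ_{gz} e¹` of an object of the center. -/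
def ctw (X : Center (FDRep k G)) (g : G) : Module.End k X.1 := tw X.1.ρ (cδ X) g

/-- A vector of parity `τ` and degree `g` has degree `g z^τ` in the regraded object, so a weight
depending on `g z^τ` only sees the new degree. -/
lemma sum_ctw (X : Center (FDRep k G)) {M : Type*} [AddCommGroup M] [Module k M]
    (F : X.1 → M) (hF : ∀ a b, F (a + b) = F a + F b) (w : G → k) (x : X.1) :
    ∑ τ : Fin 2, ∑ g : G, w (g * z ^ (τ : ℕ)) • F (cδ X g (par X.1.ρ τ x)) =
      ∑ c, w c • F (ctw X c x) := by
  have h1 : ∀ c, F (ctw X c x) = ∑ τ : Fin 2, F (cδ X (c * z ^ (τ : ℕ)) (par X.1.ρ τ x)) := by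
    intro c
    simp [ctw, tw, hF]
  simp only [h1, Finset.smul_sum]
  rw [Finset.sum_comm (s := (Finset.univ : Finset G))]
  refine Finset.sum_congr rfl fun τ _ => ?_
  refine Fintype.sum_equiv (Equiv.mulRight (z ^ (τ : ℕ))) _ _ fun g => ?_
  simp only [Equiv.coe_mulRight, mul_z_mul_z]

/-- The canonical element of `X ⊗ X^*` is invariant under moving an operator to the other factor as
its transpose; needed for parity projections in `lin_coevMap`. -/
lemma sum_rbas_move {X : FDRep k G} {M : Type*} [AddCommGroup M] [Module k M]
    (F : X →ₗ[k] dualRep X →ₗ[k] M) (A : X →ₗ[k] X) (B : dualRep X →ₗ[k] dualRep X)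
    (h : ∀ f x, dapp (B f) x = dapp f (A x)) :
    ∑ s, F (rbas X s) (B (rcob X s)) = ∑ s, F (A (rbas X s)) (rcob X s) := by
  have h1 : ∀ t, B (rcob X t) = ∑ s, dapp (rcob X t) (A (rbas X s)) • rcob X s := by
    intro t
    rw [← sum_rcob (B (rcob X t))]
    simp only [h]
  have h2 : ∀ s, F (A (rbas X s)) = ∑ t, dapp (rcob X t) (A (rbas X s)) • F (rbas X t) := by
    intro s
    conv_lhs => rw [← sum_rbas (A (rbas X s))]
    simp only [map_sum, map_smul]
  simp only [h1, h2, map_sum, map_smul, LinearMap.sum_apply, LinearMap.smul_apply]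
  exact Finset.sum_comm

/-- The contragredient action involves `z⁻¹`, which is `z`. -/
lemma dapp_par {X : FDRep k G} (σ : Fin 2) (f : dualRep X) (x : X) :
    dapp (par (dualRep X).ρ σ f) x = dapp f (par X.ρ σ x) := by
  have h : ∀ (f f' : dualRep X) (c : k), dapp (c • (f + f')) x = c * (dapp f x + dapp f' x) :=
    fun _ _ _ => rfl
  have h' : ∀ (f : dualRep X) (c : k), dapp (c • f) x = c * dapp f x := fun _ _ => rfl
  simp only [par, LinearMap.smul_apply, LinearMap.add_apply, Module.End.one_apply, h, h', dapp_add,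
    dapp_smul, dapp_ρ, DoubleModule.z_inv]

/-- The action of `δ_g` on the dual of an object of the center. -/
def dcδ (X : Center (FDRep k G)) (g : G) : dualRep X.1 →ₗ[k] dualRep X.1 :=
  Module.Dual.transpose (R := k) (cδ X g)
lemma dapp_dcδ (X : Center (FDRep k G)) (g : G) (f : dualRep X.1) (x : X.1) :
    dapp (dcδ X g f) x = dapp f (cδ X g x) := rfl

/-- The two braidings put `z^τ` and `z^σ` on `a`, with `τ` the parity of `f` and `σ` that of the new
functional. Since `δ_g` commutes with `z`, the parities agree and the two powers cancel: the grading
of the dual is the transpose, without a twist. -/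
lemma lin_dualHalf (X : Center (FDRep k G)) (A : FDRep k G) (a : A) (f : dualRep X.1) :
    lin (dualHalf X A) (tm a f) =
      ∑ g, tm (dcδ X g f) (A.ρ g a) := by
  simp only [dualHalf, monoidalComp, MonoidalCoherence.refl_iso, MonoidalCoherence.whiskerLeft_iso,
    MonoidalCoherence.whiskerRight_iso, MonoidalCoherence.tensor_right_iso,
    MonoidalCoherence.tensor_right'_iso, MonoidalCoherence.left_iso, MonoidalCoherence.left'_iso,
    MonoidalCoherence.right_iso, MonoidalCoherence.right'_iso, MonoidalCoherence.assoc_iso,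
    MonoidalCoherence.assoc'_iso, Iso.trans_hom, Iso.symm_hom, Iso.refl_hom, whiskerLeftIso_hom,
    whiskerRightIso_hom, Category.comp_id, Category.id_comp, whiskerLeft_id, id_whiskerRight,
    lin_comp, lin_id, LinearMap.comp_apply, LinearMap.id_apply, lin_whiskerLeft, lin_whiskerRight,
    lin_tensorHom, lin_assoc_hom, lin_assoc_inv, lin_leftUnitor_hom, lin_leftUnitor_inv,
    lin_rightUnitor_hom, lin_rightUnitor_inv, lin_coevL, lin_coevR, lin_evalR, lin_evalL,
    tm_sum, sum_tm, map_sum, braidIso, lin_braid, gam_tm, smul_tm, ρ_ρ, map_smul, tm_smul]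
  have key : ∀ (τ σ : Fin 2) (g : G), ∑ s, dapp (par (dualRep X.1).ρ τ f) (cδ X g (rbas X.1 s)) •
      par (dualRep X.1).ρ σ (rcob X.1 s) =
      if σ = τ then par (dualRep X.1).ρ τ (dcδ X g f) else 0 := by
    intro τ σ g
    have h1 := sum_rcob (par (dualRep X.1).ρ τ (dcδ X g f))
    have h2 : ∀ s, dapp (par (dualRep X.1).ρ τ f) (cδ X g (rbas X.1 s)) =
        dapp (par (dualRep X.1).ρ τ (dcδ X g f)) (rbas X.1 s) := by
      intro s
      have := LinearMap.congr_fun ((center_grading X).par_comm g τ) (rbas X.1 s)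
      rw [dapp_par, dapp_par, dapp_dcδ]
      exact congrArg (dapp f) this
    simp only [h2, ← map_smul, ← map_sum]
    refine (congrArg _ h1).trans ?_
    have := LinearMap.congr_fun (par_mul (dualRep X.1).ρ σ τ)
      (dcδ X g f)
    refine (show _ = _ from this).trans ?_
    split_ifs with h
    · rw [h]
    · rfl
  calc _ = ∑ g : G, ∑ τ : Fin 2, ∑ σ : Fin 2, tm (∑ s, dapp (par (dualRep X.1).ρ τ f)
        (cδ X g (rbas X.1 s)) • par (dualRep X.1).ρ σ (rcob X.1 s))
          (A.ρ (z ^ (σ : ℕ) * (g * z ^ (τ : ℕ))) a) := by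
        simp only [sum_tm, smul_tm, Finset.smul_sum]
        conv_rhs => rw [Finset.sum_comm]
        refine Finset.sum_congr rfl fun τ _ => ?_
        rw [Finset.sum_comm]
        exact Finset.sum_congr rfl fun g _ => Finset.sum_comm
    _ = ∑ g : G, ∑ τ : Fin 2, tm (par (dualRep X.1).ρ τ
          (dcδ X g f)) (A.ρ g a) := by
        refine Finset.sum_congr rfl fun g _ => Finset.sum_congr rfl fun τ _ => ?_
        rw [Finset.sum_eq_single τ]
        · rw [key, if_pos rfl, z_pow_comm, mul_z_mul_z]
        · intro σ _ hσ
          rw [key, if_neg hσ, zero_tm]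
        · simp
    _ = _ := by
        refine Finset.sum_congr rfl fun g _ => ?_
        rw [← sum_tm, Fin.sum_univ_two, par_apply_add]

variable [IsAlgClosed k] (S : IrrData k G)

lemma lin_unitπ_ι (i j : S.ι) (t : (S.obj i ⊗ dualRep (S.obj i) : FDRep k G)) (h : i ≠ j) :
    lin (S.unitπ j) (lin (S.unitι i) t) = 0 :=
  LinearMap.congr_fun (congrArg lin (Limits.biproduct.ι_π_ne (fun i => (S.obj i ⊗ dualRep (S.obj i) : FDRep k G)) h)) t
lemma lin_unitπ_ι_self (i : S.ι) (t : (S.obj i ⊗ dualRep (S.obj i) : FDRep k G)) :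
    lin (S.unitπ i) (lin (S.unitι i) t) = t :=
  LinearMap.congr_fun (congrArg lin (Limits.biproduct.ι_π_self (fun i => (S.obj i ⊗ dualRep (S.obj i) : FDRep k G)) i)) t
lemma unitRep_eq_sum (u : S.unitRep) : u = ∑ i, lin (S.unitι i) (lin (S.unitπ i) u) := by
  have h : ∑ i, S.unitπ i ≫ S.unitι i = 𝟙 _ := Limits.biproduct.total
  have := LinearMap.congr_fun (congrArg lin h) u
  rw [lin_sum, LinearMap.sum_apply] at this
  exact this.symm
lemma unitRep_ext {M : Type*} [AddCommGroup M] [Module k M] {F F' : S.unitRep →ₗ[k] M}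
    (h : ∀ i a f, F (lin (S.unitι i) (tm a f)) = F' (lin (S.unitι i) (tm a f))) : F = F' := by
  ext u
  rw [unitRep_eq_sum S u, map_sum, map_sum]
  refine Finset.sum_congr rfl fun i _ => ?_
  generalize lin (S.unitπ i) u = t
  induction t using tensor_induction with
  | h a f => exact h i a f
  | ha a b ha hb => simp only [map_add, ha, hb]

/-- The matrix coefficient `a ⊗ f ↦ f(c a)`. -/
def mcoef (A : FDRep k G) (c : G) : (A ⊗ dualRep A : FDRep k G) →ₗ[k] k :=
  contractRight k A ∘ₗ (A.ρ c).rTensor _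
lemma mcoef_tm (A : FDRep k G) (c : G) (a : A) (f : dualRep A) :
    mcoef A c (tm a f) = dapp f (A.ρ c a) := rfl

/-- The identification of `⨁ X_i ⊗ X_i^*` with the functions on `G`, by matrix coefficients. -/
def theta : S.unitRep →ₗ[k] (G → k) :=
  -- The weights are those of the unit and duality maps, which are thereby absorbed into `theta`.
  LinearMap.pi fun c => ∑ i, (S.sqrtd i / S.sqrtD) • (mcoef (S.obj i) c ∘ₗ lin (S.unitπ i))

lemma theta_ι (i : S.ι) (t : (S.obj i ⊗ dualRep (S.obj i) : FDRep k G)) (c : G) :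
    theta S (lin (S.unitι i) t) c = S.sqrtd i / S.sqrtD * mcoef (S.obj i) c t := by
  simp only [theta, LinearMap.pi_apply, LinearMap.sum_apply, LinearMap.smul_apply,
    LinearMap.comp_apply, smul_eq_mul]
  rw [Finset.sum_eq_single i]
  · rw [lin_unitπ_ι_self]
  · intro j _ hj
    rw [lin_unitπ_ι S i j t hj.symm, map_zero, mul_zero]
  · simp

/-- The weight occurs twice and its square is `d_i / 𝒟`, so this is the orthogonality
`sum_d_trace'`. -/
lemma sum_theta (c h : G) : ∑ i, (S.sqrtd i / S.sqrtD) * (S.sqrtd i / S.sqrtD *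
    ∑ s, dapp ((dualRep (S.obj i)).ρ c (rcob (S.obj i) s)) ((S.obj i).ρ h (rbas (S.obj i) s))) =
    if c = h then 1 else 0 := by
  rw [← sum_d_trace' S c h, Finset.mul_sum]
  refine Finset.sum_congr rfl fun i _ => ?_
  rw [trace_ρ_eq_sum, ← sqrtD_mul_self, ← sqrtd_mul_self]
  field_simp [sqrtD_ne_zero S]

lemma theta_surjective : Function.Surjective (theta S) := by
  have h : ∀ c, ∃ u, theta S u = Pi.single c 1 := by
    intro c
    -- Fourier inversion: the canonical elements, translated by `c` on the dual side, have as value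
    -- at `h` the weighted sum of the characters at `c⁻¹ h`.
    refine ⟨∑ i, (S.sqrtd i / S.sqrtD) • lin (S.unitι i) (∑ s, tm (rbas (S.obj i) s)
      ((dualRep (S.obj i)).ρ c (rcob (S.obj i) s))), funext fun h => ?_⟩
    rw [map_sum, Finset.sum_apply, Pi.single_apply]
    simp only [map_smul, Pi.smul_apply, smul_eq_mul, theta_ι]
    simp only [map_sum, mcoef_tm, sum_theta, eq_comm]
  choose u hu using h
  intro w
  refine ⟨∑ c, w c • u c, ?_⟩
  rw [map_sum]
  simp only [map_smul, hu]
  funext x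
  simp [Finset.sum_apply, Pi.single_apply]

/-- The dimensions `d_i²` add up to the order of `G`; `D_eq` says so in `k`, and characteristic zero
brings it back to the integers. Surjectivity of `theta` supplies the other inequality. -/
lemma finrank_unitRep_le : Module.finrank k S.unitRep ≤ Module.finrank k (G → k) := by
  let F : S.unitRep →ₗ[k] ((i : S.ι) → (S.obj i ⊗ dualRep (S.obj i) : FDRep k G)) :=
    LinearMap.pi fun i => lin (S.unitπ i)
  have hF : Function.Injective F := by
    intro u v h
    rw [unitRep_eq_sum S u, unitRep_eq_sum S v]
    exact Finset.sum_congr rfl fun i _ => congrArg _ (congrFun h i)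
  refine (LinearMap.finrank_le_finrank_of_injective hF).trans (le_of_eq ?_)
  have h1 : ∀ i, Module.finrank k (S.obj i ⊗ dualRep (S.obj i) : FDRep k G) =
      Module.finrank k (S.obj i) ^ 2 := by
    intro i
    refine (Module.finrank_tensorProduct (R := k) (S := k) (M := S.obj i)
      (M' := Module.Dual k (S.obj i))).trans ?_
    rw [Subspace.dual_finrank_eq, sq]
  rw [Module.finrank_pi_fintype, Module.finrank_fintype_fun_eq_card]
  simp only [h1]
  have := D_eq S
  rw [IrrData.D] at this
  simp only [IrrData.d] at this
  exact_mod_cast this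

lemma theta_bijective : Function.Bijective (theta S) := by
  have hs := theta_surjective S
  have he : Module.finrank k S.unitRep = Module.finrank k (G → k) :=
    le_antisymm (finrank_unitRep_le S) (LinearMap.finrank_le_finrank_of_surjective hs)
  exact ⟨(LinearMap.injective_iff_surjective_of_finrank_eq_finrank he).mpr hs, hs⟩

lemma theta_ρ (g : G) (u : S.unitRep) :
    theta S (S.unitRep.ρ g u) = DoubleModule.unitρ g (theta S u) := by
  have : theta S ∘ₗ S.unitRep.ρ g = DoubleModule.unitρ g ∘ₗ theta S := by
    refine unitRep_ext S fun i a f => funext fun c => ?_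
    rw [LinearMap.comp_apply, LinearMap.comp_apply, ← lin_ρ, DoubleModule.unitρ_apply, theta_ι,
      theta_ι, ρ_tm, mcoef_tm, mcoef_tm, dapp_ρ, ρ_ρ, ρ_ρ, mul_assoc]
  exact LinearMap.congr_fun this u

/-- The left unit constraint in terms of functions on `G`. -/
lemma lin_leftUnit (X : Center (FDRep k G)) (u : S.unitRep) (x : X.1) :
    lin (S.leftUnit X) (tm u x) = ∑ c, theta S u c • ctw X c x := by
  let F : S.unitRep →ₗ[k] X.1 := lin (S.leftUnit X) ∘ₗ (TensorProduct.mk k S.unitRep X.1).flip x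
  let F' : S.unitRep →ₗ[k] X.1 := ∑ c, (LinearMap.proj (R := k) (φ := fun _ : G => k) c ∘ₗ
    theta S).smulRight (ctw X c x)
  have : F = F' := by
    refine unitRep_ext S fun i a f => ?_
    change lin (S.leftUnit X) (tm _ x) = _
    simp only [F', LinearMap.sum_apply, LinearMap.smulRight_apply, LinearMap.comp_apply,
      LinearMap.proj_apply, theta_ι]
    -- The braiding contributes `z^τ` and the half-braiding `g`, so the matrix coefficient is taken
    -- at `g z^τ`, the regraded degree of the component.
    rw [← sum_ctw X (fun x => x) (fun _ _ => rfl)]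
    simp only [IrrData.leftUnit, lin_sum, lin_smul, LinearMap.sum_apply, LinearMap.smul_apply]
    rw [Finset.sum_eq_single i]
    · simp only [monoidalComp, MonoidalCoherence.refl_iso, MonoidalCoherence.whiskerLeft_iso,
    MonoidalCoherence.whiskerRight_iso, MonoidalCoherence.tensor_right_iso,
    MonoidalCoherence.tensor_right'_iso, MonoidalCoherence.left_iso, MonoidalCoherence.left'_iso,
    MonoidalCoherence.right_iso, MonoidalCoherence.right'_iso, MonoidalCoherence.assoc_iso,
    MonoidalCoherence.assoc'_iso, Iso.trans_hom, Iso.symm_hom, Iso.refl_hom, whiskerLeftIso_hom,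
    whiskerRightIso_hom, Category.comp_id, Category.id_comp, whiskerLeft_id, id_whiskerRight,
    lin_comp, lin_id, LinearMap.comp_apply, LinearMap.id_apply, lin_whiskerLeft, lin_whiskerRight,
    lin_tensorHom, lin_assoc_hom, lin_assoc_inv, lin_leftUnitor_hom, lin_leftUnitor_inv,
    lin_rightUnitor_hom, lin_rightUnitor_inv, lin_coevL, lin_coevR, lin_evalR, lin_evalL,
    tm_sum, sum_tm, map_sum, braidIso, lin_braid, gam_tm, lin_unitπ_ι_self, dapp_ρ, pow_z_inv, ρ_ρ,
        mcoef_tm, Finset.smul_sum, smul_smul, z_pow_comm]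
    · intro j _ hj
      simp only [monoidalComp, MonoidalCoherence.refl_iso, MonoidalCoherence.whiskerLeft_iso,
    MonoidalCoherence.whiskerRight_iso, MonoidalCoherence.tensor_right_iso,
    MonoidalCoherence.tensor_right'_iso, MonoidalCoherence.left_iso, MonoidalCoherence.left'_iso,
    MonoidalCoherence.right_iso, MonoidalCoherence.right'_iso, MonoidalCoherence.assoc_iso,
    MonoidalCoherence.assoc'_iso, Iso.trans_hom, Iso.symm_hom, Iso.refl_hom, whiskerLeftIso_hom,
    whiskerRightIso_hom, Category.comp_id, Category.id_comp, whiskerLeft_id, id_whiskerRight,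
    lin_comp, lin_id, LinearMap.comp_apply, LinearMap.id_apply, lin_whiskerLeft, lin_whiskerRight,
    lin_tensorHom, lin_assoc_hom, lin_assoc_inv, lin_leftUnitor_hom, lin_leftUnitor_inv,
    lin_rightUnitor_hom, lin_rightUnitor_inv, lin_coevL, lin_coevR, lin_evalR, lin_evalL,
    tm_sum, sum_tm, map_sum, lin_unitπ_ι S i j _ hj.symm, zero_tm, map_zero, smul_zero]
    · simp
  have h := LinearMap.congr_fun this u
  simp only [F', LinearMap.sum_apply] at h
  exact h

/-- The right unit constraint in terms of functions on `G`. -/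
lemma lin_rightUnit (X : Center (FDRep k G)) (u : S.unitRep) (x : X.1) :
    lin (S.rightUnit X) (tm x u) = ∑ c, theta S u c • ctw X c x := by
  let F : S.unitRep →ₗ[k] X.1 := lin (S.rightUnit X) ∘ₗ TensorProduct.mk k X.1 S.unitRep x
  let F' : S.unitRep →ₗ[k] X.1 := ∑ c, (LinearMap.proj (R := k) (φ := fun _ : G => k) c ∘ₗ
    theta S).smulRight (ctw X c x)
  have : F = F' := by
    refine unitRep_ext S fun i a f => ?_
    change lin (S.rightUnit X) (tm x _) = _
    simp only [F', LinearMap.sum_apply, LinearMap.smulRight_apply, LinearMap.comp_apply,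
      LinearMap.proj_apply, theta_ι]
    rw [← sum_ctw X (fun x => x) (fun _ _ => rfl)]
    simp only [IrrData.rightUnit, lin_sum, lin_smul, LinearMap.sum_apply, LinearMap.smul_apply]
    rw [Finset.sum_eq_single i]
    · simp only [monoidalComp, MonoidalCoherence.refl_iso, MonoidalCoherence.whiskerLeft_iso,
    MonoidalCoherence.whiskerRight_iso, MonoidalCoherence.tensor_right_iso,
    MonoidalCoherence.tensor_right'_iso, MonoidalCoherence.left_iso, MonoidalCoherence.left'_iso,
    MonoidalCoherence.right_iso, MonoidalCoherence.right'_iso, MonoidalCoherence.assoc_iso,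
    MonoidalCoherence.assoc'_iso, Iso.trans_hom, Iso.symm_hom, Iso.refl_hom, whiskerLeftIso_hom,
    whiskerRightIso_hom, Category.comp_id, Category.id_comp, whiskerLeft_id, id_whiskerRight,
    lin_comp, lin_id, LinearMap.comp_apply, LinearMap.id_apply, lin_whiskerLeft, lin_whiskerRight,
    lin_tensorHom, lin_assoc_hom, lin_assoc_inv, lin_leftUnitor_hom, lin_leftUnitor_inv,
    lin_rightUnitor_hom, lin_rightUnitor_inv, lin_coevL, lin_coevR, lin_evalR, lin_evalL,
    tm_sum, sum_tm, map_sum, braidIso, lin_braid', gam_tm, lin_unitπ_ι_self, ρ_ρ,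
        mcoef_tm, Finset.smul_sum, smul_smul]
    · intro j _ hj
      simp only [monoidalComp, MonoidalCoherence.refl_iso, MonoidalCoherence.whiskerLeft_iso,
    MonoidalCoherence.whiskerRight_iso, MonoidalCoherence.tensor_right_iso,
    MonoidalCoherence.tensor_right'_iso, MonoidalCoherence.left_iso, MonoidalCoherence.left'_iso,
    MonoidalCoherence.right_iso, MonoidalCoherence.right'_iso, MonoidalCoherence.assoc_iso,
    MonoidalCoherence.assoc'_iso, Iso.trans_hom, Iso.symm_hom, Iso.refl_hom, whiskerLeftIso_hom,
    whiskerRightIso_hom, Category.comp_id, Category.id_comp, whiskerLeft_id, id_whiskerRight,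
    lin_comp, lin_id, LinearMap.comp_apply, LinearMap.id_apply, lin_whiskerLeft, lin_whiskerRight,
    lin_tensorHom, lin_assoc_hom, lin_assoc_inv, lin_leftUnitor_hom, lin_leftUnitor_inv,
    lin_rightUnitor_hom, lin_rightUnitor_inv, lin_coevL, lin_coevR, lin_evalR, lin_evalL,
    tm_sum, sum_tm, map_sum, lin_unitπ_ι S i j _ hj.symm, tm_zero, zero_tm, map_zero, smul_zero]
    · simp
  have h := LinearMap.congr_fun this u
  simp only [F', LinearMap.sum_apply] at h
  exact h

/-- The evaluation in terms of functions on `G`. -/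
lemma theta_evalMap (X : Center (FDRep k G)) (f : dualRep X.1) (x : X.1) (c : G) :
    theta S (lin (S.evalMap X) (tm f x)) c = dapp f (ctw X c x) := by
  -- The indicator of `c` is the weight that orthogonality will produce; this is the shape required
  -- by `sum_ctw`.
  have h0 : dapp f (ctw X c x) = ∑ h, (if h = c then (1 : k) else 0) • dapp f (ctw X h x) := by
    simp
  rw [h0, ← sum_ctw X (dapp f) (dapp_add f)]
  simp only [IrrData.evalMap, lin_sum, lin_smul, LinearMap.sum_apply, LinearMap.smul_apply,
    monoidalComp, MonoidalCoherence.refl_iso, MonoidalCoherence.whiskerLeft_iso,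
    MonoidalCoherence.whiskerRight_iso, MonoidalCoherence.tensor_right_iso,
    MonoidalCoherence.tensor_right'_iso, MonoidalCoherence.left_iso, MonoidalCoherence.left'_iso,
    MonoidalCoherence.right_iso, MonoidalCoherence.right'_iso, MonoidalCoherence.assoc_iso,
    MonoidalCoherence.assoc'_iso, Iso.trans_hom, Iso.symm_hom, Iso.refl_hom, whiskerLeftIso_hom,
    whiskerRightIso_hom, Category.comp_id, Category.id_comp, whiskerLeft_id, id_whiskerRight,
    lin_comp, lin_id, LinearMap.comp_apply, LinearMap.id_apply, lin_whiskerLeft, lin_whiskerRight,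
    lin_tensorHom, lin_assoc_hom, lin_assoc_inv, lin_leftUnitor_hom, lin_leftUnitor_inv,
    lin_rightUnitor_hom, lin_rightUnitor_inv, lin_coevL, lin_coevR, lin_evalR, lin_evalL,
    tm_sum, sum_tm, map_sum, braidIso, lin_braid, gam_tm, Finset.sum_apply, map_smul, Pi.smul_apply, smul_tm,
    theta_ι, mcoef_tm, ρ_ρ, smul_eq_mul]
  -- Summing over the simple objects and their bases first lets `sum_theta` force `g = c z^τ`.
  calc _ = ∑ τ : Fin 2, ∑ g : G, dapp f (par X.1.ρ τ (cδ X g x)) *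
        ∑ i, (S.sqrtd i / S.sqrtD) * (S.sqrtd i / S.sqrtD * ∑ s,
          dapp ((dualRep (S.obj i)).ρ g (rcob (S.obj i) s))
            ((S.obj i).ρ (c * z ^ (τ : ℕ)) (rbas (S.obj i) s))) := by
        simp only [Finset.mul_sum]
        rw [sum_comm_four]
        refine Finset.sum_congr rfl fun τ _ => Finset.sum_congr rfl fun g _ =>
          Finset.sum_congr rfl fun i _ => Finset.sum_congr rfl fun s _ => ?_
        ring
    _ = _ := by
        refine Finset.sum_congr rfl fun τ _ => Finset.sum_congr rfl fun g _ => ?_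
        have h1 : g = c * z ^ (τ : ℕ) ↔ g * z ^ (τ : ℕ) = c := by
          constructor
          · rintro rfl; exact mul_z_mul_z τ c
          · rintro rfl; exact (mul_z_mul_z τ g).symm
        have h2 : par X.1.ρ τ (cδ X g x) = cδ X g (par X.1.ρ τ x) :=
          LinearMap.congr_fun ((center_grading X).par_comm g τ) x
        rw [sum_theta, h2, mul_comm]
        simp only [h1]

/-- The coevaluation in terms of functions on `G`. -/
lemma lin_coevMap (X : Center (FDRep k G)) (u : S.unitRep) :
    lin (S.coevMap X) u = ∑ c, theta S u c • ∑ s, tm (ctw X c (rbas X.1 s)) (rcob X.1 s) := by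
  let F' : S.unitRep →ₗ[k] (X.1 ⊗ dualRep X.1 : FDRep k G) :=
    ∑ c, (LinearMap.proj (R := k) (φ := fun _ : G => k) c ∘ₗ
    theta S).smulRight (∑ s, tm (ctw X c (rbas X.1 s)) (rcob X.1 s))
  have : lin (S.coevMap X) = F' := by
    refine unitRep_ext S fun i a f => ?_
    simp only [F', LinearMap.sum_apply, LinearMap.smulRight_apply, LinearMap.comp_apply,
      LinearMap.proj_apply, theta_ι, Finset.smul_sum]
    simp only [IrrData.coevMap, lin_sum, lin_smul, LinearMap.sum_apply, LinearMap.smul_apply]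
    rw [Finset.sum_eq_single i, Finset.sum_comm (s := (Finset.univ : Finset G))]
    · simp only [← sum_ctw X (fun x => tm x (rcob X.1 _)) (fun _ _ => add_tm _ _ _)]
      simp only [monoidalComp, MonoidalCoherence.refl_iso, MonoidalCoherence.whiskerLeft_iso,
    MonoidalCoherence.whiskerRight_iso, MonoidalCoherence.tensor_right_iso,
    MonoidalCoherence.tensor_right'_iso, MonoidalCoherence.left_iso, MonoidalCoherence.left'_iso,
    MonoidalCoherence.right_iso, MonoidalCoherence.right'_iso, MonoidalCoherence.assoc_iso,
    MonoidalCoherence.assoc'_iso, Iso.trans_hom, Iso.symm_hom, Iso.refl_hom, whiskerLeftIso_hom,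
    whiskerRightIso_hom, Category.comp_id, Category.id_comp, whiskerLeft_id, id_whiskerRight,
    lin_comp, lin_id, LinearMap.comp_apply, LinearMap.id_apply, lin_whiskerLeft, lin_whiskerRight,
    lin_tensorHom, lin_assoc_hom, lin_assoc_inv, lin_leftUnitor_hom, lin_leftUnitor_inv,
    lin_rightUnitor_hom, lin_rightUnitor_inv, lin_coevL, lin_coevR, lin_evalR, lin_evalL,
    tm_sum, sum_tm, map_sum, braidIso, lin_braid', gam_tm, lin_unitπ_ι_self, ρ_ρ,
        mcoef_tm, Finset.smul_sum, smul_smul, dapp_ρ, pow_z_inv, tm_smul, smul_tm]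
      calc _ = ∑ τ : Fin 2, ∑ g : G, (S.sqrtd i / S.sqrtD * dapp f ((S.obj i).ρ
              (z ^ (τ : ℕ) * g) a)) • ∑ s, (tm (cδ X g (rbas X.1 s))
                (par (dualRep X.1).ρ τ (rcob X.1 s)) : (X.1 ⊗ dualRep X.1 : FDRep k G)) := by
            simp only [Finset.smul_sum]
            conv_rhs => rw [Finset.sum_comm]
            rw [Finset.sum_comm]
            refine Finset.sum_congr rfl fun g _ => Finset.sum_comm
        _ = ∑ τ : Fin 2, ∑ g : G, (S.sqrtd i / S.sqrtD * dapp f ((S.obj i).ρ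
              (g * z ^ (τ : ℕ)) a)) • ∑ s, (tm (cδ X g (par X.1.ρ τ (rbas X.1 s)))
                (rcob X.1 s) : (X.1 ⊗ dualRep X.1 : FDRep k G)) := by
            refine Finset.sum_congr rfl fun τ _ => Finset.sum_congr rfl fun g _ => ?_
            rw [z_pow_comm]
            congr 1
            -- The braiding left the parity projection on `X^*`; on `X` it combines with `δ_g` into
            -- the regraded projection.
            exact sum_rbas_move ((TensorProduct.mk k X.1 (dualRep X.1)) ∘ₗ cδ X g) (par X.1.ρ τ)
              (par (dualRep X.1).ρ τ) (dapp_par τ)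
        _ = _ := by
            simp only [Finset.smul_sum]
            exact (sum_comm_three _).symm
    · intro j _ hj
      simp only [monoidalComp, MonoidalCoherence.refl_iso, MonoidalCoherence.whiskerLeft_iso,
    MonoidalCoherence.whiskerRight_iso, MonoidalCoherence.tensor_right_iso,
    MonoidalCoherence.tensor_right'_iso, MonoidalCoherence.left_iso, MonoidalCoherence.left'_iso,
    MonoidalCoherence.right_iso, MonoidalCoherence.right'_iso, MonoidalCoherence.assoc_iso,
    MonoidalCoherence.assoc'_iso, Iso.trans_hom, Iso.symm_hom, Iso.refl_hom, whiskerLeftIso_hom,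
    whiskerRightIso_hom, Category.comp_id, Category.id_comp, whiskerLeft_id, id_whiskerRight,
    lin_comp, lin_id, LinearMap.comp_apply, LinearMap.id_apply, lin_whiskerLeft, lin_whiskerRight,
    lin_tensorHom, lin_assoc_hom, lin_assoc_inv, lin_leftUnitor_hom, lin_leftUnitor_inv,
    lin_rightUnitor_hom, lin_rightUnitor_inv, lin_coevL, lin_coevR, lin_evalR, lin_evalL,
    tm_sum, sum_tm, map_sum, lin_unitπ_ι S i j _ hj.symm, tm_zero, zero_tm, map_zero, smul_zero]
    · simp
  have h := LinearMap.congr_fun this u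
  simp only [F', LinearMap.sum_apply] at h
  exact h

lemma theta_ι_tm (i : S.ι) (a : S.obj i) (f : dualRep (S.obj i)) :
    theta S (lin (S.unitι i) (tm a f)) = ∑ c, (S.sqrtd i / S.sqrtD * dapp f ((S.obj i).ρ c a)) •
      (Pi.single c 1 : G → k) := by
  funext h
  rw [theta_ι, mcoef_tm]
  simp [Finset.sum_apply, Pi.single_apply]

/-- The component of `u` may be taken to be a pure tensor, as `unitRep_ext` asks for no more. -/
lemma lin_unitTerm {B A A' : FDRep k G} {U U' : FDRep k G} (p : U ⟶ A ⊗ dualRep A)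
    (φ : B ⊗ A ⟶ A') (ψ : A' ⟶ B ⊗ A) (q : A' ⊗ dualRep A' ⟶ U') (b : B) (u : U) (a : A)
    (f : dualRep A) (h : lin p u = tm a f) :
    lin (B ◁ p ⊗≫ (φ ⊗ₘ mate ψ) ⊗≫ q ▷ B) (tm b u) =
      ∑ t, tm (lin q (tm (lin φ (tm b a)) (rcob A' t))) (contr f (lin ψ (rbas A' t))) := by
  simp only [monoidalComp, MonoidalCoherence.refl_iso, MonoidalCoherence.whiskerLeft_iso,
    MonoidalCoherence.whiskerRight_iso, MonoidalCoherence.tensor_right_iso,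
    MonoidalCoherence.tensor_right'_iso, MonoidalCoherence.left_iso, MonoidalCoherence.left'_iso,
    MonoidalCoherence.right_iso, MonoidalCoherence.right'_iso, MonoidalCoherence.assoc_iso,
    MonoidalCoherence.assoc'_iso, Iso.trans_hom, Iso.symm_hom, Iso.refl_hom, whiskerLeftIso_hom,
    whiskerRightIso_hom, Category.comp_id, Category.id_comp, whiskerLeft_id, id_whiskerRight,
    lin_comp, lin_id, LinearMap.comp_apply, LinearMap.id_apply, lin_whiskerLeft, lin_whiskerRight,
    lin_tensorHom, lin_assoc_hom, lin_assoc_inv, lin_leftUnitor_hom, lin_leftUnitor_inv,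
    lin_rightUnitor_hom, lin_rightUnitor_inv, lin_coevL, lin_coevR, lin_evalR, lin_evalL,
    tm_sum, sum_tm, map_sum, h, lin_mate]

/-- The half-braiding of the unit in terms of functions on `G`. -/
lemma theta_unitHalf (B : FDRep k G) (b : B) (u : S.unitRep) :
    (theta S).rTensor B (lin (S.unitHalf B) (tm b u)) =
      ∑ c, (DoubleModule.unitδ c (theta S u)) ⊗ₜ[k] B.ρ c b := by
  let F : S.unitRep →ₗ[k] (G → k) ⊗[k] B :=
    (theta S).rTensor B ∘ₗ lin (S.unitHalf B) ∘ₗ TensorProduct.mk k B S.unitRep b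
  let F' : S.unitRep →ₗ[k] (G → k) ⊗[k] B :=
    ∑ c, (TensorProduct.mk k (G → k) B).flip (B.ρ c b) ∘ₗ DoubleModule.unitδ c ∘ₗ theta S
  have : F = F' := by
    refine unitRep_ext S fun i a f => ?_
    have e1 : F' (lin (S.unitι i) (tm a f)) = ∑ c, (Pi.single c 1 : G → k) ⊗ₜ[k]
        ((S.sqrtd i / S.sqrtD) • contr f (tm (B.ρ c b) ((S.obj i).ρ c a))) := by
      simp only [F', LinearMap.sum_apply]
      refine Finset.sum_congr rfl fun c _ => ?_
      change (DoubleModule.unitδ c (theta S (lin (S.unitι i) (tm a f)))) ⊗ₜ[k] B.ρ c b = _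
      have : DoubleModule.unitδ c (theta S (lin (S.unitι i) (tm a f))) =
          (S.sqrtd i / S.sqrtD * dapp f ((S.obj i).ρ c a)) • (Pi.single c 1 : G → k) := by
        funext x
        rw [DoubleModule.unitδ_apply, theta_ι, mcoef_tm]
        simp [Pi.single_apply]
      rw [this, contr_tm, smul_smul, TensorProduct.smul_tmul]
    -- The matrix coefficients of `φ(b ⊗ a)` against a dual basis of `X_j` reassemble `c φ(b ⊗ a) =
    -- φ(c b ⊗ c a)`, so that only `φ ≫ ψ` remains.
    have hterm : ∀ j (φ : B ⊗ S.obj i ⟶ S.obj j) (ψ : S.obj j ⟶ B ⊗ S.obj i),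
        (theta S).rTensor B (lin (B ◁ S.unitπ i ⊗≫ (φ ⊗ₘ mate ψ) ⊗≫ S.unitι j ▷ B)
          (tm b (lin (S.unitι i) (tm a f)))) = ∑ c, (Pi.single c 1 : G → k) ⊗ₜ[k]
          ((S.sqrtd j / S.sqrtD) • contr f (lin (φ ≫ ψ) (tm (B.ρ c b) ((S.obj i).ρ c a)))) := by
      intro j φ ψ
      rw [lin_unitTerm _ _ _ _ _ _ _ _ (lin_unitπ_ι_self S i _), map_sum]
      have : ∀ (u : S.unitRep) (b : B), (theta S).rTensor B (tm u b) = theta S u ⊗ₜ[k] b :=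
        fun _ _ => rfl
      simp only [this, theta_ι_tm, TensorProduct.sum_tmul, TensorProduct.smul_tmul, mul_smul]
      rw [Finset.sum_comm]
      refine Finset.sum_congr rfl fun c _ => ?_
      rw [← TensorProduct.tmul_sum]
      simp only [fun (r : k) (v : B) => smul_comm r (S.sqrtd j / S.sqrtD) v]
      rw [← Finset.smul_sum]
      congr 2
      refine (sum_dapp_rcob ((S.obj j).ρ c (lin φ (tm b a))) (contr f ∘ₗ lin ψ)).trans ?_
      rw [← lin_ρ]; rfl
    have e2 : F (lin (S.unitι i) (tm a f)) = ∑ j, (S.sqrtd i * S.sqrtd j) • ∑ α,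
        ∑ c, (Pi.single c 1 : G → k) ⊗ₜ[k] ((S.sqrtd j / S.sqrtD) • contr f
          (lin (homBasis (B ⊗ S.obj i) (S.obj j) α ≫ dualHom (B ⊗ S.obj i) (S.obj j) α)
            (tm (B.ρ c b) ((S.obj i).ρ c a)))) := by
      change (theta S).rTensor B (lin (S.unitHalf B) (tm b (lin (S.unitι i) (tm a f)))) = _
      simp only [IrrData.unitHalf, lin_sum, lin_smul, LinearMap.sum_apply, LinearMap.smul_apply]
      rw [Finset.sum_eq_single i]
      · simp only [map_sum, map_smul, hterm]
      · intro i' _ hi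
        refine Finset.sum_eq_zero fun j _ => ?_
        rw [Finset.sum_eq_zero, smul_zero]
        intro α _
        simp only [monoidalComp, MonoidalCoherence.refl_iso, MonoidalCoherence.whiskerLeft_iso,
    MonoidalCoherence.whiskerRight_iso, MonoidalCoherence.tensor_right_iso,
    MonoidalCoherence.tensor_right'_iso, MonoidalCoherence.left_iso, MonoidalCoherence.left'_iso,
    MonoidalCoherence.right_iso, MonoidalCoherence.right'_iso, MonoidalCoherence.assoc_iso,
    MonoidalCoherence.assoc'_iso, Iso.trans_hom, Iso.symm_hom, Iso.refl_hom, whiskerLeftIso_hom,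
    whiskerRightIso_hom, Category.comp_id, Category.id_comp, whiskerLeft_id, id_whiskerRight,
    lin_comp, lin_id, LinearMap.comp_apply, LinearMap.id_apply, lin_whiskerLeft, lin_whiskerRight,
    lin_tensorHom, lin_assoc_hom, lin_assoc_inv, lin_leftUnitor_hom, lin_leftUnitor_inv,
    lin_rightUnitor_hom, lin_rightUnitor_inv, lin_coevL, lin_coevR, lin_evalR, lin_evalL,
    tm_sum, sum_tm, map_sum, lin_unitπ_ι S i i' _ hi.symm, tm_zero, map_zero]
      · simp
    let V : FDRep k G := B ⊗ S.obj i
    -- Again linear in the inserted endomorphism, so `sum_homBasis_apply` evaluates the sum over `j`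
    -- and `α` at the identity.
    let E : (V ⟶ V) →ₗ[k] (G → k) ⊗[k] B :=
      { toFun := fun h => ∑ c, (Pi.single c 1 : G → k) ⊗ₜ[k] ((S.sqrtd i / S.sqrtD) • contr f
          (lin h (tm (B.ρ c b) ((S.obj i).ρ c a))))
        map_add' := fun h h' => by
          simp only [lin_add, LinearMap.add_apply, map_add, smul_add, TensorProduct.tmul_add,
            Finset.sum_add_distrib]
        map_smul' := fun r h => by
          simp only [lin_smul, LinearMap.smul_apply, map_smul, TensorProduct.tmul_smul,
            Finset.smul_sum, RingHom.id_apply, smul_comm r] }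
    rw [e1, e2]
    refine Eq.trans ?_ (sum_homBasis_apply S V E)
    refine Finset.sum_congr rfl fun j _ => ?_
    rw [Finset.smul_sum, Finset.smul_sum]
    refine Finset.sum_congr rfl fun α _ => ?_
    simp only [E, LinearMap.coe_mk, AddHom.coe_mk, Finset.smul_sum, TensorProduct.tmul_smul,
      smul_smul]
    refine Finset.sum_congr rfl fun c _ => ?_
    congr 1
    -- The factor `√d_i √d_j` of `Γ`, times the weight `√d_j / √𝒟` of the summand `j`, is `d_j`
    -- times the weight of the summand `i`.
    rw [← sqrtd_mul_self]
    ring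
  have h := LinearMap.congr_fun this u
  simp only [F', LinearMap.sum_apply] at h
  exact h

end UnitAndDual

/-! ### `T` is an equivalence, and the twisted product is pulled back along it. -/

section Equivalence
variable {k : Type u} [Field k] [CharZero k] {G : Type u} [Group G] [Fintype G] [Supergroup G]

namespace DoubleModule
variable (V : DoubleModule k G)

lemma δ_δ (g h : G) (x : V) : V.δ g (V.δ h x) = if g = h then V.δ g x else 0 := by
  have := LinearMap.congr_fun (V.isGrading.orth g h) x
  split_ifs at this ⊢ <;> exact this
lemma ρ_δ (g h : G) (x : V) : V.ρ g (V.δ h x) = V.δ (g * h * g⁻¹) (V.ρ g x) :=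
  LinearMap.congr_fun (V.isGrading.conj g h) x
lemma sum_δ_apply (x : V) : ∑ g, V.δ g x = x := by
  have := LinearMap.congr_fun V.sum_δ x
  rwa [LinearMap.sum_apply] at this

/-- The representation underlying a module over the Drinfeld double. -/
def rep : FDRep k G := FDRep.of V.ρ

/-- The grading of a module, as operators on its underlying representation. -/
def repδ (g : G) : V.rep →ₗ[k] V.rep := V.δ g

lemma repδ_repδ (g h : G) (x : V.rep) :
    V.repδ g (V.repδ h x) = if g = h then V.repδ g x else 0 := V.δ_δ g h x
lemma ρ_repδ (g h : G) (x : V.rep) :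
    V.rep.ρ g (V.repδ h x) = V.repδ (g * h * g⁻¹) (V.rep.ρ g x) := V.ρ_δ g h x
lemma sum_repδ (x : V.rep) : ∑ g, V.repδ g x = x := V.sum_δ_apply x

/-- The linear map `a ⊗ v ↦ ∑_g δ_g v ⊗ g a`. -/
def halfLin (A : FDRep k G) : (A ⊗ V.rep : FDRep k G) →ₗ[k] (V.rep ⊗ A : FDRep k G) :=
  ∑ g : G, (TensorProduct.comm k A V.rep).toLinearMap ∘ₗ TensorProduct.map (A.ρ g) (V.repδ g)
lemma halfLin_tm (A : FDRep k G) (a : A) (v : V.rep) :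
    V.halfLin A (tm a v) = ∑ g, tm (V.repδ g v) (A.ρ g a) := by
  rw [halfLin, LinearMap.sum_apply]; rfl
/-- The linear map `v ⊗ a ↦ ∑_g g⁻¹ a ⊗ δ_g v`. -/
def halfInvLin (A : FDRep k G) : (V.rep ⊗ A : FDRep k G) →ₗ[k] (A ⊗ V.rep : FDRep k G) :=
  ∑ g : G, (TensorProduct.comm k V.rep A).toLinearMap ∘ₗ TensorProduct.map (V.repδ g) (A.ρ g⁻¹)
lemma halfInvLin_tm (A : FDRep k G) (a : A) (v : V.rep) :
    V.halfInvLin A (tm v a) = ∑ g, tm (A.ρ g⁻¹ a) (V.repδ g v) := by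
  rw [halfInvLin, LinearMap.sum_apply]; rfl

/-- The half-braiding defined by the grading of a module. -/
def halfIso (A : FDRep k G) : V.rep ⊗ A ≅ A ⊗ V.rep where
  hom := homOf (V.halfInvLin A) (fun h t => by
    induction t using tensor_induction with
    | h v a =>
      rw [ρ_tm, halfInvLin_tm, halfInvLin_tm, map_sum]
      refine (Fintype.sum_equiv (MulAut.conj h).toEquiv _ _ fun g => ?_).symm
      simp only [ρ_tm, ρ_repδ, ρ_ρ, MulEquiv.toEquiv_eq_coe, EquivLike.coe_coe, MulAut.conj_apply]
      congr 3
      group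
    | ha a b ha hb => simp only [map_add, ha, hb])
  inv := homOf (V.halfLin A) (fun h t => by
    induction t using tensor_induction with
    | h a v =>
      rw [ρ_tm, halfLin_tm, halfLin_tm, map_sum]
      refine (Fintype.sum_equiv (MulAut.conj h).toEquiv _ _ fun g => ?_).symm
      simp only [ρ_tm, ρ_repδ, ρ_ρ, MulEquiv.toEquiv_eq_coe, EquivLike.coe_coe, MulAut.conj_apply]
      congr 3
      group
    | ha a b ha hb => simp only [map_add, ha, hb])
  hom_inv_id := lin_injective (tensor_ext fun v a => by
    simp only [lin_comp, lin_homOf, LinearMap.comp_apply, halfInvLin_tm, map_sum, halfLin_tm,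
      repδ_repδ, ρ_ρ]
    conv_rhs => rw [lin_id, LinearMap.id_apply, ← V.sum_repδ v, sum_tm]
    refine Finset.sum_congr rfl fun g _ => ?_
    rw [Finset.sum_eq_single g]
    · simp
    · intro h _ hh; rw [if_neg hh, zero_tm]
    · simp)
  inv_hom_id := lin_injective (tensor_ext fun a v => by
    simp only [lin_comp, lin_homOf, LinearMap.comp_apply, halfInvLin_tm, map_sum, halfLin_tm,
      repδ_repδ, ρ_ρ]
    conv_rhs => rw [lin_id, LinearMap.id_apply, ← V.sum_repδ v, tm_sum]
    refine Finset.sum_congr rfl fun g _ => ?_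
    rw [Finset.sum_eq_single g]
    · simp
    · intro h _ hh; rw [if_neg hh, tm_zero]
    · simp)

/-- The object of the center defined by a module over the Drinfeld double. -/
def toCenter : ReducedCenter k G := (⟨V.rep,
  { β := V.halfIso
    -- Two successive half-braidings apply two projections; orthogonality leaves a single group
    -- element acting on both factors, the diagonal action on `A ⊗ B`.
    monoidal := fun A B => lin_injective (tensor_ext fun v t => by
      induction t using tensor_induction with
      | h a b =>
        simp only [halfIso, lin_comp, lin_homOf, LinearMap.comp_apply, lin_assoc_inv, lin_assoc_hom,
          lin_whiskerLeft, lin_whiskerRight, halfInvLin_tm, ρ_tm, map_sum, sum_tm, tm_sum,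
          repδ_repδ]
        refine Finset.sum_congr rfl fun g _ => ?_
        rw [Finset.sum_eq_single g]
        · simp
        · intro h _ hh; rw [if_neg hh, tm_zero]
        · simp
      | ha a b ha hb => simp only [map_add, tm_add, ha, hb])
    naturality := fun f => lin_injective (tensor_ext fun v a => by
      simp only [halfIso, lin_comp, lin_homOf, LinearMap.comp_apply, lin_whiskerLeft,
        lin_whiskerRight, halfInvLin_tm, map_sum, lin_ρ]) }⟩ : Center (FDRep k G))

/-- On `e ⊗ x` in `k[G] ⊗ V` the half-braiding has `δ_g x` as coefficient of `e_g`: the grading is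
recovered. -/
lemma cδ_toCenter (g : G) : cδ (toCenter V) g = V.repδ g := by
  refine LinearMap.ext fun (x : V.rep) => ?_
  refine (congrArg (rcoef g) (V.halfLin_tm (reg k G) (regb 1) x)).trans ?_
  rw [map_sum]
  simp only [reg_ρ_regb, mul_one, rcoef_tm]
  simp
  rfl

end DoubleModule

lemma T_ρ (X : ReducedCenter k G) : ((T k G).obj X).ρ = X.1.ρ := DoubleModule.of_ρ _ _ _ _
lemma T_δ (X : ReducedCenter k G) : ((T k G).obj X).δ = cδ X := DoubleModule.of_δ _ _ _ _
/-- A linear map commuting with `G` and the gradings is a morphism of the center. -/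
def centerHom {X Y : Center (FDRep k G)} (f : X.1 →ₗ[k] Y.1)
    (hρ : ∀ g x, f (X.1.ρ g x) = Y.1.ρ g (f x)) (hδ : ∀ g x, f (cδ X g x) = cδ Y g (f x)) :
    X ⟶ Y :=
  Center.Hom.mk (homOf f hρ) fun A => by
    -- By `gam_tm` the half-braidings with every `A` are expressed through the operators `δ_g`.
    have h : A ◁ homOf f hρ ≫ gam Y A = gam X A ≫ homOf f hρ ▷ A :=
      lin_injective (tensor_ext fun a x => by
        simp only [lin_comp, LinearMap.comp_apply, lin_whiskerLeft, lin_whiskerRight, gam_tm,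
          lin_homOf, map_sum, hδ])
    rw [gam, gam, Iso.eq_inv_comp] at h
    rw [← h, Category.assoc, Category.assoc, Iso.inv_hom_id, Category.comp_id]

/-- The functor `T` is fully faithful. -/
def TFullyFaithful : (T k G).FullyFaithful where
  preimage {X Y} f := centerHom (X := X) (Y := Y) f.toLin
    (fun g x => by
      have := DoubleModule.toLin_ρ f g x
      rwa [T_ρ, T_ρ] at this)
    (fun g x => by
      have := DoubleModule.toLin_δ f g x
      rwa [T_δ, T_δ] at this)
  map_preimage f := rfl
  preimage_map f := rfl

instance : (T k G).Full := TFullyFaithful.full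
instance : (T k G).Faithful := TFullyFaithful.faithful

/-- The module of the object of the center defined by a module. -/
def counit (V : DoubleModule k G) : (T k G).obj V.toCenter ≅ V :=
  DoubleModule.isoOfInv
    (DoubleModule.homMk (X := (T k G).obj V.toCenter) (Y := V) LinearMap.id
      (fun g x => by rw [T_ρ]; rfl)
      (fun g x => by rw [T_δ, DoubleModule.cδ_toCenter]; rfl))
    LinearMap.id rfl rfl

instance : (T k G).EssSurj := ⟨fun V => ⟨V.toCenter, ⟨counit V⟩⟩⟩
instance : (T k G).IsEquivalence where

/-- The reduced tensor product, as a structure on the center. -/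
@[reducible]
def reducedStruct : MonoidalCategoryStruct (ReducedCenter k G) where
  -- All operations are pulled back through `T`, so the coherence axioms are inherited from
  -- `D(G)`-modules; agreement with the diagrams is a separate matter.
  tensorObj X Y := DoubleModule.toCenter ((T k G).obj X ⊗ (T k G).obj Y)
  whiskerLeft X _ _ f := TFullyFaithful.preimage
    ((counit _).hom ≫ (T k G).obj X ◁ (T k G).map f ≫ (counit _).inv)
  whiskerRight f Y := TFullyFaithful.preimage
    ((counit _).hom ≫ (T k G).map f ▷ (T k G).obj Y ≫ (counit _).inv)
  tensorHom f g := TFullyFaithful.preimage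
    ((counit _).hom ≫ ((T k G).map f ⊗ₘ (T k G).map g) ≫ (counit _).inv)
  tensorUnit := DoubleModule.toCenter (𝟙_ _)
  associator _ _ _ := TFullyFaithful.preimageIso
    (counit _ ≪≫ whiskerRightIso (counit _) _ ≪≫ α_ _ _ _ ≪≫ whiskerLeftIso _ (counit _).symm ≪≫
      (counit _).symm)
  leftUnitor _ := TFullyFaithful.preimageIso
    (counit _ ≪≫ whiskerRightIso (counit _) _ ≪≫ λ_ _)
  rightUnitor _ := TFullyFaithful.preimageIso
    (counit _ ≪≫ whiskerLeftIso _ (counit _) ≪≫ ρ_ _)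

/-- The functor `T` is strict for the reduced tensor product, up to the identity of vectors. -/
@[reducible]
def inducingData : letI := reducedStruct (k := k) (G := G)
    Monoidal.InducingFunctorData (T k G) :=
  letI := reducedStruct (k := k) (G := G)
  { μIso := fun X Y => (counit _).symm
    εIso := (counit _).symm
    whiskerLeft_eq := fun X _ _ f => TFullyFaithful.map_preimage _
    whiskerRight_eq := fun f Y => TFullyFaithful.map_preimage _
    tensorHom_eq := fun f g => TFullyFaithful.map_preimage _
    associator_eq := fun _ _ _ => by
      refine (TFullyFaithful.map_preimage _).trans ?_
      simp
      rfl
    leftUnitor_eq := fun _ => by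
      refine (TFullyFaithful.map_preimage _).trans ?_
      simp
      rfl
    rightUnitor_eq := fun _ => by
      refine (TFullyFaithful.map_preimage _).trans ?_
      simp
      rfl }

/-- The center is a monoidal category under the reduced tensor product. -/
@[reducible]
def reducedMonoidal : MonoidalCategory (ReducedCenter k G) :=
  letI := reducedStruct (k := k) (G := G)
  Monoidal.induced (T k G) inducingData

/-- The functor `T` is monoidal. -/
@[reducible]
def TMonoidal : letI := reducedMonoidal (k := k) (G := G)
    (T k G).Monoidal :=
  letI := reducedStruct (k := k) (G := G)
  Monoidal.fromInducedMonoidal (T k G) inducingData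

end Equivalence

/-! ### The pulled-back tensor product agrees with the image of `Q`. -/

section ReducedTensor
variable {k : Type u} [Field k] [CharZero k] {G : Type u} [Group G] [Fintype G] [Supergroup G]

attribute [local instance] reducedMonoidal TMonoidal

namespace DoubleModule

variable {X Y Z X' Y' : DoubleModule k G}

/-- Morphisms preserve the regraded degrees, so they map the twisted product into the twisted
product without a projection. -/
lemma J_mapLin (f : X ⟶ X') (g : Y ⟶ Y') (t : tens X Y) :
    J X' Y' (mapLin f g t) = TensorProduct.map f.toLin g.toLin (J X Y t) := by
  have : J X' Y' ∘ₗ mapLin f g = TensorProduct.map f.toLin g.toLin ∘ₗ J X Y :=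
    tens_lin_ext fun x y => by
      simp only [LinearMap.comp_apply, mapLin_tz, J_tz, map_sum, TensorProduct.map_tmul, toLin_δ']
  exact LinearMap.congr_fun this t

/-- On the unit `z` acts by conjugation, hence trivially, and the regrading changes nothing. -/
lemma unit_δ'_apply (b : G) (f : unit k G) (c : G) :
    ((unit k G).δ' b f) c = if c = b then f b else (0 : k) := by
  have : (unit k G).δ' b = unitδ b := unit_ext fun a => by
    rw [unit_δ'_sgl, ← unit_δ_sgl, unit_δ]
  rw [this]; exact unitδ_apply b f c
lemma lunitLin_tz_eq_sum (f : unit k G) (x : X) :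
    lunitLin X (tz f x) = ∑ b, (f b : k) • X.δ' b x := by
  conv_lhs => rw [unit_eq_sum f, sum_tz, map_sum]
  simp only [smul_tz, map_smul, lunitLin_tz]
lemma runitLin_tz_eq_sum (f : unit k G) (x : X) :
    runitLin X (tz x f) = ∑ b, (f b : k) • X.δ' b x := by
  conv_lhs => rw [unit_eq_sum f, tz_sum, map_sum]
  simp only [tz_smul, map_smul, runitLin_tz]

end DoubleModule

open DoubleModule

/-- The module `T(X, γ)`. -/
def TD (X : Center (FDRep k G)) : DoubleModule k G :=
  .of (V := X.1) X.1.ρ (cδ X) (center_grading X) (center_sum X)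
lemma TD_ρ (X : Center (FDRep k G)) : (TD X).ρ = X.1.ρ := of_ρ _ _ _ _
lemma TD_δ (X : Center (FDRep k G)) : (TD X).δ = cδ X := of_δ _ _ _ _

lemma fproj_TD (X Y : Center (FDRep k G)) (b : G) : fproj (TD X) (TD Y) b = cproj X Y b := by
  rw [fproj, TD_ρ, TD_ρ, TD_δ, TD_δ]; rfl

lemma tprod_TD (X Y : Center (FDRep k G)) (g : G) :
    ((TD X).ρ.tprod (TD Y).ρ) g = (X.1 ⊗ Y.1).ρ g := by
  rw [TD_ρ, TD_ρ]; rfl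

/-- The inclusion of the reduced tensor product in the tensor product. -/
def redIncl (X Y : Center (FDRep k G)) : (tens (TD X) (TD Y)).rep ⟶ X.1 ⊗ Y.1 :=
  homOf (J (TD X) (TD Y)) fun g t => (J_ρ g t).trans (LinearMap.congr_fun (tprod_TD X Y g) _)
/-- The projection of the tensor product to the reduced tensor product. -/
def redProj (X Y : Center (FDRep k G)) : X.1 ⊗ Y.1 ⟶ (tens (TD X) (TD Y)).rep :=
  homOf (R (TD X) (TD Y)) fun g t => J_injective
    (((congrArg (tproj (TD X) (TD Y)) (LinearMap.congr_fun (tprod_TD X Y g) t).symm).trans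
      (tprod_tproj (X := TD X) (Y := TD Y) g t).symm).trans
      (J_ρ g (R (TD X) (TD Y) t)).symm)

lemma redIncl_redProj (X Y : Center (FDRep k G)) : redIncl X Y ≫ redProj X Y = 𝟙 _ :=
  lin_injective (LinearMap.ext fun t => R_J (X := TD X) (Y := TD Y) t)

/-- Both half-braidings project to the fiber over `c` and let `c` act on `B`: one by its
construction from the grading, the other by `lin_redHalf`. -/
lemma red_half [IsAlgClosed k] (S : IrrData k G) (X Y : Center (FDRep k G)) (B : FDRep k G) :
    gam (toCenter (tens (TD X) (TD Y))) B ≫ redIncl X Y ▷ B =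
      B ◁ redIncl X Y ≫ S.redHalf X Y B := by
  refine lin_injective (tensor_ext fun b t => ?_)
  have h1 : lin (gam (toCenter (tens (TD X) (TD Y))) B ≫ redIncl X Y ▷ B)
      (tm b t) = ∑ c, tm (cproj X Y c (J (TD X) (TD Y) t)) (B.ρ c b) := by
    refine (congrArg (lin (redIncl X Y ▷ B)) (halfLin_tm _ B b t)).trans ?_
    rw [map_sum]
    refine Finset.sum_congr rfl fun c _ => ?_
    rw [← fproj_TD]
    exact congrArg (fun s : (X.1 ⊗ Y.1 : FDRep k G) => tm s (B.ρ c b)) (J_δ c t)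
  refine h1.trans ?_
  have h2 : ∀ s : (X.1 ⊗ Y.1 : FDRep k G), lin (S.redHalf X Y B) (tm b s) =
      ∑ c, tm (cproj X Y c s) (B.ρ c b) := fun s => by
    induction s using tensor_induction with
    | h x y => exact lin_redHalf S X Y B b x y
    | ha s s' hs hs' => simp only [tm_add, map_add, hs, hs', add_tm, Finset.sum_add_distrib]
  exact (h2 _).symm

/-- Both are the sum of the projections to the fibers, the right side by `lin_Q`. -/
lemma redProj_redIncl [IsAlgClosed k] (S : IrrData k G) (X Y : Center (FDRep k G)) :
    redProj X Y ≫ redIncl X Y = S.Q X Y := by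
  refine lin_injective (tensor_ext fun x y => ?_)
  refine Eq.trans ?_ (lin_Q S X Y x y).symm
  refine (J_R (X := TD X) (Y := TD Y) (tm x y)).trans ?_
  refine (LinearMap.sum_apply _ _ _).trans ?_
  exact Finset.sum_congr rfl fun b _ => LinearMap.congr_fun (fproj_TD X Y b) _

lemma red_map {X X' Y Y' : ReducedCenter k G} (f : X ⟶ X') (g : Y ⟶ Y') :
    (f ⊗ₘ g).f ≫ redIncl X' Y' = redIncl X Y ≫ (f.f ⊗ₘ g.f) :=
  lin_injective (LinearMap.ext fun t => J_mapLin ((T k G).map f) ((T k G).map g) t)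

/-- The identity of the vectors of `V`, as vectors of `T` of the corresponding object. -/
def toT (V : DoubleModule k G) : V →ₗ[k] TD V.toCenter := (counit V).inv.toLin

lemma TD_toCenter_δ' (V : DoubleModule k G) (g : G) (v : V) :
    (TD V.toCenter).δ' g (toT V v) = toT V (V.δ' g v) := (toLin_δ' (counit V).inv g v).symm

/-- The pulled-back associator is that of `D(G)`-modules up to counits, which are the identity on
vectors. -/
lemma red_assoc_tz (X Y Z : ReducedCenter k G) (x : TD X) (y : TD Y) (w : TD Z) :
    lin (α_ X Y Z).hom.f (tz (toT (tens (TD X) (TD Y)) (tz x y)) w) =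
      tz x (toT (tens (TD Y) (TD Z)) (tz y w)) := by
  let XY := tens (TD X) (TD Y)
  let YZ := tens (TD Y) (TD Z)
  change mapLin (𝟙 (TD X)) (counit YZ).inv (assocLin (TD X) (TD Y) (TD Z)
    (mapLin (counit XY).hom (𝟙 (TD Z)) (tz (toT XY (tz x y)) w))) = _
  refine (congrArg (fun t => mapLin (𝟙 (TD X)) (counit YZ).inv (assocLin (TD X) (TD Y) (TD Z) t))
    (mapLin_tz (counit XY).hom (𝟙 (TD Z)) (toT XY (tz x y)) w)).trans ?_
  refine (congrArg (mapLin (𝟙 (TD X)) (counit YZ).inv) (assocLin_tz x y w)).trans ?_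
  exact mapLin_tz _ _ _ _

lemma red_tens_ext3 {X Y Z : DoubleModule k G} {M : Type*} [AddCommGroup M] [Module k M]
    {f f' : tens (TD (toCenter (tens X Y))) Z →ₗ[k] M}
    (h : ∀ x y w, f (tz (toT _ (tz x y)) w) = f' (tz (toT _ (tz x y)) w)) : f = f' := by
  refine tens_lin_ext fun t w => ?_
  let e : tens X Y →ₗ[k] tens (TD (toCenter (tens X Y))) Z :=
    R _ Z ∘ₗ (TensorProduct.mk k _ Z).flip w ∘ₗ toT (tens X Y)
  exact LinearMap.congr_fun (tens_lin_ext (f := f ∘ₗ e) (g := f' ∘ₗ e) fun x y => h x y w) t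

lemma redIncl_tz (X Y : Center (FDRep k G)) (x : TD X) (y : TD Y) :
    lin (redIncl X Y) (tz x y) = ∑ b, tm ((TD X).δ' b x) ((TD Y).δ' b y) := J_tz x y

lemma redIncl_δ' (X Y : Center (FDRep k G)) (x : TD X) (y : TD Y) (b : G) :
    lin (redIncl X Y) ((tens (TD X) (TD Y)).δ' b (tz x y)) = tm ((TD X).δ' b x) ((TD Y).δ' b y) := by
  rw [← tz_left, redIncl_tz, Finset.sum_eq_single b]
  · rw [δ'_δ'_self]
  · intro c _ hc; rw [δ'_δ', if_neg hc]; exact zero_tm _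
  · simp

lemma redIncl_tz_right (X : Center (FDRep k G)) (V : DoubleModule k G) (x : TD X) (v : V) :
    lin (redIncl X V.toCenter) (tz x (toT V v)) = ∑ b, tm ((TD X).δ' b x) (V.δ' b v : V.rep) := by
  refine (redIncl_tz X V.toCenter x (toT V v)).trans ?_
  simp only [TD_toCenter_δ']
  rfl
lemma redIncl_tz_left (X : Center (FDRep k G)) (V : DoubleModule k G) (x : TD X) (v : V) :
    lin (redIncl V.toCenter X) (tz (toT V v) x) = ∑ b, tm (V.δ' b v : V.rep) ((TD X).δ' b x) := by
  refine (redIncl_tz V.toCenter X (toT V v) x).trans ?_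
  simp only [TD_toCenter_δ']
  rfl

/-- The iterated inclusion keeps the components whose three regraded degrees coincide. The other
bracketing gives the same sum, whence `red_assoc`. -/
lemma redIncl_comp_left (X Y Z : Center (FDRep k G)) (x : TD X) (y : TD Y) (w : TD Z) :
    lin (redIncl (toCenter (tens (TD X) (TD Y))) Z ≫ redIncl X Y ▷ Z.1 ≫ (α_ X.1 Y.1 Z.1).hom)
      (tz (toT (tens (TD X) (TD Y)) (tz x y)) w) =
      ∑ b, tm ((TD X).δ' b x) (tm ((TD Y).δ' b y) ((TD Z).δ' b w)) := by
  refine (congrArg (lin (redIncl X Y ▷ Z.1 ≫ (α_ X.1 Y.1 Z.1).hom))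
    (redIncl_tz_left Z _ w (tz x y))).trans ?_
  refine (map_sum (lin (redIncl X Y ▷ Z.1 ≫ (α_ X.1 Y.1 Z.1).hom)) _ _).trans ?_
  refine Finset.sum_congr rfl fun b _ => ?_
  exact congrArg (fun t : (X.1 ⊗ Y.1 : FDRep k G) => lin (α_ X.1 Y.1 Z.1).hom (tm t ((TD Z).δ' b w)))
    (redIncl_δ' X Y x y b)
lemma redIncl_comp_right (X Y Z : Center (FDRep k G)) (x : TD X) (y : TD Y) (w : TD Z) :
    lin (redIncl X (toCenter (tens (TD Y) (TD Z))) ≫ X.1 ◁ redIncl Y Z)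
      (tz x (toT (tens (TD Y) (TD Z)) (tz y w))) =
      ∑ b, tm ((TD X).δ' b x) (tm ((TD Y).δ' b y) ((TD Z).δ' b w)) := by
  refine (congrArg (lin (X.1 ◁ redIncl Y Z)) (redIncl_tz_right X _ x (tz y w))).trans ?_
  refine (map_sum (lin (X.1 ◁ redIncl Y Z)) _ _).trans ?_
  refine Finset.sum_congr rfl fun b _ => ?_
  exact congrArg (fun t : (Y.1 ⊗ Z.1 : FDRep k G) => (tm ((TD X).δ' b x) t : (X.1 ⊗ (Y.1 ⊗ Z.1) : FDRep k G)))
    (redIncl_δ' Y Z y w b)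

/-- The inclusion of the reduced tensor product in the tensor product. -/
abbrev rincl (X Y : ReducedCenter k G) : (X ⊗ Y : ReducedCenter k G).1 ⟶ X.1 ⊗ Y.1 := redIncl X Y

lemma red_assoc (X Y Z : ReducedCenter k G) :
    (α_ X Y Z).hom.f ≫ rincl X (Y ⊗ Z) ≫ X.1 ◁ rincl Y Z =
      rincl (X ⊗ Y) Z ≫ rincl X Y ▷ Z.1 ≫ (α_ X.1 Y.1 Z.1).hom := by
  refine lin_injective (red_tens_ext3 (X := TD X) (Y := TD Y) (Z := TD Z) fun x y w => ?_)
  refine Eq.trans ?_ (redIncl_comp_left X Y Z x y w).symm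
  refine Eq.trans ?_ (redIncl_comp_right X Y Z x y w)
  exact congrArg (lin (rincl X (Y ⊗ Z) ≫ X.1 ◁ rincl Y Z)) (red_assoc_tz X Y Z x y w)

/-! ### The unit object and the unit constraints. -/

section Unit
variable [IsAlgClosed k] (S : IrrData k G)

/-- The identification of `⨁ X_i ⊗ X_i^*` with the space of functions on `G`. -/
def thetaHom : S.unitRep ⟶ (unit k G).rep :=
  homOf (theta S) fun g u => (theta_ρ S g u).trans (LinearMap.congr_fun
    (congrFun (congrArg DFunLike.coe (unit_ρ (k := k) (G := G)).symm) g) _)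

instance : IsIso (thetaHom S) := isIso_of_bijective _ (theta_bijective S)

/-- The unit of the reduced tensor product is `⨁ X_i ⊗ X_i^*`. -/
def redUnit : (unit k G).rep ≅ S.unitRep := (asIso (thetaHom S)).symm

lemma theta_redUnit (u : (unit k G).rep) : theta S (lin (redUnit S).hom u) = u :=
  LinearMap.congr_fun (congrArg lin (redUnit S).hom_inv_id) u
-- For `redUnit` only the inverse, `theta`, is explicit, so compatibility of half-braidings is
-- tested in that direction.
lemma half_of_iso {A U B : FDRep k G} (e : A ≅ U) (γ : B ⊗ A ⟶ A ⊗ B) (γ' : B ⊗ U ⟶ U ⊗ B)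
    (h : ∀ b u, lin γ (tm b (lin e.inv u)) = lin (e.inv ▷ B) (lin γ' (tm b u))) :
    γ ≫ e.hom ▷ B = B ◁ e.hom ≫ γ' := by
  rw [← cancel_epi (B ◁ e.inv), ← cancel_mono (e.inv ▷ B)]
  simp only [Category.assoc, hom_inv_whiskerRight, Category.comp_id, whiskerLeft_inv_hom_assoc]
  exact lin_injective (tensor_ext h)

lemma red_unit_half (B : FDRep k G) :
    gam (toCenter (unit k G)) B ≫ (redUnit S).hom ▷ B = B ◁ (redUnit S).hom ≫ S.unitHalf B := by
  refine half_of_iso (redUnit S) (gam (toCenter (unit k G)) B) _ fun b u => ?_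
  refine Eq.trans ?_ (theta_unitHalf S B b u).symm
  refine (halfLin_tm (unit k G) B b (theta S u)).trans ?_
  refine Finset.sum_congr rfl fun c _ => ?_
  rw [repδ, unit_δ]; rfl

lemma unit_smul_δ' (X : DoubleModule k G) (f : unit k G) (x : X) (b : G) :
    ∑ c, ((unit k G).δ' b f c : k) • X.δ' c (X.δ' b x) = (f b : k) • X.δ' b x := by
  rw [Finset.sum_eq_single b]
  · rw [unit_δ'_apply, if_pos rfl, δ'_δ'_self]
  · intro c _ hc; rw [unit_δ'_apply, if_neg hc]; exact zero_smul _ _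
  · simp

lemma TD_δ' (X : Center (FDRep k G)) : (TD X).δ' = ctw X := by
  funext g
  rw [δ', TD_ρ, TD_δ]; rfl

lemma redUnit_leftUnit (X : Center (FDRep k G)) (f : (unit k G).rep) (x : X.1) :
    lin ((redUnit S).hom ▷ X.1 ≫ S.leftUnit X) (tm f x) =
      ∑ c, (show unit k G from f) c • (TD X).δ' c x :=
  (lin_leftUnit S X (lin (redUnit S).hom f) x).trans <| Finset.sum_congr rfl fun c _ =>
    congrArg₂ (fun (a : k) (D : Module.End k X.1) => a • D x) (congrFun (theta_redUnit S f) c)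
      (congrFun (TD_δ' X).symm c)
lemma redUnit_rightUnit (X : Center (FDRep k G)) (f : (unit k G).rep) (x : X.1) :
    lin (X.1 ◁ (redUnit S).hom ≫ S.rightUnit X) (tm x f) =
      ∑ c, (show unit k G from f) c • (TD X).δ' c x :=
  (lin_rightUnit S X (lin (redUnit S).hom f) x).trans <| Finset.sum_congr rfl fun c _ =>
    congrArg₂ (fun (a : k) (D : Module.End k X.1) => a • D x) (congrFun (theta_redUnit S f) c)
      (congrFun (TD_δ' X).symm c)

lemma red_leftUnit_tz (X : Center (FDRep k G)) (f : unit k G) (x : TD X) :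
    lin (redIncl (toCenter (unit k G)) X ≫ (redUnit S).hom ▷ X.1 ≫ S.leftUnit X)
      (tz (toT _ f) x) = ∑ b, (f b : k) • (TD X).δ' b x := by
  refine (congrArg (lin ((redUnit S).hom ▷ X.1 ≫ S.leftUnit X)) (redIncl_tz_left X _ x f)).trans ?_
  refine (map_sum (lin ((redUnit S).hom ▷ X.1 ≫ S.leftUnit X)) _ _).trans ?_
  refine Finset.sum_congr rfl fun b _ => ?_
  exact (redUnit_leftUnit S X ((unit k G).δ' b f) ((TD X).δ' b x)).trans
    (unit_smul_δ' (TD X) f x b)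
lemma red_rightUnit_tz (X : Center (FDRep k G)) (f : unit k G) (x : TD X) :
    lin (redIncl X (toCenter (unit k G)) ≫ X.1 ◁ (redUnit S).hom ≫ S.rightUnit X)
      (tz x (toT _ f)) = ∑ b, (f b : k) • (TD X).δ' b x := by
  refine (congrArg (lin (X.1 ◁ (redUnit S).hom ≫ S.rightUnit X)) (redIncl_tz_right X _ x f)).trans ?_
  refine (map_sum (lin (X.1 ◁ (redUnit S).hom ≫ S.rightUnit X)) _ _).trans ?_
  refine Finset.sum_congr rfl fun b _ => ?_
  exact (redUnit_rightUnit S X ((unit k G).δ' b f) ((TD X).δ' b x)).trans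
    (unit_smul_δ' (TD X) f x b)

lemma leftUnitor_tz (X : ReducedCenter k G) (f : unit k G) (x : TD X) :
    lin (λ_ X).hom.f (tz (toT _ f) x) = ∑ b, (f b : k) • (TD X).δ' b x := by
  change lunitLin (TD X) (mapLin (counit (unit k G)).hom (𝟙 (TD X)) (tz (toT _ f) x)) = _
  refine Eq.trans ?_ (lunitLin_tz_eq_sum (X := TD X) f x)
  exact congrArg (lunitLin (TD X)) (mapLin_tz (counit (unit k G)).hom (𝟙 (TD X)) (toT _ f) x)
lemma rightUnitor_tz (X : ReducedCenter k G) (f : unit k G) (x : TD X) :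
    lin (ρ_ X).hom.f (tz x (toT _ f)) = ∑ b, (f b : k) • (TD X).δ' b x := by
  change runitLin (TD X) (mapLin (𝟙 (TD X)) (counit (unit k G)).hom (tz x (toT _ f))) = _
  refine Eq.trans ?_ (runitLin_tz_eq_sum (X := TD X) f x)
  exact congrArg (runitLin (TD X)) (mapLin_tz (𝟙 (TD X)) (counit (unit k G)).hom x (toT _ f))

/-- Both constraints let the function `f` act on `x` by its value at the regraded degree; the same
holds on the right. -/
lemma red_leftUnit (X : ReducedCenter k G) :
    (λ_ X).hom.f = rincl (𝟙_ _) X ≫ (redUnit S).hom ▷ X.1 ≫ S.leftUnit X := by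
  refine lin_injective (tens_lin_ext (X := TD (toCenter (unit k G))) (Y := TD X) fun f x => ?_)
  exact (leftUnitor_tz X f x).trans (red_leftUnit_tz S X f x).symm
lemma red_rightUnit (X : ReducedCenter k G) :
    (ρ_ X).hom.f = rincl X (𝟙_ _) ≫ X.1 ◁ (redUnit S).hom ≫ S.rightUnit X := by
  refine lin_injective (tens_lin_ext (X := TD X) (Y := TD (toCenter (unit k G))) fun x f => ?_)
  exact (rightUnitor_tz X f x).trans (red_rightUnit_tz S X f x).symm

end Unit

end ReducedTensor

/-! ### Duals for the reduced tensor product. -/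

section ReducedRigid
variable {k : Type u} [Field k] [CharZero k] {G : Type u} [Group G] [Fintype G] [Supergroup G]

attribute [local instance] reducedMonoidal TMonoidal
open DoubleModule

/-- The dual of an object of the center. -/
def redDual (X : Center (FDRep k G)) : ReducedCenter k G := toCenter (dual (TD X))

/-- The dual of an object of the center is a dual for the reduced tensor product. -/
@[reducible]
def redExact (X : ReducedCenter k G) : ExactPairing X (redDual X) :=
  letI : ExactPairing ((T k G).obj X) ((T k G).obj (redDual X)) :=
    exactPairingCongrRight (Y' := dual ((T k G).obj X)) (counit (dual ((T k G).obj X)))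
  -- A faithful monoidal functor reflects the zigzag identities; evaluation and coevaluation are
  -- preimages of those of modules.
  ExactPairing.ofFaithful (T k G)
    (TFullyFaithful.preimage (Functor.OplaxMonoidal.δ (T k G) _ _ ≫ ε_ _ _ ≫
      Functor.LaxMonoidal.ε (T k G)))
    (TFullyFaithful.preimage (Functor.OplaxMonoidal.η (T k G) ≫ η_ _ _ ≫
      Functor.LaxMonoidal.μ (T k G) _ _))
    (TFullyFaithful.map_preimage _) (TFullyFaithful.map_preimage _)

/-- The center is rigid under the reduced tensor product. -/
@[reducible]
def redRigid : RightRigidCategory (ReducedCenter k G) where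
  rightDual X := { rightDual := redDual X, exact := redExact X }

attribute [local instance] redRigid

lemma eval_tz (X : ReducedCenter k G) (f : dual (TD X)) (x : TD X) :
    lin (ε_ X (Xᘁ)).f (tz (toT _ f) x) = evLin (TD X) (tz f x) := by
  change evLin (TD X) (mapLin (counit (dual (TD X))).hom (𝟙 (TD X)) (tz (toT _ f) x)) = _
  exact congrArg (evLin (TD X)) (mapLin_tz (counit (dual (TD X))).hom (𝟙 (TD X)) (toT _ f) x)

lemma mapLin_counit_inv (X V : DoubleModule k G) (x : X) (v : V) :
    mapLin (𝟙 X) (counit V).inv (tz x v) = tz x (toT V v) := mapLin_tz _ _ _ _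

lemma coevLin_eq_sum (X : DoubleModule k G) (f : unit k G) :
    coevLin X f = ∑ g, (f g : k) • ∑ s, tz (X.δ' g (bas X s)) (cob s) := by
  conv_lhs => rw [unit_eq_sum f]
  simp only [map_sum, map_smul, coevLin_sgl]

lemma coeval_apply (X : ReducedCenter k G) (f : unit k G) :
    lin (η_ X (Xᘁ)).f (toT _ f) = ∑ g, (f g : k) • ∑ s, tz ((TD X).δ' g (bas (TD X) s))
      (toT (dual (TD X)) (cob s)) := by
  change mapLin (𝟙 (TD X)) (counit (dual (TD X))).inv (coevLin (TD X) f) = _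
  refine (congrArg (mapLin (𝟙 (TD X)) (counit (dual (TD X))).inv)
    (coevLin_eq_sum (TD X) f)).trans ?_
  simp only [map_sum, map_smul, mapLin_counit_inv]
  rfl

lemma evLin_tz_apply (X : DoubleModule k G) (f : dual X) (x : X) (c : G) :
    evLin X (tz f x) c = app f (X.δ' c x) := by
  rw [evLin_tz]
  have h : ∀ (s : Finset G) (v : G → unit k G), (∑ h ∈ s, v h) c = ∑ h ∈ s, (v h c : k) :=
    fun s v => Finset.sum_apply c s v
  rw [h, Finset.sum_eq_single c]
  · change app f (X.δ' c x) * (sgl c : unit k G) c = _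
    rw [sgl_apply, if_pos rfl, mul_one]
  · intro b _ hb
    change app f (X.δ' b x) * (sgl b : unit k G) c = _
    rw [sgl_apply, if_neg (Ne.symm hb), mul_zero]
  · simp

/-- The representation underlying the dual is the dual representation. -/
def redDualIso (X : Center (FDRep k G)) : (redDual X).1 ≅ dualRep X.1 where
  hom := homOf (X := (dual (TD X)).rep) (Y := dualRep X.1) LinearMap.id fun g f => by
    change (dual (TD X)).ρ g f = _
    rw [dual_ρ, TD_ρ]; rfl
  inv := homOf (X := dualRep X.1) (Y := (dual (TD X)).rep) LinearMap.id fun g f => by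
    change _ = (dual (TD X)).ρ g f
    rw [dual_ρ, TD_ρ]; rfl
  hom_inv_id := rfl
  inv_hom_id := rfl

/-- On both sides the grading of the dual is the transpose of that of `X`; for the diagram this is
`lin_dualHalf`. -/
lemma red_dual_half (X : Center (FDRep k G)) (A : FDRep k G) :
    gam (redDual X) A ≫ (redDualIso X).hom ▷ A = A ◁ (redDualIso X).hom ≫ dualHalf X A := by
  refine lin_injective (tensor_ext fun a (f : dualRep X.1) => ?_)
  refine Eq.trans ?_ (lin_dualHalf X A a f).symm
  refine (congrArg (lin ((redDualIso X).hom ▷ A)) (halfLin_tm (dual (TD X)) A a f)).trans ?_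
  refine (map_sum (lin ((redDualIso X).hom ▷ A)) _ _).trans ?_
  refine Finset.sum_congr rfl fun g _ => ?_
  rw [repδ, dual_δ]
  change tm (X := dualRep X.1) (dualδ (TD X) g f) (A.ρ g a) = _
  rw [dualδ, TD_δ]; rfl

section
variable [IsAlgClosed k] (S : IrrData k G)

lemma theta_evalMap_δ' (X : Center (FDRep k G)) (f : dual (TD X)) (x : TD X) (b c : G) :
    theta S (lin (S.evalMap X) (tm (X := dualRep X.1) ((dual (TD X)).δ' b f) ((TD X).δ' b x))) c =
      app f ((TD X).δ' b ((TD X).δ' c ((TD X).δ' b x))) :=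
  ((theta_evalMap S X _ _ c).trans (congrArg (fun D : G → Module.End k X.1 =>
    dapp (X := X.1) ((dual (TD X)).δ' b f) (D c ((TD X).δ' b x))) (TD_δ' X).symm)).trans
    (app_δ' b f ((TD X).δ' c ((TD X).δ' b x)))

lemma red_dual_ev_tz (X : Center (FDRep k G)) (f : dual (TD X)) (x : TD X) (c : G) :
    theta S (lin (redIncl (redDual X) X ≫ (redDualIso X).hom ▷ X.1 ≫ S.evalMap X)
      (tz (toT _ f) x)) c = app f ((TD X).δ' c x) := by
  let F := lin ((redDualIso X).hom ▷ X.1 ≫ S.evalMap X)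
  have h1 : lin (redIncl (redDual X) X ≫ (redDualIso X).hom ▷ X.1 ≫ S.evalMap X)
      (tz (toT _ f) x) = ∑ b, lin (S.evalMap X)
        (tm (X := dualRep X.1) ((dual (TD X)).δ' b f) ((TD X).δ' b x)) :=
    (congrArg F (redIncl_tz_left X _ x f)).trans (map_sum F _ _)
  -- The value at `c` sees only the component of regraded degree `c`.
  rw [h1, map_sum, Finset.sum_apply, Finset.sum_eq_single c]
  · rw [theta_evalMap_δ', δ'_δ'_self, δ'_δ'_self]
  · intro b _ hb
    rw [theta_evalMap_δ', δ'_δ' _ c b, if_neg (Ne.symm hb), map_zero, app_zero']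
  · simp

lemma theta_eval_tz (X : ReducedCenter k G) (f : dual (TD X)) (x : TD X) (c : G) :
    theta S (lin ((ε_ X (Xᘁ)).f ≫ (redUnit S).hom) (tz (toT _ f) x)) c =
      app f ((TD X).δ' c x) :=
  (congrFun (theta_redUnit S (lin (ε_ X (Xᘁ)).f (tz (toT _ f) x))) c).trans
    ((congrFun (eval_tz X f x) c).trans (evLin_tz_apply (TD X) f x c))

/-- Since `theta` is injective, the two evaluations may be compared as functions on `G`. -/
lemma red_dual_ev (X : ReducedCenter k G) :
    (ε_ X (Xᘁ)).f ≫ (redUnit S).hom =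
      rincl (Xᘁ) X ≫ (redDualIso X).hom ▷ X.1 ≫ S.evalMap X :=
  lin_injective (tens_lin_ext (X := TD (redDual X)) (Y := TD X) fun f x =>
    (theta_bijective S).1 (funext fun c =>
      (theta_eval_tz S X f x c).trans (red_dual_ev_tz S X f x c).symm))

/-- The diagram takes its values in all of `X ⊗ X^*`; the final projection turns each pure tensor
into the generator `tz` of the twisted product. -/
lemma redProj_coevMap (X : Center (FDRep k G)) (f : (unit k G).rep) :
    lin ((redUnit S).hom ≫ S.coevMap X ≫ X.1 ◁ (redDualIso X).inv ≫ redProj X (redDual X)) f =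
      ∑ g, ((show unit k G from f) g : k) • ∑ s, tz ((TD X).δ' g (bas (TD X) s))
        (toT (dual (TD X)) (cob s)) := by
  let F := lin (X.1 ◁ (redDualIso X).inv ≫ redProj X (redDual X))
  refine (congrArg F (lin_coevMap S X (lin (redUnit S).hom f))).trans ?_
  refine (map_sum F _ _).trans (Finset.sum_congr rfl fun g _ => ?_)
  refine (map_smul F _ _).trans (congrArg₂ (· • ·) (congrFun (theta_redUnit S f) g) ?_)
  refine (map_sum F _ _).trans (Finset.sum_congr rfl fun s _ => ?_)
  exact congrArg (fun D : G → Module.End k X.1 => tz (X := TD X)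
    (D g (bas (TD X) s)) (toT (dual (TD X)) (cob s))) (TD_δ' X).symm

lemma red_dual_coev (X : ReducedCenter k G) :
    (η_ X (Xᘁ)).f = (redUnit S).hom ≫ S.coevMap X ≫ X.1 ◁ (redDualIso X).inv ≫
      redProj X (Xᘁ : ReducedCenter k G) :=
  lin_injective (LinearMap.ext fun f => (coeval_apply X f).trans (redProj_coevMap S X f).symm)
end

end ReducedRigid

/-! ### Morphisms to a dual are determined by evaluation. -/

section EvaluationMates
universe v₁ u₁
variable {C : Type u₁} [Category.{v₁} C] [MonoidalCategory C]

/-- Morphisms `A → Y` correspond to forms on `A ⊗ X` by adjunction. The pairing is explicit because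
pairings other than the chosen one are needed, as in `double_dual_tensor`. -/
lemma hom_eq_of_evaluation {X Y A : C} (p : ExactPairing X Y) {f f' : A ⟶ Y}
    (h : f ▷ X ≫ p.evaluation' = f' ▷ X ≫ p.evaluation') : f = f' := by
  let _ : HasRightDual X := { rightDual := Y, exact := p }
  have e := congrArg (tensorRightHomEquiv A X Y (𝟙_ C)) h
  have h1 := tensorRightHomEquiv_whiskerRight_comp_evaluation (X := X) (f := (f : A ⟶ Xᘁ))
  have h2 := tensorRightHomEquiv_whiskerRight_comp_evaluation (X := X) (f := (f' : A ⟶ Xᘁ))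
  exact (cancel_mono (λ_ (Xᘁ : C)).inv).mp ((h1.symm.trans e).trans h2)

/-- The comparison of two duals is the mate of the identity of `X`. -/
lemma rightDualIso_hom_evaluation {X Y₁ Y₂ : C} (p₁ : ExactPairing X Y₁) (p₂ : ExactPairing X Y₂) :
    (rightDualIso p₁ p₂).hom ▷ X ≫ p₂.evaluation' = p₁.evaluation' := by
  have h := @rightAdjointMate_comp_evaluation C _ _ X X ⟨Y₂⟩ ⟨Y₁⟩ (𝟙 X)
  refine h.trans ?_
  rw [whiskerLeft_id, Category.id_comp]; rfl

/-- The nested form, inner pairing first, can be followed on elements step by step. -/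
lemma tensor_evaluation_eq {X₁ X₂ Y₁ Y₂ : C} [ExactPairing X₁ Y₁] [ExactPairing X₂ Y₂] :
    ε_ (X₁ ⊗ X₂) (Y₂ ⊗ Y₁) = (α_ Y₂ Y₁ (X₁ ⊗ X₂)).hom ≫ Y₂ ◁ (α_ Y₁ X₁ X₂).inv ≫
      Y₂ ◁ (ε_ X₁ Y₁ ▷ X₂) ≫ Y₂ ◁ (λ_ X₂).hom ≫ ε_ X₂ Y₂ := by
  rw [ExactPairing.tensor_evaluation]
  monoidal

lemma dualComparison_evaluation {D : Type*} [Category* D] [MonoidalCategory D]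
    [RightRigidCategory C] [RightRigidCategory D] (F : C ⥤ D) [F.Monoidal] (X : C) :
    dualComparison F X ▷ F.obj X ≫ ε_ (F.obj X) ((F.obj X)ᘁ) =
      Functor.LaxMonoidal.μ F (Xᘁ) X ≫ F.map (ε_ X (Xᘁ)) ≫ Functor.OplaxMonoidal.η F := by
  apply (tensorRightHomEquiv (F.obj (Xᘁ)) (F.obj X) ((F.obj X)ᘁ) (𝟙_ D)).injective
  rw [tensorRightHomEquiv_whiskerRight_comp_evaluation, dualComparison, Category.assoc,
    Iso.hom_inv_id, Category.comp_id]
end EvaluationMates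

/-! ### Forms as functions on `G`, through a monoidal functor to `D(G)`-modules. -/

section FiberElements
open DoubleModule
variable {k : Type u} [Field k] [CharZero k] {G : Type u} [Group G] [Fintype G] [Supergroup G]
universe v₁ u₁
variable {C : Type u₁} [Category.{v₁} C] [MonoidalCategory C] (F : C ⥤ DoubleModule k G)

lemma whiskerLeft_tz (X : DoubleModule k G) {Y Y' : DoubleModule k G} (f : Y ⟶ Y') (x : X) (y : Y) :
    (X ◁ f).toLin (tz x y) = tz x (f.toLin y) := mapLin_tz _ _ _ _
lemma whiskerRight_tz {X X' : DoubleModule k G} (f : X ⟶ X') (Y : DoubleModule k G) (x : X) (y : Y) :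
    (f ▷ Y).toLin (tz x y) = tz (f.toLin x) y := mapLin_tz _ _ _ _

variable [F.Monoidal]
open Functor.LaxMonoidal Functor.OplaxMonoidal

/-- The element of `F(A ⊗ B)` defined by elements of `F(A)` and `F(B)`. -/
def pr {A B : C} (a : F.obj A) (b : F.obj B) : F.obj (A ⊗ B) := (μ F A B).toLin (tz a b)

/-- The function on `G` which is the value of a form on a pair of elements. -/
def val {A B : C} (s : A ⊗ B ⟶ 𝟙_ C) (a : F.obj A) (b : F.obj B) : unit k G :=
  (η F).toLin ((F.map s).toLin (pr F a b))

/-- The values of a form, as a bilinear map. -/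
def valMap {A B : C} (s : A ⊗ B ⟶ 𝟙_ C) : F.obj A →ₗ[k] F.obj B →ₗ[k] unit k G :=
  TensorProduct.curry ((η F).toLin ∘ₗ (F.map s).toLin ∘ₗ (μ F A B).toLin ∘ₗ R _ _)

variable {F}

lemma valMap_apply {A B : C} (s : A ⊗ B ⟶ 𝟙_ C) (a : F.obj A) (b : F.obj B) :
    valMap F s a b = val F s a b := rfl

/-- The tensor constraint is invertible, so the products span. -/
lemma pr_ext {A B : C} {M : Type*} [AddCommGroup M] [Module k M] {f f' : F.obj (A ⊗ B) →ₗ[k] M}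
    (h : ∀ a b, f (pr F a b) = f' (pr F a b)) : f = f' := by
  have h1 : f ∘ₗ (μ F A B).toLin = f' ∘ₗ (μ F A B).toLin := tens_lin_ext h
  refine LinearMap.ext fun t => ?_
  have h2 : (μ F A B).toLin ((δ F A B).toLin t) = t :=
    LinearMap.congr_fun (congrArg Hom.toLin (Functor.Monoidal.δ_μ F A B)) t
  rw [← h2]
  exact LinearMap.congr_fun h1 _

lemma map_whiskerLeft_pr {A B B' : C} (f : B ⟶ B') (a : F.obj A) (b : F.obj B) :
    (F.map (A ◁ f)).toLin (pr F a b) = pr F a ((F.map f).toLin b) :=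
  (LinearMap.congr_fun (congrArg Hom.toLin (μ_natural_right F A f)) (tz a b)).symm.trans
    (congrArg (μ F A B').toLin (whiskerLeft_tz _ _ a b))
lemma map_whiskerRight_pr {A A' B : C} (f : A ⟶ A') (a : F.obj A) (b : F.obj B) :
    (F.map (f ▷ B)).toLin (pr F a b) = pr F ((F.map f).toLin a) b :=
  (LinearMap.congr_fun (congrArg Hom.toLin (μ_natural_left F f B)) (tz a b)).symm.trans
    (congrArg (μ F A' B).toLin (whiskerRight_tz _ _ a b))
lemma map_tensorHom_pr {A A' B B' : C} (f : A ⟶ A') (g : B ⟶ B') (a : F.obj A) (b : F.obj B) :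
    (F.map (f ⊗ₘ g)).toLin (pr F a b) = pr F ((F.map f).toLin a) ((F.map g).toLin b) := by
  rw [MonoidalCategory.tensorHom_def, F.map_comp, comp_toLin, LinearMap.comp_apply, map_whiskerRight_pr,
    map_whiskerLeft_pr]
lemma map_assoc_pr {A B D : C} (a : F.obj A) (b : F.obj B) (d : F.obj D) :
    (F.map (α_ A B D).hom).toLin (pr F (pr F a b) d) = pr F a (pr F b d) := by
  have h := LinearMap.congr_fun (congrArg Hom.toLin (Functor.LaxMonoidal.associativity F A B D)) (tz (tz a b) d)
  refine Eq.trans ?_ (h.trans ?_)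
  · exact (congrArg (fun t => (F.map (α_ A B D).hom).toLin ((μ F (A ⊗ B) D).toLin t))
      (whiskerRight_tz _ _ _ d)).symm
  · refine congrArg (μ F A (B ⊗ D)).toLin ?_
    refine (congrArg (F.obj A ◁ μ F B D).toLin (assocLin_tz a b d)).trans ?_
    exact whiskerLeft_tz _ _ a _
lemma map_assoc_inv_pr {A B D : C} (a : F.obj A) (b : F.obj B) (d : F.obj D) :
    (F.map (α_ A B D).inv).toLin (pr F a (pr F b d)) = pr F (pr F a b) d := by
  rw [← map_assoc_pr, ← LinearMap.comp_apply, ← comp_toLin, ← F.map_comp, Iso.hom_inv_id, F.map_id]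
  rfl
lemma map_leftUnitor_pr {A : C} (u : F.obj (𝟙_ C)) (a : F.obj A) :
    (F.map (λ_ A).hom).toLin (pr F u a) =
      ∑ c, ((η F).toLin u : G → k) c • (F.obj A).δ' c a := by
  have h := LinearMap.congr_fun (congrArg Hom.toLin (Functor.LaxMonoidal.left_unitality F A)) (tz ((η F).toLin u) a)
  refine Eq.trans ?_ (h.symm.trans (lunitLin_tz_eq_sum _ _))
  refine (congrArg (fun t => (F.map (λ_ A).hom).toLin ((μ F (𝟙_ C) A).toLin t)) ?_)
  refine Eq.trans ?_ (whiskerRight_tz _ _ _ a).symm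
  exact congrArg (fun v => tz v a)
    (LinearMap.congr_fun (congrArg Hom.toLin (Functor.Monoidal.η_ε F)) u).symm

lemma val_whiskerRight {A A' B : C} (f : A ⟶ A') (s : A' ⊗ B ⟶ 𝟙_ C) (a : F.obj A) (b : F.obj B) :
    val F (f ▷ B ≫ s) a b = val F s ((F.map f).toLin a) b := by
  rw [val, F.map_comp, comp_toLin, LinearMap.comp_apply, map_whiskerRight_pr]; rfl
lemma val_whiskerLeft {A B B' : C} (f : B ⟶ B') (s : A ⊗ B' ⟶ 𝟙_ C) (a : F.obj A) (b : F.obj B) :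
    val F (A ◁ f ≫ s) a b = val F s a ((F.map f).toLin b) := by
  rw [val, F.map_comp, comp_toLin, LinearMap.comp_apply, map_whiskerLeft_pr]; rfl

lemma val_injective [F.Faithful] {A B : C} {s s' : A ⊗ B ⟶ 𝟙_ C}
    (h : ∀ a b, val F s a b = val F s' a b) : s = s' := by
  apply F.map_injective
  rw [← cancel_mono (η F)]
  exact hom_ext (pr_ext h)

lemma pr_smul {A B : C} (a : F.obj A) (c : k) (b : F.obj B) : pr F a (c • b) = c • pr F a b := by
  rw [pr, tz_smul]; exact map_smul _ _ _
lemma pr_sum {A B : C} {ι : Type*} (s : Finset ι) (a : F.obj A) (b : ι → F.obj B) :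
    pr F a (∑ i ∈ s, b i) = ∑ i ∈ s, pr F a (b i) := by
  rw [pr, tz_sum]; exact map_sum _ _ _
lemma pr_δ' {A B : C} (a : F.obj A) (b : F.obj B) (c : G) :
    pr F a ((F.obj B).δ' c b) = (F.obj (A ⊗ B)).δ' c (pr F a b) := by
  rw [pr, tz_right]; exact toLin_δ' _ _ _

/-- Forms preserve the regraded degree, and the degree `c` part of the unit is the value at `c`; so
scaling `b` by a function of the degree scales the value pointwise. -/
lemma val_smul_δ' {A B : C} (s : A ⊗ B ⟶ 𝟙_ C) (a : F.obj A) (b : F.obj B) (f : G → k) (c : G) :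
    val F s a (∑ d, f d • (F.obj B).δ' d b) c = f c * val F s a b c := by
  have h : val F s a (∑ d, f d • (F.obj B).δ' d b) =
      ∑ d, f d • (unit k G).δ' d (val F s a b) := by
    rw [val, pr_sum]
    simp only [pr_smul, pr_δ', map_sum, map_smul, toLin_δ']
    rfl
  rw [h]
  refine (Finset.sum_apply c Finset.univ fun d => (f d • (unit k G).δ' d (val F s a b) : G → k)).trans ?_
  rw [Finset.sum_eq_single c]
  · exact congrArg (f c * ·) ((unit_δ'_apply c _ c).trans (if_pos rfl))
  · intro d _ hd
    exact (congrArg (f d * ·) ((unit_δ'_apply d _ c).trans (if_neg (Ne.symm hd)))).trans (mul_zero _)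
  · simp

/-- The evaluation of a tensor product is the pointwise product of the evaluations. -/
lemma val_tensor {X₁ X₂ Y₁ Y₂ : C} [ExactPairing X₁ Y₁] [ExactPairing X₂ Y₂] (g : F.obj Y₂)
    (h : F.obj Y₁) (x : F.obj X₁) (y : F.obj X₂) (c : G) :
    val F (ε_ (X₁ ⊗ X₂) (Y₂ ⊗ Y₁)) (pr F g h) (pr F x y) c =
      val F (ε_ X₁ Y₁) h x c * val F (ε_ X₂ Y₂) g y c := by
  rw [tensor_evaluation_eq, val]
  simp only [F.map_comp, comp_toLin, LinearMap.comp_apply, map_assoc_pr, map_whiskerLeft_pr,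
    map_assoc_inv_pr, map_whiskerRight_pr, map_leftUnitor_pr]
  -- The inner pairing has become a function acting on `y` through the left unit constraint, that
  -- is, by degree.
  exact val_smul_δ' _ g y _ c

/-! ### Canonical maps to the double dual: naturality, monoidality, functoriality. -/

section Pivotal
variable [RightRigidCategory C] [F.Faithful]

variable (F) in
/-- The evaluation of the double dual at the image of an element is the evaluation at it. -/
def IsDoubleDual {X : C} (i : X ⟶ (Xᘁ)ᘁ) : Prop :=
  ∀ (x : F.obj X) (f : F.obj (Xᘁ)),
    val F (ε_ (Xᘁ) ((Xᘁ)ᘁ)) ((F.map i).toLin x) f = val F (ε_ X (Xᘁ)) f x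

/-- Paired with `g` in `Y^*`, both sides send `x` to the value of `g` at the image of `x`: one
directly, the other through the transpose of `f`. -/
lemma double_dual_natural {X Y : C} {i : X ⟶ (Xᘁ)ᘁ} {j : Y ⟶ (Yᘁ)ᘁ} (hi : IsDoubleDual F i)
    (hj : IsDoubleDual F j) (f : X ⟶ Y) : f ≫ j = i ≫ (fᘁ)ᘁ := by
  apply hom_eq_of_evaluation (HasRightDual.exact (X := (Yᘁ : C)))
  change _ ≫ ε_ (Yᘁ) ((Yᘁ)ᘁ) = _ ≫ ε_ (Yᘁ) ((Yᘁ)ᘁ)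
  refine val_injective (F := F) fun x g => ?_
  rw [comp_whiskerRight, comp_whiskerRight, Category.assoc, Category.assoc,
    rightAdjointMate_comp_evaluation, val_whiskerRight, val_whiskerRight, val_whiskerRight,
    val_whiskerLeft, hi, hj, ← val_whiskerRight, rightAdjointMate_comp_evaluation, val_whiskerLeft]

lemma rightDualTensorIso_evaluation (X Y : C) :
    (rightDualTensorIso X Y).hom ▷ (X ⊗ Y) ≫ ε_ (X ⊗ Y) (Yᘁ ⊗ Xᘁ) = ε_ (X ⊗ Y) ((X ⊗ Y)ᘁ) :=
  rightDualIso_hom_evaluation _ _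

lemma dblDualTensorIso_evaluation (X Y : C) :
    (dblDualTensorIso X Y).hom ▷ ((X ⊗ Y)ᘁ) ≫ ((Xᘁ)ᘁ ⊗ (Yᘁ)ᘁ) ◁ (rightDualTensorIso X Y).hom ≫
      ε_ (Yᘁ ⊗ Xᘁ) ((Xᘁ)ᘁ ⊗ (Yᘁ)ᘁ) = ε_ ((X ⊗ Y)ᘁ) (((X ⊗ Y)ᘁ)ᘁ) :=
  rightDualIso_hom_evaluation _ _

/-- Passing to the double dual exchanges the order of the factors twice; with evaluations multiplied
pointwise, all that remains is commutativity of `k`. -/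
lemma double_dual_tensor {X Y : C} {i : X ⟶ (Xᘁ)ᘁ} {j : Y ⟶ (Yᘁ)ᘁ}
    {l : X ⊗ Y ⟶ ((X ⊗ Y)ᘁ)ᘁ} (hi : IsDoubleDual F i) (hj : IsDoubleDual F j)
    (hl : IsDoubleDual F l) : l ≫ (dblDualTensorIso X Y).hom = i ⊗ₘ j := by
  -- The test uses the pairing through which `dblDualTensorIso` is defined.
  apply hom_eq_of_evaluation (exactPairingCongrLeft (rightDualTensorIso X Y))
  change _ ≫ _ ◁ (rightDualTensorIso X Y).hom ≫ ε_ (Yᘁ ⊗ Xᘁ) ((Xᘁ)ᘁ ⊗ (Yᘁ)ᘁ) =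
    _ ≫ _ ◁ (rightDualTensorIso X Y).hom ≫ ε_ (Yᘁ ⊗ Xᘁ) ((Xᘁ)ᘁ ⊗ (Yᘁ)ᘁ)
  rw [comp_whiskerRight, Category.assoc, dblDualTensorIso_evaluation]
  refine val_injective (F := F) fun t f => ?_
  rw [val_whiskerRight, val_whiskerRight, val_whiskerLeft, hl, ← rightDualTensorIso_evaluation,
    val_whiskerRight]
  generalize (F.map (rightDualTensorIso X Y).hom).toLin f = q
  -- As an equality of bilinear maps it can be checked on products in both variables.
  have h : valMap F (ε_ (X ⊗ Y) (Yᘁ ⊗ Xᘁ)) = (valMap F (ε_ (Yᘁ ⊗ Xᘁ) ((Xᘁ)ᘁ ⊗ (Yᘁ)ᘁ)) ∘ₗ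
      (F.map (i ⊗ₘ j)).toLin).flip := by
    refine pr_ext fun g h => pr_ext fun x y => ?_
    rw [LinearMap.flip_apply, LinearMap.comp_apply, map_tensorHom_pr, valMap_apply, valMap_apply]
    refine funext fun c => ?_
    rw [val_tensor, val_tensor, hi, hj, mul_comm]
  exact LinearMap.congr_fun (LinearMap.congr_fun h q) t

/-- Tested against `F(X^*)`, both sides give the image under `F` of the evaluation of `X`, since
`dualComparison` is compatible with evaluations. In the target category the identity functor
computes values. -/
lemma double_dual_functor {X : C} {i : X ⟶ (Xᘁ)ᘁ} {j : F.obj X ⟶ ((F.obj X)ᘁ)ᘁ}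
    (hi : IsDoubleDual F i) (hj : IsDoubleDual (𝟭 _) j) :
    F.map i ≫ dualComparison F (Xᘁ) = j ≫ (dualComparison F X)ᘁ := by
  apply hom_eq_of_evaluation (HasRightDual.exact (X := (F.obj (Xᘁ))))
  change _ ≫ ε_ (F.obj (Xᘁ)) ((F.obj (Xᘁ))ᘁ) = _ ≫ ε_ (F.obj (Xᘁ)) ((F.obj (Xᘁ))ᘁ)
  refine val_injective (F := 𝟭 _) fun x f => ?_
  have h := val_whiskerRight (F := 𝟭 _) (dualComparison F X) (ε_ (F.obj X) ((F.obj X)ᘁ)) f x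
  rw [dualComparison_evaluation] at h
  rw [comp_whiskerRight, comp_whiskerRight, Category.assoc, Category.assoc,
    rightAdjointMate_comp_evaluation, dualComparison_evaluation, val_whiskerRight,
    val_whiskerRight, val_whiskerLeft, hj]
  exact (hi x f).trans h
end Pivotal

end FiberElements

/-! ### The two pivotal structures. -/

section Pivotal
variable {k : Type u} [Field k] [CharZero k] {G : Type u} [Group G] [Fintype G] [Supergroup G]
open DoubleModule

/-- The isomorphism `V ≅ W^∨` defined by an isomorphism `W ≅ V^∨`. -/
def dualFlip {V W : DoubleModule k G} (e : W ≅ dual V) : V ≅ dual W :=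
  isoOfInv
    (homMk (X := V) (Y := dual W) (LinearMap.flip (e.hom.toLin : W →ₗ[k] Module.Dual k V))
      (fun g x => dual_ext fun w => by
        rw [app_ρ]
        change app (e.hom.toLin w) (V.ρ g x) = app (e.hom.toLin (W.ρ g⁻¹ w)) x
        rw [toLin_ρ, app_ρ, inv_inv])
      (fun g x => dual_ext fun w => by
        rw [app_δ]
        change app (e.hom.toLin w) (V.δ g x) = app (e.hom.toLin (W.δ g w)) x
        rw [toLin_δ, app_δ]))
    -- The inverse pulls a functional on `W` back to `V^*` along the inverse of `e`; finite
    -- dimension makes it the evaluation at a vector of `V`.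
    ((Module.evalEquiv k V).symm.toLinearMap ∘ₗ
      Module.Dual.transpose (R := k) (M := Module.Dual k V) (M' := W) e.inv.toLin)
    (by
      refine LinearMap.ext fun x => ?_
      refine (LinearEquiv.symm_apply_eq (Module.evalEquiv k V)).mpr ?_
      refine LinearMap.ext fun (f : Module.Dual k V) => ?_
      have h : e.hom.toLin (e.inv.toLin f) = f :=
        LinearMap.congr_fun (congrArg Hom.toLin e.inv_hom_id) f
      exact congrArg (fun f => app f x) h)
    (by
      refine LinearMap.ext fun (x : Module.Dual k W) => dual_ext fun w => ?_
      refine (Module.apply_evalEquiv_symm_apply (R := k) (M := V) (e.hom.toLin w) _).trans ?_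
      have h : e.inv.toLin (e.hom.toLin w) = w :=
        LinearMap.congr_fun (congrArg Hom.toLin e.hom_inv_id) w
      exact congrArg x h)

/-- No sign or twist intervenes, as the regraded projections of the dual are the transposes of those
of `V`. -/
lemma isDoubleDual_dualFlip (V : DoubleModule k G) :
    IsDoubleDual (𝟭 (DoubleModule k G)) (dualFlip (Iso.refl (dual V))).hom := fun x f => by
  refine funext fun c => ?_
  refine (evLin_tz_apply (dual V) _ f c).trans (Eq.trans ?_ (evLin_tz_apply V f x c).symm)
  exact app_δ' c f x

variable (k G) in
/-- The pivotal structure of the category of modules over the Drinfeld double. -/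
def doublePivotal : PivotalStructure (DoubleModule k G) where
  iso V := dualFlip (Iso.refl (dual V))
  natural f := double_dual_natural (isDoubleDual_dualFlip _) (isDoubleDual_dualFlip _) f
  monoidal _ _ := double_dual_tensor (isDoubleDual_dualFlip _) (isDoubleDual_dualFlip _)
    (isDoubleDual_dualFlip _)

section
attribute [local instance] reducedMonoidal TMonoidal redRigid

/-- The isomorphism of an object of the center with its double dual. -/
def redDblDual (X : ReducedCenter k G) : X ≅ (Xᘁ)ᘁ :=
  TFullyFaithful.preimageIso (X := X) (Y := (Xᘁ)ᘁ) (dualFlip (counit (dual ((T k G).obj X))) ≪≫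
    (counit (dual ((T k G).obj (Xᘁ)))).symm)

lemma val_eval (X : ReducedCenter k G) (f : dual (TD X)) (x : TD X) (c : G) :
    val (T k G) (A := Xᘁ) (B := X) (ε_ X (Xᘁ)) (toT (dual (TD X)) f) x c =
      app f ((TD X).δ' c x) :=
  (congrFun (eval_tz X f x) c).trans (evLin_tz_apply (TD X) f x c)

lemma app_counit_δ' (V : DoubleModule k G) (c : G) (f : (T k G).obj (dual V).toCenter) (x : V) :
    app ((counit (dual V)).hom.toLin (((T k G).obj (dual V).toCenter).δ' c f)) x =
      app ((counit (dual V)).hom.toLin f) (V.δ' c x) := by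
  rw [toLin_δ', app_δ']

lemma isDoubleDual_redDblDual (X : ReducedCenter k G) :
    IsDoubleDual (T k G) (redDblDual X).hom := fun x f => by
  refine funext fun c => ?_
  refine Eq.trans ?_ (val_eval X f x c).symm
  refine (val_eval (Xᘁ) ((dualFlip (counit (dual ((T k G).obj X)))).hom.toLin x) f c).trans ?_
  exact app_counit_δ' ((T k G).obj X) c f x

variable (k G) in
/-- The pivotal structure of the center for the reduced tensor product. -/
def redPivotal : PivotalStructure (ReducedCenter k G) where
  iso := redDblDual
  natural f := double_dual_natural (isDoubleDual_redDblDual _) (isDoubleDual_redDblDual _) f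
  monoidal _ _ := double_dual_tensor (isDoubleDual_redDblDual _) (isDoubleDual_redDblDual _)
    (isDoubleDual_redDblDual _)

lemma isPivotalFunctor_T : IsPivotalFunctor (T k G) (redPivotal k G) (doublePivotal k G) :=
  fun X => double_dual_functor (isDoubleDual_redDblDual X) (isDoubleDual_dualFlip _)
end

/-- The center with the reduced tensor product is a pivotal monoidal category. -/
def reducedStructure [IsAlgClosed k] (S : IrrData k G) : ReducedStructure S :=
  letI := reducedMonoidal (k := k) (G := G)
  letI := redRigid (k := k) (G := G)
  { incl := fun X Y => redIncl X Y
    proj := fun X Y => redProj X Y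
    incl_proj := fun X Y => redIncl_redProj X Y
    proj_incl := fun X Y => redProj_redIncl S X Y
    half := fun X Y B => red_half S X Y B
    map := fun f g => red_map f g
    assoc := fun X Y Z => red_assoc X Y Z
    unit := redUnit S
    unit_half := fun B => red_unit_half S B
    left_unit := fun X => red_leftUnit S X
    right_unit := fun X => red_rightUnit S X
    dual := fun X => redDualIso X
    dual_half := fun X A => red_dual_half X A
    dual_ev := fun X => red_dual_ev S X
    dual_coev := fun X => red_dual_coev S X
    pivotal := redPivotal k G
    pivotal_eq := fun _ => rfl }

end Pivotal

/-! ### The fibers of the twisted product as direct sums of pieces. -/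

section Decomposition
variable {k : Type u} [Field k] [CharZero k] {G : Type u} [Group G] [Fintype G] [Supergroup G]
open DoubleModule

/-- The other ranges lie in the kernel of `e i`, while `e i` is the identity on its own range. -/
lemma iSupIndep_range_of_orthogonal {ι V : Type*} [AddCommGroup V] [Module k V]
    (e : ι → Module.End k V) (h : ∀ i j, e i * e j = if i = j then e i else 0) :
    iSupIndep fun i => LinearMap.range (e i) := by
  intro i
  rw [Submodule.disjoint_def]
  rintro _ ⟨x, rfl⟩ hx
  have h1 : (⨆ j, ⨆ (_ : j ≠ i), LinearMap.range (e j)) ≤ LinearMap.ker (e i) := by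
    refine iSup_le fun j => iSup_le fun hj => ?_
    rintro _ ⟨y, rfl⟩
    rw [LinearMap.mem_ker, ← Module.End.mul_apply, h, if_neg (Ne.symm hj)]; rfl
  have h2 := h1 hx
  rwa [LinearMap.mem_ker, ← Module.End.mul_apply, h, if_pos rfl] at h2

variable (V W : DoubleModule k G) (g : G)

/-- The projection of `V ⊗ W` to the tensor product of two pieces. -/
def pieceProj (p : Fin 2 × Fin 2) : Module.End k (V ⊗[k] W) :=
  TensorProduct.map (V.δ (g * Supergroup.z ^ (p.2 : ℕ)) * par V.ρ p.1)
    (W.δ (g * Supergroup.z ^ (p.1 : ℕ)) * par W.ρ p.2)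

lemma δ_par_mul (a b : G) (σ τ : Fin 2) : (V.δ a * par V.ρ σ) * (V.δ b * par V.ρ τ) =
    if σ = τ then (if a = b then V.δ a * par V.ρ σ else 0) else 0 := by
  rw [mul_assoc, ← mul_assoc (par V.ρ σ), V.isGrading.par_comm, mul_assoc (V.δ b), ← mul_assoc,
    V.isGrading.orth, par_mul]
  split_ifs <;> simp

/-- Distinct pieces differ in a parity, and projections to different parities are orthogonal. -/
lemma pieceProj_mul (p q : Fin 2 × Fin 2) :
    pieceProj V W g p * pieceProj V W g q = if p = q then pieceProj V W g p else 0 := by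
  rw [pieceProj, pieceProj, ← TensorProduct.map_mul, δ_par_mul, δ_par_mul]
  by_cases h1 : p.1 = q.1 <;> by_cases h2 : p.2 = q.2
  · rw [if_pos h1, if_pos h2, if_pos (by rw [h2]), if_pos (by rw [h1]), if_pos (Prod.ext h1 h2)]
  · rw [if_neg h2, TensorProduct.map_zero_right, if_neg fun h => h2 (congrArg Prod.snd h)]
  · rw [if_neg h1, TensorProduct.map_zero_left, if_neg fun h => h1 (congrArg Prod.fst h)]
  · rw [if_neg h1, TensorProduct.map_zero_left, if_neg fun h => h1 (congrArg Prod.fst h)]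

lemma range_pieceProj (p : Fin 2 × Fin 2) : LinearMap.range (pieceProj V W g p) =
    LinearMap.range (TensorProduct.mapIncl (V.piece p.1 (g * Supergroup.z ^ (p.2 : ℕ)))
      (W.piece p.2 (g * Supergroup.z ^ (p.1 : ℕ)))) := by
  rw [piece, piece, range_map_eq]; rfl

lemma fproj_eq_sum : fproj V W g = ∑ p, pieceProj V W g p := by
  rw [Fintype.sum_prod_type]; rfl

lemma iSupIndep_piece : iSupIndep (fun p : Fin 2 × Fin 2 => LinearMap.range (TensorProduct.mapIncl
    (V.piece p.1 (g * Supergroup.z ^ (p.2 : ℕ))) (W.piece p.2 (g * Supergroup.z ^ (p.1 : ℕ))))) := by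
  simp only [← range_pieceProj]
  exact iSupIndep_range_of_orthogonal _ fun p q => by rw [pieceProj_mul]; congr

lemma fproj_of_mem {s : V ⊗[k] W} (hs : s ∈ twFiber V W g) : fproj V W g s = s := by
  have : twFiber V W g ≤ LinearMap.eqLocus (fproj V W g) LinearMap.id := by
    refine iSup_le fun σ => iSup_le fun τ => ?_
    rw [← range_pieceProj V W g (σ, τ)]
    rintro _ ⟨t, rfl⟩
    change fproj V W g _ = _
    rw [fproj_eq_sum, ← Module.End.mul_apply, Finset.sum_mul]
    simp only [pieceProj_mul]
    simp
  exact this hs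

/-- `δ_g` acts on the twisted product as `fproj`, whose values lie in the twisted fiber and which
fixes that fiber pointwise. -/
lemma map_fiber : ((V ⊗ W : DoubleModule k G).fiber g).map (J V W) = twFiber V W g := by
  refine le_antisymm ?_ fun s hs => ?_
  · rintro _ ⟨_, ⟨t, rfl⟩, rfl⟩
    exact (J_δ g t).symm ▸ fproj_mem_fiber g _
  · let t : tens V W := ⟨s, Submodule.mem_iSup_of_mem g hs⟩
    exact ⟨(tens V W).δ g t, ⟨t, rfl⟩, (J_δ g t).trans (fproj_of_mem V W g hs)⟩
end Decomposition
end RedCenter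

end

theorem theoremt {k : Type u} [Field k] [IsAlgClosed k] [CharZero k] {G : Type u} [Group G]
    [Fintype G] [Supergroup G] :
    Nonempty (IrrData k G) ∧ ∀ S : IrrData k G,
      ∃ (R : ReducedStructure S) (P : PivotalStructure (DoubleModule k G)),
        letI := R.mon
        letI := R.rigid
        ∃ _ : (T k G).Monoidal,
          (T k G).IsEquivalence ∧
          (∀ (X Y : ReducedCenter k G) (t : ((T k G).obj X ⊗ (T k G).obj Y : DoubleModule k G)),
            lin (R.incl X Y) ((Functor.LaxMonoidal.μ (T k G) X Y).toLin t) =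
              DoubleModule.J ((T k G).obj X) ((T k G).obj Y) t) ∧
          (∀ V : DoubleModule k G, (P.iso V).hom.toLin = V.dblDual) ∧
          IsPivotalFunctor (T k G) R.pivotal P ∧
          ∀ (V W : DoubleModule k G) (g : G),
            iSupIndep (fun p : Fin 2 × Fin 2 => LinearMap.range (TensorProduct.mapIncl
              (V.piece p.1 (g * Supergroup.z ^ (p.2 : ℕ)))
              (W.piece p.2 (g * Supergroup.z ^ (p.1 : ℕ))))) ∧
            ((V ⊗ W : DoubleModule k G).fiber g).map (DoubleModule.J V W) =
              ⨆ (σ : Fin 2) (τ : Fin 2), LinearMap.range (TensorProduct.mapIncl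
                (V.piece σ (g * Supergroup.z ^ (τ : ℕ))) (W.piece τ (g * Supergroup.z ^ (σ : ℕ)))) :=
  -- The tensor constraint and the map to the double dual agree with the prescribed ones by
  -- definition, since all identifications involved are the identity on vectors.
  ⟨nonempty_irrData k G, fun S => ⟨reducedStructure S, doublePivotal k G, TMonoidal,
    inferInstance, fun _ _ _ => rfl, fun _ => rfl, isPivotalFunctor_T,
    fun V W g => ⟨iSupIndep_piece V W g, map_fiber V W g⟩⟩⟩
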